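/- For $N\ge 1$ and $\alpha\in\mathbb{R}$ let $\mathbf{A}_j(\mathbf{x}_1,\dots,\mathbf{x}_N)=\sum_{k\ne j}(\mathbf{x}_j-\mathbf{x}_k)^{-\perp}$, where $(x,y)^{-\perp}=(-y,x)/(x^2+y^2)$, and let $D_j=-i\nabla_{\mathbf{x}_j}+\alpha\mathbf{A}_j$ for $1\le j\le N$. Let $\mathscr{D}^N_\alpha\subset L^2_{\mathrm{sym}}(\mathbb{R}^{2N})$ be the domain of the closure in $L^2$ of the operator $\Psi\mapsto(D_j\Psi)_{j=1}^N$ defined on the permutation-symmetric functions in $C_c^\infty(\mathbb{R}^{2N}\setminus\{\mathbf{x}_j=\mathbf{x}_k\text{ for some }j\neq k\})$. With $Q_0=[0,1]^2$ put $$E^{\mathcal N}_N(\alpha)=\inf\Bigl\{\sum_{j=1}^N\int_{Q_0^N}|D_j\Psi|^2\;:\;\Psi\in\mathscr{D}^N_\alpha,\ \int_{Q_0^N}|\Psi|^2=1\Bigr\}$$ (Neumann ground-state energy), and let $E^{\mathcal D}_N(\alpha)$ (Dirichlet ground-state energy) be the same infimum restricted to those $\Psi$ whose support is a compact subset of $Q_0^N$.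 Then there are constants $0<C_1\le C_2<\infty$, $K<\infty$ and $N_0\in\mathbb{N}$ such that for all $0\le\alpha\le1$ and all $N\ge \max\{N_0,1\}$ $$C_1\,\alpha N^2\Bigl(1-\frac{K}{N}\Bigr)\le E^{\mathcal N}_N(\alpha)\le E^{\mathcal D}_N(\alpha)\le C_2\,\alpha N^2+KN .$$ Moreover, there are constants $K'<\infty$ and $0<\alpha_0\le1$ such that for all $0<\alpha\le\alpha_0$ $$\liminf_{N\to\infty}\frac{E^{\mathcal N}_N(\alpha)}{N^2}\ge\frac{\pi}{4}\,\alpha\bigl(1-K'\alpha^{1/3}\bigr).$$ -/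

import Mathlib

open MeasureTheory Filter Topology
open scoped ENNReal

noncomputable section

namespace Anyon

/-- A configuration `(x₁, …, x_N) ∈ (ℝ²)^N` of `N` points of the plane. The volume on this type is
Lebesgue measure on `ℝ^{2N}`. -/
abbrev Config (N : ℕ) : Type := Fin N → Fin 2 → ℝ

/-- The planar vector field `x^{-⊥} = x^⊥ / |x|² = (-y, x) / (x² + y²)`. -/
def perpInv (x : Fin 2 → ℝ) : Fin 2 → ℝ :=
  ![-(x 1) / (x 0 ^ 2 + x 1 ^ 2), x 0 / (x 0 ^ 2 + x 1 ^ 2)]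

/-- The magnetic potential `A_j = ∑_{k ≠ j} (x_j - x_k)^{-⊥}`. -/
def vecPot {N : ℕ} (j : Fin N) (x : Config N) : Fin 2 → ℝ :=
  ∑ k ∈ Finset.univ.erase j, perpInv (x j - x k)

/-- The set of configurations in which at least two particles coincide. -/
def diagonals (N : ℕ) : Set (Config N) := {x | ∃ j k : Fin N, j ≠ k ∧ x j = x k}

/-- The component in direction `a ∈ {0, 1}` of `D_j φ = -i ∇_{x_j} φ + α A_j φ`, for a
differentiable function `φ`. -/
def covDeriv {N : ℕ} (α : ℝ) (j : Fin N) (a : Fin 2) (φ : Config N → ℂ) (x : Config N) : ℂ :=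
  -Complex.I * fderiv ℝ φ x (Pi.single j (Pi.single a 1)) + (α : ℂ) * (vecPot j x a : ℂ) * φ x

/-- Permutation-symmetric smooth functions with compact support away from the diagonals. -/
structure IsTest {N : ℕ} (φ : Config N → ℂ) : Prop where
  smooth : ContDiff ℝ ((⊤ : ℕ∞) : WithTop ℕ∞) φ
  compact : HasCompactSupport φ
  off_diagonals : Disjoint (tsupport φ) (diagonals N)
  symm : ∀ (σ : Equiv.Perm (Fin N)) (x : Config N), φ (x ∘ σ) = φ x

/-- `IsCovGrad α Ψ F` says that `Ψ ∈ L²_sym(ℝ^{2N})` lies in the form domain of `N` ideal anyons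
with statistics parameter `α`, i.e. in the domain of the closed operator `(D_j)_j`, and that
`F j a` is the component in direction `a` of `D_j Ψ ∈ L²`. The operator is the closure in `L²` of
its restriction to the test functions `IsTest` (it coincides with the maximal realization). -/
structure IsCovGrad {N : ℕ} (α : ℝ) (Ψ : Config N → ℂ) (F : Fin N → Fin 2 → Config N → ℂ) :
    Prop where
  memLp : MemLp Ψ 2 volume
  symm : ∀ σ : Equiv.Perm (Fin N), (fun x : Config N => Ψ (x ∘ σ)) =ᵐ[volume] Ψ
  memLp_grad : ∀ j a, MemLp (F j a) 2 volume
  approx : ∃ φ : ℕ → Config N → ℂ, (∀ n, IsTest (φ n)) ∧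
    Tendsto (fun n => eLpNorm (φ n - Ψ) 2 volume) atTop (𝓝 0) ∧
    ∀ j a, Tendsto (fun n => eLpNorm (covDeriv α j a (φ n) - F j a) 2 volume) atTop (𝓝 0)

/-- The configurations `Ω^N` of `N` points of `Ω`. -/
def configsIn (N : ℕ) (Ω : Set (Fin 2 → ℝ)) : Set (Config N) := {x | ∀ j, x j ∈ Ω}

/-- The kinetic energy `∑_j ∫_{Ω^N} |D_j Ψ|²`, where `F j` is `D_j Ψ`. -/
def kineticEnergy {N : ℕ} (Ω : Set (Fin 2 → ℝ)) (F : Fin N → Fin 2 → Config N → ℂ) : ℝ≥0∞ :=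
  ∑ j, ∫⁻ x in configsIn N Ω, ∑ a, ‖F j a x‖ₑ ^ 2

/-- The Neumann ground-state energy of `N` anyons on `Ω`. -/
def neumannEnergy (N : ℕ) (α : ℝ) (Ω : Set (Fin 2 → ℝ)) : ℝ≥0∞ :=
  sInf {E | ∃ (Ψ : Config N → ℂ) (F : Fin N → Fin 2 → Config N → ℂ), IsCovGrad α Ψ F ∧
    ∫⁻ x in configsIn N Ω, ‖Ψ x‖ₑ ^ 2 = 1 ∧ E = kineticEnergy Ω F}

/-- The Dirichlet ground-state energy of `N` anyons on `Ω`: the same infimum over those `Ψ` that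
have compact support in `Ω`. -/
def dirichletEnergy (N : ℕ) (α : ℝ) (Ω : Set (Fin 2 → ℝ)) : ℝ≥0∞ :=
  sInf {E | ∃ (Ψ : Config N → ℂ) (F : Fin N → Fin 2 → Config N → ℂ), IsCovGrad α Ψ F ∧
    (∃ K : Set (Config N), IsCompact K ∧ K ⊆ configsIn N Ω ∧ ∀ᵐ x, x ∉ K → Ψ x = 0) ∧
    ∫⁻ x in configsIn N Ω, ‖Ψ x‖ₑ ^ 2 = 1 ∧ E = kineticEnergy Ω F}

/-- The unit square `[0,1]²`. -/
def unitSquare : Set (Fin 2 → ℝ) := Set.Icc 0 1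

end Anyon

end

open MeasureTheory Filter Topology
open scoped ENNReal

noncomputable section

namespace Anyon

/-! Lower bound. In the relative coordinate `u` of two particles, half a turn exchanges them, so on
a circle around `0` a symmetric wave function is `π`-periodic, while the flux over the half circle
is `π α`: particles outside the disc contribute nothing, by Cauchy's theorem. The operator `-i d/dθ
+ α` on `π`-periodic functions has the eigenvalues `2 n + α`, of modulus at least `α` when `0 ≤ α ≤
1`. This is an angular Hardy inequality. Combined with integration along rays from the diagonal,
where test functions vanish, it bounds `α` times the mass of close pairs by their energy
(`disc_estimate`). A diamagnetic Poincaré inequality, which does not see the potential at all,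
spreads the bound from close pairs to all pairs in a rectangle of bounded aspect ratio. The result
is `pair_estimate`: energy at least `(7 π / 4) α' / area`, with `α' = min α (1 / 100000)`.

Many particles are reached by bisecting cells. In a cell of area `A`, `n` particles are claimed to
have energy at least `(π / 4) α' w(n) / A`, where `w` is `pairWeight`. For `n ≤ 1` this is empty,
for `n = 2` it is the two-particle bound, and for `n ≥ 3` it follows from the two halves, since
halving the area doubles the energy scale and `w(m + n) ≤ 2 (w(m) + w(n))`. A test function
separates its particles by some `δ > 0`, so the bisection stops (`CellBound.square`). Since `w(N) ≥
(N + 4) (N - 1)`, the energy in the unit square is at least `(π / 4) α' (N + 4) (N - 1)`. Density of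
the test functions extends this to the form domain. For small `α` there is no error in `α` at all.

Upper bound. The square is cut into `m²` boxes, each holding at most `n` particles, with `α n ≤ 1`
and `N ≤ n m²`. Profiles supported well inside the boxes make `arg (x_j - x_k)` smooth for particles
of different boxes, and a phase built from these angles gauges away their interaction exactly.
Particles of the same box are kept apart by a logarithmic cutoff with gradient of order `1 / (n
|z|)`. Its square integral costs only `1 / n` per pair, and the bound `α ≤ 1 / n` makes the
remaining potential no larger than this gradient. The energy per particle is then of order `m²`.
Summing over all distributions of the particles symmetrizes the state without cross terms, because
the supports are disjoint. With `n` of order `min (1 / α) N` and `m²` of order `N / n`, the total `N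
m²` is of order `α N² + N`. -/

/-! ### Magnetic Hardy inequality on a half circle -/

theorem alpha_sq_le_shift (α : ℝ) (h0 : 0 ≤ α) (h1 : α ≤ 1) (n : ℤ) :
    α ^ 2 ≤ (2 * (n : ℝ) + α) ^ 2 := by
  rcases le_or_gt 0 n with hn | hn
  · have : (0 : ℝ) ≤ n := by exact_mod_cast hn
    nlinarith
  · have : (n : ℝ) ≤ -1 := by exact_mod_cast (by omega : n ≤ -1)
    nlinarith

theorem memLp_two_of_continuous {f : ℝ → ℂ} (hf : Continuous f) (a b : ℝ) :
    MemLp f 2 (volume.restrict (Set.Ioc a b)) := by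
  have : MemLp f ⊤ (volume.restrict (Set.Ioc a b)) := by
    obtain ⟨C, hC⟩ := isCompact_Icc.exists_bound_of_continuousOn (s := Set.Icc a b) hf.continuousOn
    refine memLp_top_of_bound hf.aestronglyMeasurable C ?_
    refine (ae_restrict_iff' measurableSet_Ioc).2 (ae_of_all _ fun x hx => hC x ⟨hx.1.le, hx.2⟩)
  exact this.mono_exponent le_top

/-- The Fourier modes of period `π` diagonalize `-i d/dt + α` with eigenvalues `2 n + α`, so
Parseval reduces the claim to `α² ≤ (2 n + α)²`. Periodicity removes the boundary term in the
coefficients of `v'`. -/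
theorem periodic_hardy (α : ℝ) (h0 : 0 ≤ α) (h1 : α ≤ 1) (c : ℝ) (v v' : ℝ → ℂ)
    (hv : ∀ t, HasDerivAt v (v' t) t) (hv' : Continuous v')
    (hper : v (c + Real.pi) = v c) :
    α ^ 2 * ∫ t in c..c + Real.pi, ‖v t‖ ^ 2 ≤
      ∫ t in c..c + Real.pi, ‖v' t + Complex.I * α * v t‖ ^ 2 := by
  have hvc : Continuous v := continuous_iff_continuousAt.2 fun t => (hv t).continuousAt
  have hab : c < c + Real.pi := by linarith [Real.pi_pos]
  have hπ := Real.pi_pos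
  set g : ℝ → ℂ := fun t => v' t + Complex.I * α * v t with hg
  have hgc : Continuous g := by fun_prop
  have hcoef : ∀ n : ℤ, fourierCoeffOn hab g n =
      Complex.I * ((2 * (n : ℝ) + α : ℝ) : ℂ) * fourierCoeffOn hab v n := by
    intro n
    have hadd : fourierCoeffOn hab g n =
        fourierCoeffOn hab v' n + Complex.I * α * fourierCoeffOn hab v n := by
      simp only [fourierCoeffOn_eq_integral, hg]
      rw [mul_smul_comm, ← smul_add, ← intervalIntegral.integral_const_mul,
        ← intervalIntegral.integral_add]
      · congr 1
        refine intervalIntegral.integral_congr fun t _ => ?_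
        simp only [smul_eq_mul]; ring
      · refine Continuous.intervalIntegrable ?_ _ _
        have : Continuous fun x : ℝ => (x : AddCircle (c + Real.pi - c)) := AddCircle.continuous_mk' _
        fun_prop
      · refine Continuous.intervalIntegrable ?_ _ _
        have : Continuous fun x : ℝ => (x : AddCircle (c + Real.pi - c)) := AddCircle.continuous_mk' _
        fun_prop
    have hderiv : fourierCoeffOn hab v' n = Complex.I * (2 * n) * fourierCoeffOn hab v n := by
      -- The integration by parts formula divides by `n`; the mean of `v'` is the difference of the
      -- equal end values.
      rcases eq_or_ne n 0 with rfl | hn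
      · simp only [fourierCoeffOn_eq_integral]
        have := intervalIntegral.integral_eq_sub_of_hasDerivAt (a := c) (b := c + Real.pi)
          (fun t _ => hv t) (hv'.intervalIntegrable _ _)
        simp [this, hper]
      · have := fourierCoeffOn_of_hasDerivAt hab hn (fun t _ => hv t)
          (hv'.intervalIntegrable c (c + Real.pi))
        rw [this, hper]
        have hn' : (n : ℂ) ≠ 0 := by exact_mod_cast hn
        have hpc : (Real.pi : ℂ) ≠ 0 := by exact_mod_cast hπ.ne'
        push_cast
        field_simp
        ring
    rw [hadd, hderiv]; push_cast; ring
  have hs1 := hasSum_sq_fourierCoeffOn hab (memLp_two_of_continuous hvc c (c + Real.pi))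
  have hs2 := hasSum_sq_fourierCoeffOn hab (memLp_two_of_continuous hgc c (c + Real.pi))
  have hle := hasSum_le (fun n => ?_) (hs1.mul_left (α ^ 2)) hs2
  · have e : c + Real.pi - c = Real.pi := by ring
    rw [e, smul_eq_mul, smul_eq_mul] at hle
    have hpi : 0 < Real.pi⁻¹ := inv_pos.2 hπ
    nlinarith
  · rw [hcoef n, norm_mul, norm_mul, Complex.norm_I, one_mul, Complex.norm_real, mul_pow]
    refine mul_le_mul_of_nonneg_right ?_ (by positivity)
    rw [Real.norm_eq_abs, sq_abs]
    exact alpha_sq_le_shift α h0 h1 n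

/-- Hardy inequality on a half circle with magnetic flux `π α`. -/
theorem halfCircle_hardy (α : ℝ) (h0 : 0 ≤ α) (h1 : α ≤ 1) (c : ℝ) (u u' : ℝ → ℂ) (a : ℝ → ℝ)
    (hu : ∀ t, HasDerivAt u (u' t) t) (hu' : Continuous u') (ha : Continuous a)
    (hper : u (c + Real.pi) = u c) (hflux : ∫ t in c..c + Real.pi, a t = Real.pi * α) :
    α ^ 2 * ∫ t in c..c + Real.pi, ‖u t‖ ^ 2 ≤
      ∫ t in c..c + Real.pi, ‖-Complex.I * u' t + a t * u t‖ ^ 2 := by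
  -- A gauge phase that replaces `a` by its mean `α`. The flux condition makes `b` vanish at both
  -- ends of the interval, so multiplication by `E` preserves the periodicity.
  set b : ℝ → ℝ := fun t => (∫ s in c..t, a s) - α * (t - c) with hb
  have hbd : ∀ t, HasDerivAt b (a t - α) t := by
    intro t
    have h1 := intervalIntegral.integral_hasDerivAt_right (a := c) (b := t)
      (ha.intervalIntegrable _ _) (ha.stronglyMeasurableAtFilter _ _) ha.continuousAt
    have h2 : HasDerivAt (fun t => α * (t - c)) α t := by
      simpa using ((hasDerivAt_id t).sub_const c).const_mul α
    exact h1.sub h2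
  set E : ℝ → ℂ := fun t => Complex.exp ((b t : ℂ) * Complex.I) with hE
  have hEn : ∀ t, ‖E t‖ = 1 := fun t => Complex.norm_exp_ofReal_mul_I _
  have hEd : ∀ t, HasDerivAt E (E t * ((a t - α : ℝ) * Complex.I)) t := fun t =>
    (((hbd t).ofReal_comp).mul_const Complex.I).cexp
  have hEc : Continuous E := continuous_iff_continuousAt.2 fun t => (hEd t).continuousAt
  have huc : Continuous u := continuous_iff_continuousAt.2 fun t => (hu t).continuousAt
  have key := periodic_hardy α h0 h1 c (fun t => E t * u t)
    (fun t => E t * ((a t - α : ℝ) * Complex.I) * u t + E t * u' t)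
    (fun t => (hEd t).mul (hu t)) (by fun_prop) (by
      have h1 : b c = 0 := by simp [hb]
      have h2 : b (c + Real.pi) = 0 := by simp [hb, hflux]; ring
      simp [hE, h1, h2, hper])
  refine le_of_eq_of_le ?_ (key.trans_eq ?_)
  · congr 1
    refine intervalIntegral.integral_congr fun t _ => ?_
    simp [hEn]
  · refine intervalIntegral.integral_congr fun t _ => ?_
    have : E t * ((a t - α : ℝ) * Complex.I) * u t + E t * u' t + Complex.I * α * (E t * u t)
        = E t * (Complex.I * (-Complex.I * u' t + a t * u t)) := by
      push_cast; linear_combination (E t * u' t) * Complex.I_mul_I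
    simp only [this, norm_mul, hEn, Complex.norm_I, one_mul]

/-! ### Diamagnetic and Poincaré inequalities -/

/-- Integrated diamagnetic inequality along a line. -/
theorem abs_norm_sub_norm_le {u u' : ℝ → ℂ} (a : ℝ → ℝ) (hu : ∀ t, HasDerivAt u (u' t) t)
    (hu' : Continuous u') {s t : ℝ} (hst : s ≤ t) :
    ENNReal.ofReal |‖u t‖ - ‖u s‖| ≤
      ∫⁻ τ in Set.Ioc s t, ‖-Complex.I * u' τ + a τ * u τ‖ₑ := by
  have huc : Continuous u := continuous_iff_continuousAt.2 fun t => (hu t).continuousAt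
  -- The modulus is not differentiable at zeros of `u`; the regularization by `ε` is removed at the
  -- end by continuity.
  have main : ∀ ε : ℝ, 0 < ε →
      ENNReal.ofReal |√(‖u t‖ ^ 2 + ε ^ 2) - √(‖u s‖ ^ 2 + ε ^ 2)| ≤
      ∫⁻ τ in Set.Ioc s t, ‖-Complex.I * u' τ + a τ * u τ‖ₑ := by
    intro ε hε
    set f : ℝ → ℝ := fun τ => √(‖u τ‖ ^ 2 + ε ^ 2)
    set f' : ℝ → ℝ := fun τ => (2 * inner ℝ (u τ) (u' τ)) / (2 * √(‖u τ‖ ^ 2 + ε ^ 2))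
    have hf : ∀ τ, HasDerivAt f (f' τ) τ := fun τ =>
      (((hu τ).norm_sq).add_const (ε ^ 2)).sqrt (by positivity)
    have hf'c : Continuous f' := by
      refine Continuous.div (by fun_prop) (by fun_prop) fun τ => ?_
      positivity
    have hFTC := intervalIntegral.integral_eq_sub_of_hasDerivAt (a := s) (b := t)
          (fun t _ => hf t) (hf'c.intervalIntegrable _ _)
    have hb : ∀ τ, ‖f' τ‖ₑ ≤ ‖-Complex.I * u' τ + a τ * u τ‖ₑ := by
      intro τ
      rw [enorm_le_iff_norm_le]
      -- The vector `i a u` is orthogonal to `u` in the real inner product, so the potential may be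
      -- inserted for free.
      have e : inner ℝ (u τ) (u' τ) = inner ℝ (u τ) (Complex.I * (-Complex.I * u' τ + a τ * u τ)) := by
        simp [Complex.inner]; ring
      simp only [f', e]
      rw [mul_div_mul_left _ _ two_ne_zero, norm_div, Real.norm_eq_abs, Real.norm_eq_abs,
        abs_of_nonneg (Real.sqrt_nonneg _), div_le_iff₀ (by positivity)]
      refine (abs_real_inner_le_norm _ _).trans ?_
      rw [norm_mul, Complex.norm_I, one_mul, mul_comm]
      gcongr
      exact Real.le_sqrt_of_sq_le (by nlinarith)
    rw [← hFTC, intervalIntegral.integral_of_le hst, ← Real.enorm_eq_ofReal_abs]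
    exact (enorm_integral_le_lintegral_enorm _).trans (lintegral_mono hb)
  have lim : Tendsto (fun ε : ℝ => ENNReal.ofReal |√(‖u t‖ ^ 2 + ε ^ 2) - √(‖u s‖ ^ 2 + ε ^ 2)|)
      (𝓝[>] 0) (𝓝 (ENNReal.ofReal |‖u t‖ - ‖u s‖|)) := by
    have : Continuous fun ε : ℝ => ENNReal.ofReal |√(‖u t‖ ^ 2 + ε ^ 2) - √(‖u s‖ ^ 2 + ε ^ 2)| := by
      exact ENNReal.continuous_ofReal.comp (by fun_prop)
    have h := (this.tendsto 0).mono_left (nhdsWithin_le_nhds (s := Set.Ioi 0))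
    simpa using h
  exact le_of_tendsto lim (eventually_mem_nhdsWithin.mono main)

theorem sq_setLIntegral_le {X : Type*} [MeasurableSpace X] (μ : Measure X) {f : X → ℝ≥0∞}
    (hf : AEMeasurable f μ) : (∫⁻ x, f x ∂μ) ^ 2 ≤ μ Set.univ * ∫⁻ x, f x ^ 2 ∂μ := by
  have h := ENNReal.lintegral_mul_le_Lp_mul_Lq μ Real.HolderConjugate.two_two hf
    (aemeasurable_const (b := (1 : ℝ≥0∞)))
  simp only [Pi.mul_apply, mul_one, ENNReal.one_rpow, lintegral_const, one_mul] at h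
  calc (∫⁻ x, f x ∂μ) ^ 2 ≤ ((∫⁻ x, f x ^ (2 : ℝ) ∂μ) ^ (1 / 2 : ℝ) * μ Set.univ ^ (1 / 2 : ℝ)) ^ 2 := by
        gcongr
    _ = _ := by
        rw [mul_pow, ← ENNReal.rpow_natCast, ← ENNReal.rpow_mul, ← ENNReal.rpow_natCast,
          ← ENNReal.rpow_mul]
        norm_num [mul_comm]

/-- Two values of `|u|` differ by at most the integral of the covariant derivative over the
interval. Cauchy–Schwarz gives one factor `ℓ`, the double integration the other two. The potential
is only required to be measurable. -/
theorem line_poincare {u u' : ℝ → ℂ} {a : ℝ → ℝ} (ha : Measurable a)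
    (hu : ∀ t, HasDerivAt u (u' t) t) (hu' : Continuous u') (c ℓ : ℝ) :
    ∫⁻ s in Set.Ico c (c + ℓ), ∫⁻ t in Set.Ico c (c + ℓ), ‖‖u s‖ - ‖u t‖‖ₑ ^ 2 ≤
      ENNReal.ofReal ℓ ^ 3 * ∫⁻ t in Set.Ico c (c + ℓ), ‖-Complex.I * u' t + a t * u t‖ₑ ^ 2 := by
  have huc : Continuous u := continuous_iff_continuousAt.2 fun t => (hu t).continuousAt
  set g : ℝ → ℝ≥0∞ := fun t => ‖-Complex.I * u' t + a t * u t‖ₑ with hg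
  have hgm : Measurable g := by fun_prop
  have hvol : volume.restrict (Set.Ico c (c + ℓ)) Set.univ = ENNReal.ofReal ℓ := by simp
  have hpt : ∀ s ∈ Set.Ico c (c + ℓ), ∀ t ∈ Set.Ico c (c + ℓ), ‖‖u s‖ - ‖u t‖‖ₑ ^ 2 ≤
      ENNReal.ofReal ℓ * ∫⁻ t in Set.Ico c (c + ℓ), g t ^ 2 := by
    intro s hs t ht
    have h1 : ‖‖u s‖ - ‖u t‖‖ₑ ≤ ∫⁻ t in Set.Ico c (c + ℓ), g t := by
      rcases le_total s t with h | h
      · rw [← enorm_neg, neg_sub, Real.enorm_eq_ofReal_abs]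
        exact (abs_norm_sub_norm_le a hu hu' h).trans
          (lintegral_mono_set fun x hx => ⟨hs.1.trans hx.1.le, hx.2.trans_lt ht.2⟩)
      · rw [Real.enorm_eq_ofReal_abs]
        exact (abs_norm_sub_norm_le a hu hu' h).trans
          (lintegral_mono_set fun x hx => ⟨ht.1.trans hx.1.le, hx.2.trans_lt hs.2⟩)
    calc _ ≤ (∫⁻ t in Set.Ico c (c + ℓ), g t) ^ 2 := by gcongr
      _ ≤ _ := by
        have := sq_setLIntegral_le (volume.restrict (Set.Ico c (c + ℓ))) hgm.aemeasurable
        rwa [hvol] at this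
  calc _ ≤ ∫⁻ s in Set.Ico c (c + ℓ), ∫⁻ t in Set.Ico c (c + ℓ),
        (ENNReal.ofReal ℓ * ∫⁻ t in Set.Ico c (c + ℓ), g t ^ 2) :=
        setLIntegral_mono' measurableSet_Ico fun s hs =>
          setLIntegral_mono' measurableSet_Ico fun t ht => hpt s hs t ht
    _ = _ := by
        simp only [lintegral_const, hvol]
        ring

/-- The Poincaré inequality tensorizes. -/
theorem prod_poincare {X Y : Type*} [MeasurableSpace X] [MeasurableSpace Y] (μ : Measure X)
    (ν : Measure Y) [SFinite μ] [SFinite ν] {g : X → Y → ℝ} (hg : Measurable fun z : X × Y => g z.1 z.2)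
    {F G : X → Y → ℝ≥0∞} (hF : Measurable fun z : X × Y => F z.1 z.2)
    (hG : Measurable fun z : X × Y => G z.1 z.2) (a b : ℝ≥0∞)
    (hX : ∀ y, ∫⁻ x, ∫⁻ x', ‖g x y - g x' y‖ₑ ^ 2 ∂μ ∂μ ≤ a * ∫⁻ x, F x y ∂μ)
    (hY : ∀ x, ∫⁻ y, ∫⁻ y', ‖g x y - g x y'‖ₑ ^ 2 ∂ν ∂ν ≤ b * ∫⁻ y, G x y ∂ν) :
    ∫⁻ x, ∫⁻ y, ∫⁻ x', ∫⁻ y', ‖g x y - g x' y'‖ₑ ^ 2 ∂ν ∂μ ∂ν ∂μ ≤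
      2 * a * ν Set.univ * (∫⁻ x, ∫⁻ y, F x y ∂ν ∂μ) +
        2 * b * μ Set.univ * (∫⁻ x, ∫⁻ y, G x y ∂ν ∂μ) := by
  -- The coordinates are changed one at a time, through the intermediate point `(x', y)`.
  have hpt : ∀ x y x' y', ‖g x y - g x' y'‖ₑ ^ 2 ≤
      2 * ‖g x y - g x' y‖ₑ ^ 2 + 2 * ‖g x' y - g x' y'‖ₑ ^ 2 := by
    intro x y x' y'
    have : ∀ r : ℝ, ‖r‖ₑ ^ 2 = ENNReal.ofReal (r ^ 2) := fun r => by
      rw [Real.enorm_eq_ofReal_abs, ← ENNReal.ofReal_pow (abs_nonneg _), sq_abs]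
    simp only [this]
    rw [← ENNReal.ofReal_ofNat 2, ← ENNReal.ofReal_mul (by norm_num),
      ← ENNReal.ofReal_mul (by norm_num), ← ENNReal.ofReal_add (by positivity) (by positivity)]
    exact ENNReal.ofReal_le_ofReal (by nlinarith [sq_nonneg (g x y - g x' y - (g x' y - g x' y'))])
  have m1 : Measurable fun z : (X × Y) × X => ‖g z.1.1 z.1.2 - g z.2 z.1.2‖ₑ ^ 2 := by
    have h2 : Measurable fun z : (X × Y) × X => g z.1.1 z.1.2 := hg.comp measurable_fst
    have h3 : Measurable fun z : (X × Y) × X => g z.2 z.1.2 :=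
      hg.comp (measurable_snd.prodMk (measurable_snd.comp measurable_fst))
    fun_prop
  have m2 : Measurable fun z : (X × Y) × Y => ‖g z.1.1 z.1.2 - g z.1.1 z.2‖ₑ ^ 2 := by
    have h2 : Measurable fun z : (X × Y) × Y => g z.1.1 z.1.2 := hg.comp measurable_fst
    have h3 : Measurable fun z : (X × Y) × Y => g z.1.1 z.2 :=
      hg.comp ((measurable_fst.comp measurable_fst).prodMk measurable_snd)
    fun_prop
  obtain ⟨A, hA⟩ : ∃ A : X → Y → ℝ≥0∞, ∀ x y, A x y = ∫⁻ x', ‖g x y - g x' y‖ₑ ^ 2 ∂μ :=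
    ⟨_, fun _ _ => rfl⟩
  obtain ⟨B, hB⟩ : ∃ B : X → Y → ℝ≥0∞, ∀ x y, B x y = ∫⁻ y', ‖g x y - g x y'‖ₑ ^ 2 ∂ν :=
    ⟨_, fun _ _ => rfl⟩
  have mA : Measurable fun z : X × Y => A z.1 z.2 := by
    simp only [hA]; exact m1.lintegral_prod_right'
  have mB : Measurable fun z : X × Y => B z.1 z.2 := by
    simp only [hB]; exact m2.lintegral_prod_right'
  have inner_le : ∀ x y, ∫⁻ x', ∫⁻ y', ‖g x y - g x' y'‖ₑ ^ 2 ∂ν ∂μ ≤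
      2 * ν Set.univ * A x y + 2 * ∫⁻ x', B x' y ∂μ := by
    intro x y
    have k0 : Measurable fun x' => g x' y := hg.comp (measurable_prodMk_right (y := y))
    have k1 : Measurable fun x' => ‖g x y - g x' y‖ₑ ^ 2 := by fun_prop
    have k2 : Measurable fun x' => B x' y := mB.comp measurable_prodMk_right
    calc _ ≤ ∫⁻ x', ∫⁻ y', (2 * ‖g x y - g x' y‖ₑ ^ 2 + 2 * ‖g x' y - g x' y'‖ₑ ^ 2) ∂ν ∂μ :=
          lintegral_mono fun x' => lintegral_mono fun y' => hpt x y x' y'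
      _ = ∫⁻ x', (2 * ν Set.univ * ‖g x y - g x' y‖ₑ ^ 2 + 2 * B x' y) ∂μ := by
          refine lintegral_congr fun x' => ?_
          rw [lintegral_add_left measurable_const, lintegral_const, lintegral_const_mul, hB]
          · ring
          · have k3 : Measurable fun y' => g x' y' := hg.comp (measurable_prodMk_left (x := x'))
            fun_prop
      _ = _ := by
          rw [lintegral_add_left (k1.const_mul _), lintegral_const_mul _ k1,
            lintegral_const_mul _ k2, hA]
  have hAX : ∀ y, ∫⁻ x, A x y ∂μ ≤ a * ∫⁻ x, F x y ∂μ := fun y => by simpa only [hA] using hX y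
  have hBY : ∀ x, ∫⁻ y, B x y ∂ν ≤ b * ∫⁻ y, G x y ∂ν := fun x => by simpa only [hB] using hY x
  have mAx : ∀ x, Measurable (A x) := fun x => mA.comp measurable_prodMk_left
  have mFx : ∀ x, Measurable (F x) := fun x => hF.comp measurable_prodMk_left
  have sA : ∫⁻ x, ∫⁻ y, A x y ∂ν ∂μ ≤ a * ∫⁻ x, ∫⁻ y, F x y ∂ν ∂μ := by
    calc _ = ∫⁻ y, ∫⁻ x, A x y ∂μ ∂ν := lintegral_lintegral_swap mA.aemeasurable
      _ ≤ ∫⁻ y, a * ∫⁻ x, F x y ∂μ ∂ν := lintegral_mono hAX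
      _ = a * ∫⁻ y, ∫⁻ x, F x y ∂μ ∂ν := lintegral_const_mul _ hF.lintegral_prod_left'
      _ = _ := by rw [lintegral_lintegral_swap (f := F) hF.aemeasurable]
  have sB : ∫⁻ x, ∫⁻ y, B x y ∂ν ∂μ ≤ b * ∫⁻ x, ∫⁻ y, G x y ∂ν ∂μ := by
    calc _ ≤ ∫⁻ x, b * ∫⁻ y, G x y ∂ν ∂μ := lintegral_mono hBY
      _ = _ := lintegral_const_mul _ hG.lintegral_prod_right'
  calc _ ≤ ∫⁻ x, ∫⁻ y, (2 * ν Set.univ * A x y + 2 * ∫⁻ x', B x' y ∂μ) ∂ν ∂μ :=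
        lintegral_mono fun x => lintegral_mono fun y => inner_le x y
    _ = ∫⁻ x, (2 * ν Set.univ * (∫⁻ y, A x y ∂ν) + 2 * ∫⁻ x, ∫⁻ y, B x y ∂ν ∂μ) ∂μ := by
        refine lintegral_congr fun x => ?_
        rw [lintegral_add_left ((mAx x).const_mul _), lintegral_const_mul _ (mAx x),
          lintegral_const_mul _ mB.lintegral_prod_left', 
          ← lintegral_lintegral_swap (f := B) mB.aemeasurable]
    _ = 2 * ν Set.univ * (∫⁻ x, ∫⁻ y, A x y ∂ν ∂μ) +
        2 * μ Set.univ * ∫⁻ x, ∫⁻ y, B x y ∂ν ∂μ := by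
        rw [lintegral_add_right _ measurable_const,
          lintegral_const_mul _ mA.lintegral_prod_right', lintegral_const]
        ring
    _ ≤ 2 * ν Set.univ * (a * ∫⁻ x, ∫⁻ y, F x y ∂ν ∂μ) +
        2 * μ Set.univ * (b * ∫⁻ x, ∫⁻ y, G x y ∂ν ∂μ) := by gcongr
    _ = _ := by ring

/-! ### Two particles in the relative coordinate -/

/-- The magnetic potential, tested in direction `v`, felt by a particle at `p` in the presence of
a particle at `q` and of fixed particles at `y l`. -/
def pairPot {ι : Type*} (s : Finset ι) (y : ι → ℂ) (p q v : ℂ) : ℝ :=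
  (v / (p - q)).im + ∑ l ∈ s, (v / (p - y l)).im

/-- The covariant derivative of a two-particle function in the first particle. -/
def covFst {ι : Type*} (α : ℝ) (s : Finset ι) (y : ι → ℂ) (ψ : ℂ × ℂ → ℂ) (v p q : ℂ) : ℂ :=
  -Complex.I * fderiv ℝ ψ (p, q) (v, 0) + ((α * pairPot s y p q v : ℝ) : ℂ) * ψ (p, q)

/-- The covariant derivative of a two-particle function in the second particle. -/
def covSnd {ι : Type*} (α : ℝ) (s : Finset ι) (y : ι → ℂ) (ψ : ℂ × ℂ → ℂ) (v p q : ℂ) : ℂ :=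
  -Complex.I * fderiv ℝ ψ (p, q) (0, v) + ((α * pairPot s y q p v : ℝ) : ℂ) * ψ (p, q)

/-- The kinetic energy density of a two-particle function. -/
def pairDensity {ι : Type*} (α : ℝ) (s : Finset ι) (y : ι → ℂ) (ψ : ℂ × ℂ → ℂ) (p q : ℂ) : ℝ≥0∞ :=
  (‖covFst α s y ψ 1 p q‖ₑ ^ 2 + ‖covFst α s y ψ Complex.I p q‖ₑ ^ 2) +
    (‖covSnd α s y ψ 1 p q‖ₑ ^ 2 + ‖covSnd α s y ψ Complex.I p q‖ₑ ^ 2)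

theorem enorm_sq_eq_ofReal {E : Type*} [SeminormedAddCommGroup E] (z : E) :
    ‖z‖ₑ ^ 2 = ENNReal.ofReal (‖z‖ ^ 2) := by
  rw [← ofReal_norm, ENNReal.ofReal_pow (norm_nonneg _)]

theorem lintegral_ball_polar (ρ : ℝ) {h : ℂ → ℝ≥0∞} (hm : Measurable h) :
    ∫⁻ u in Metric.ball (0 : ℂ) ρ, h u =
      ∫⁻ r in Set.Ioo 0 ρ, ∫⁻ θ in Set.Ioc (-Real.pi) Real.pi,
        ENNReal.ofReal r * h (r * Complex.exp (θ * Complex.I)) := by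
  rw [← lintegral_indicator measurableSet_ball, ← Complex.lintegral_comp_polarCoord_symm,
    polarCoord_target, Measure.volume_eq_prod, ← Measure.prod_restrict, lintegral_prod]
  · rw [← lintegral_indicator measurableSet_Ioi, ← lintegral_indicator measurableSet_Ioo]
    refine lintegral_congr fun r => ?_
    by_cases hr : 0 < r
    · rw [Set.indicator_of_mem (Set.mem_Ioi.2 hr)]
      have hn : ∀ θ : ℝ, ‖Complex.polarCoord.symm (r, θ)‖ = r := fun θ => by
        rw [Complex.norm_polarCoord_symm, abs_of_pos hr]
      have he : ∀ θ : ℝ, Complex.polarCoord.symm (r, θ) = r * Complex.exp (θ * Complex.I) := fun θ => by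
        rw [Complex.polarCoord_symm_apply, Complex.exp_mul_I, Complex.ofReal_cos, Complex.ofReal_sin]
      by_cases hr2 : r < ρ
      · rw [Set.indicator_of_mem (show r ∈ Set.Ioo 0 ρ from ⟨hr, hr2⟩), restrict_Ioo_eq_restrict_Ioc]
        refine lintegral_congr fun θ => ?_
        simp only [smul_eq_mul]
        rw [Set.indicator_of_mem (by rw [mem_ball_zero_iff, hn]; exact hr2), he]
      · rw [Set.indicator_of_notMem (fun hh => hr2 hh.2)]
        have : ∀ θ : ℝ, (Metric.ball (0 : ℂ) ρ).indicator h (Complex.polarCoord.symm (r, θ)) = 0 :=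
          fun θ => Set.indicator_of_notMem (by rw [mem_ball_zero_iff, hn]; exact hr2) _
        simp only [this, smul_zero, lintegral_zero]
    · rw [Set.indicator_of_notMem (by simpa using hr),
        Set.indicator_of_notMem (fun hh => hr hh.1)]
  · refine Measurable.aemeasurable ?_
    have : Measurable fun p : ℝ × ℝ => Complex.polarCoord.symm p := by
      simp only [Complex.polarCoord_symm_apply]; fun_prop
    exact Measurable.smul (measurable_fst.ennreal_ofReal) ((hm.indicator measurableSet_ball).comp this)

/-- A point outside the circle carries no flux. Up to sign the second term is the first at the angle
`θ + π`, so the integral over the half circle is the imaginary part of the contour integral of `1 /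
(z - y)` over the whole circle, which vanishes by Cauchy's theorem. -/
theorem integral_im_div_sub_eq_zero {R y : ℂ} {r : ℝ} (hr : 0 < r) (hy : r < ‖y - R‖) (c : ℝ) :
    ∫ θ in c..c + Real.pi,
      ((Complex.I * (r * Complex.exp (θ * Complex.I)) / (R + r * Complex.exp (θ * Complex.I) - y)).im -
        (Complex.I * (r * Complex.exp (θ * Complex.I)) /
          (R - r * Complex.exp (θ * Complex.I) - y)).im) = 0 := by
  set k : ℝ → ℂ := fun θ =>
    Complex.I * (r * Complex.exp (θ * Complex.I)) / (R + r * Complex.exp (θ * Complex.I) - y) with hk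
  have hne : ∀ θ : ℝ, R + r * Complex.exp (θ * Complex.I) - y ≠ 0 := by
    intro θ h
    have : y - R = r * Complex.exp (θ * Complex.I) := by linear_combination -h
    rw [this, norm_mul, Complex.norm_exp_ofReal_mul_I, Complex.norm_real, Real.norm_eq_abs,
      abs_of_pos hr] at hy
    linarith
  have hkc : Continuous k := Continuous.div (by fun_prop) (by fun_prop) hne
  have hexp : ∀ θ : ℝ, Complex.exp (((θ + Real.pi : ℝ) : ℂ) * Complex.I) =
      -Complex.exp (θ * Complex.I) := fun θ => by
    push_cast; rw [add_mul, Complex.exp_add, Complex.exp_pi_mul_I]; ring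
  have hkpi : ∀ θ : ℝ, k (θ + Real.pi) = -(Complex.I * (r * Complex.exp (θ * Complex.I)) /
          (R - r * Complex.exp (θ * Complex.I) - y)) := by
    intro θ
    simp only [hk, hexp]
    rw [← neg_div]
    congr 1 <;> ring
  have hper : Function.Periodic k (2 * Real.pi) := by
    intro θ
    have : Complex.exp (((θ + 2 * Real.pi : ℝ) : ℂ) * Complex.I) = Complex.exp (θ * Complex.I) := by
      push_cast; rw [add_mul, Complex.exp_add, Complex.exp_two_pi_mul_I, mul_one]
    simp only [hk, this]
  have hcirc : ∫ θ in (0 : ℝ)..2 * Real.pi, k θ = 0 := by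
    have h0 : (∮ z in C(R, r), (z - y)⁻¹) = 0 := by
      refine DiffContOnCl.circleIntegral_eq_zero hr.le ?_
      refine (DifferentiableOn.diffContOnCl ?_)
      refine DifferentiableOn.inv (by fun_prop) fun z hz => ?_
      rw [closure_ball _ hr.ne', Metric.mem_closedBall, dist_eq_norm] at hz
      intro h
      rw [sub_eq_zero.1 h] at hz
      linarith
    rw [circleIntegral] at h0
    rw [← h0]
    refine intervalIntegral.integral_congr fun θ _ => ?_
    simp only [hk, deriv_circleMap, circleMap, smul_eq_mul]
    rw [div_eq_mul_inv]; ring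
  have e1 : ∀ θ : ℝ, ((k θ).im - (Complex.I * (r * Complex.exp (θ * Complex.I)) /
          (R - r * Complex.exp (θ * Complex.I) - y)).im) = (k θ).im + (k (θ + Real.pi)).im := by
    intro θ; rw [hkpi, Complex.neg_im]; ring
  have hki : Continuous fun θ => (k θ).im := by fun_prop
  calc _ = ∫ θ in c..c + Real.pi, ((k θ).im + (k (θ + Real.pi)).im) :=
        intervalIntegral.integral_congr fun θ _ => e1 θ
    _ = (∫ θ in c..c + Real.pi, (k θ).im) + ∫ θ in c..c + Real.pi, (k (θ + Real.pi)).im :=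
        intervalIntegral.integral_add (hki.intervalIntegrable _ _)
          (Continuous.intervalIntegrable (by fun_prop) _ _)
    _ = (∫ θ in c..c + Real.pi, (k θ).im) + ∫ θ in c + Real.pi..c + 2 * Real.pi, (k θ).im := by
        rw [intervalIntegral.integral_comp_add_right (fun θ => (k θ).im)]
        congr 2; ring
    _ = ∫ θ in c..c + 2 * Real.pi, (k θ).im :=
        intervalIntegral.integral_add_adjacent_intervals (hki.intervalIntegrable _ _)
          (hki.intervalIntegrable _ _)
    _ = ∫ θ in (0 : ℝ)..0 + 2 * Real.pi, (k θ).im :=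
        Function.Periodic.intervalIntegral_add_eq (fun θ => by rw [hper θ]) _ _
    _ = (∫ θ in (0 : ℝ)..2 * Real.pi, k θ).im := by
        rw [zero_add]
        exact Complex.imCLM.intervalIntegral_comp_comm (hkc.intervalIntegrable 0 (2 * Real.pi))
    _ = 0 := by rw [hcirc, Complex.zero_im]


section Disc

variable {ι : Type*} {α : ℝ} {s : Finset ι} {y : ι → ℂ} {ψ : ℂ × ℂ → ℂ}

theorem pairPot_linear (p q : ℂ) (a b : ℝ) (v w : ℂ) :
    pairPot s y p q (a * v + b * w) = a * pairPot s y p q v + b * pairPot s y p q w := by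
  have h : ∀ z : ℂ, ((a * v + b * w) / z).im = a * (v / z).im + b * (w / z).im := by
    intro z
    rw [add_div, mul_div_assoc, mul_div_assoc, Complex.add_im, Complex.im_ofReal_mul,
      Complex.im_ofReal_mul]
  simp only [pairPot, h, Finset.sum_add_distrib, mul_add, Finset.mul_sum]
  ring

/-- The covariant derivative in the relative coordinate `u`, where `p = R + u`, `q = R - u`. -/
def covRel (α : ℝ) (s : Finset ι) (y : ι → ℂ) (ψ : ℂ × ℂ → ℂ) (R v u : ℂ) : ℂ :=
  covFst α s y ψ v (R + u) (R - u) - covSnd α s y ψ v (R + u) (R - u)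

/-- The magnetic potential in the relative coordinate. -/
def relPot (s : Finset ι) (y : ι → ℂ) (R v u : ℂ) : ℝ :=
  pairPot s y (R + u) (R - u) v - pairPot s y (R - u) (R + u) v

theorem covRel_eq (R v u : ℂ) : covRel α s y ψ R v u =
    -Complex.I * fderiv ℝ ψ (R + u, R - u) (v, -v) +
      ((α * relPot s y R v u : ℝ) : ℂ) * ψ (R + u, R - u) := by
  have : ((v, -v) : ℂ × ℂ) = (v, 0) - (0, v) := by simp
  rw [this, map_sub, covRel, covFst, covSnd, relPot]
  push_cast; ring

theorem covRel_linear (R u : ℂ) (a b : ℝ) (v w : ℂ) :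
    covRel α s y ψ R (a * v + b * w) u =
      a * covRel α s y ψ R v u + b * covRel α s y ψ R w u := by
  simp only [covRel_eq, relPot, pairPot_linear]
  have : ((a * v + b * w, -(a * v + b * w)) : ℂ × ℂ) = a • (v, -v) + b • (w, -w) := by
    simp [Prod.smul_mk]; ring
  rw [this, map_add, map_smul, map_smul]
  simp only [Complex.real_smul]
  push_cast; ring

/-- The radial and angular directions are a rotation of the coordinate directions, and the covariant
derivative is real linear in the direction. This is what lets radial and angular energies be added.
-/
theorem norm_sq_covRel_rotate (R u : ℂ) (θ : ℝ) :
    ‖covRel α s y ψ R (Complex.exp (θ * Complex.I)) u‖ ^ 2 +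
      ‖covRel α s y ψ R (Complex.I * Complex.exp (θ * Complex.I)) u‖ ^ 2 =
    ‖covRel α s y ψ R 1 u‖ ^ 2 + ‖covRel α s y ψ R Complex.I u‖ ^ 2 := by
  have e1 : Complex.exp (θ * Complex.I) =
      (Real.cos θ : ℂ) * 1 + (Real.sin θ : ℂ) * Complex.I := by
    rw [Complex.exp_mul_I]; push_cast; ring
  have e2 : Complex.I * Complex.exp (θ * Complex.I) =
      ((-Real.sin θ : ℝ) : ℂ) * 1 + (Real.cos θ : ℂ) * Complex.I := by
    rw [Complex.exp_mul_I]; push_cast; linear_combination Complex.sin θ * Complex.I_mul_I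
  rw [e2, e1, covRel_linear, covRel_linear]
  generalize covRel α s y ψ R 1 u = A
  generalize covRel α s y ψ R Complex.I u = B
  simp only [← Complex.normSq_eq_norm_sq, Complex.normSq_apply, Complex.add_re, Complex.add_im,
    Complex.re_ofReal_mul, Complex.im_ofReal_mul]
  linear_combination (A.re ^ 2 + A.im ^ 2 + B.re ^ 2 + B.im ^ 2) * Real.sin_sq_add_cos_sq θ

theorem norm_sq_covRel_le (R u : ℂ) :
    ENNReal.ofReal (‖covRel α s y ψ R 1 u‖ ^ 2 + ‖covRel α s y ψ R Complex.I u‖ ^ 2) ≤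
      2 * pairDensity α s y ψ (R + u) (R - u) := by
  have h : ∀ z w : ℂ, ‖z - w‖ ^ 2 ≤ 2 * (‖z‖ ^ 2 + ‖w‖ ^ 2) := fun z w => by
    have := norm_sub_le z w
    nlinarith [sq_nonneg (‖z‖ - ‖w‖), norm_nonneg (z - w)]
  rw [pairDensity]
  simp only [enorm_sq_eq_ofReal]
  rw [← ENNReal.ofReal_add, ← ENNReal.ofReal_add, ← ENNReal.ofReal_add, ← ENNReal.ofReal_ofNat 2,
    ← ENNReal.ofReal_mul]
  · refine ENNReal.ofReal_le_ofReal ?_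
    have h1 := h (covFst α s y ψ 1 (R + u) (R - u)) (covSnd α s y ψ 1 (R + u) (R - u))
    have h2 := h (covFst α s y ψ Complex.I (R + u) (R - u)) (covSnd α s y ψ Complex.I (R + u) (R - u))
    simp only [covRel]
    linarith
  all_goals positivity

/-- The function `α |ψ|²` is integrated along the ray from the diagonal, where it vanishes. Young's
inequality `2 α |ψ| |Dψ| ≤ r |Dψ|² + (α² / r) |ψ|²` is weighted so that the last term is exactly
what the angular inequality controls. -/
theorem radial_estimate (h0 : 0 ≤ α) (hψ : ContDiff ℝ 1 ψ) (hdiag : ∀ p, ψ (p, p) = 0) (R : ℂ)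
    (θ : ℝ) {σ : ℝ} (hσ : 0 ≤ σ) :
    ENNReal.ofReal (α * ‖ψ (R + σ * Complex.exp (θ * Complex.I),
        R - σ * Complex.exp (θ * Complex.I))‖ ^ 2) ≤
      ∫⁻ r in Set.Ioc 0 σ, ENNReal.ofReal
        (r * ‖covRel α s y ψ R (Complex.exp (θ * Complex.I)) (r * Complex.exp (θ * Complex.I))‖ ^ 2 +
          α ^ 2 / r * ‖ψ (R + r * Complex.exp (θ * Complex.I),
            R - r * Complex.exp (θ * Complex.I))‖ ^ 2) := by
  set e := Complex.exp (θ * Complex.I)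
  set F : ℝ → ℂ := fun r => ψ (R + r * e, R - r * e)
  set F' : ℝ → ℂ := fun r => fderiv ℝ ψ (R + r * e, R - r * e) (e, -e)
  have hF : ∀ r, HasDerivAt F (F' r) r := by
    intro r
    have h1 : HasDerivAt (fun r : ℝ => ((R + r * e, R - r * e) : ℂ × ℂ)) (e, -e) r := by
      have h2 : HasDerivAt (fun r : ℝ => (r : ℂ) * e) e r := by
        simpa using (Complex.ofRealCLM.hasDerivAt (x := r)).mul_const e
      exact (h2.const_add R).prodMk (h2.const_sub R)
    exact ((hψ.differentiable one_ne_zero _).hasFDerivAt).comp_hasDerivAt r h1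
  have hdψ : Continuous (fderiv ℝ ψ) := hψ.continuous_fderiv one_ne_zero
  have hF'c : Continuous F' := (hdψ.comp (by fun_prop)).clm_apply continuous_const
  have hFc : Continuous F := continuous_iff_continuousAt.2 fun t => (hF t).continuousAt
  have hFTC := intervalIntegral.integral_eq_sub_of_hasDerivAt (a := 0) (b := σ)
    (fun t _ => ((hF t).norm_sq).const_mul α)
    (Continuous.intervalIntegrable (by fun_prop) _ _)
  have hF0 : F 0 = 0 := by simp [F, hdiag]
  rw [hF0, norm_zero, zero_pow two_ne_zero, mul_zero, sub_zero] at hFTC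
  rw [← hFTC, intervalIntegral.integral_of_le hσ]
  refine (ENNReal.ofReal_le_ofReal (le_abs_self _)).trans ?_
  rw [← Real.enorm_eq_ofReal_abs]
  refine (enorm_integral_le_lintegral_enorm _).trans ?_
  refine setLIntegral_mono' measurableSet_Ioc fun r hr => ?_
  rw [Real.enorm_eq_ofReal_abs]
  refine ENNReal.ofReal_le_ofReal ?_
  set w := covRel α s y ψ R e (r * e) with hw
  have e1 : inner ℝ (F r) (F' r) = inner ℝ (F r) (Complex.I * w) := by
    rw [hw, covRel_eq]
    simp only [Complex.inner, F, F']
    simp; ring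
  rw [e1, abs_mul, abs_mul, abs_of_nonneg h0, abs_two]
  have h2 : |inner ℝ (F r) (Complex.I * w)| ≤ ‖F r‖ * ‖w‖ := by
    refine (abs_real_inner_le_norm _ _).trans ?_
    rw [norm_mul, Complex.norm_I, one_mul]
  have hr0 : 0 < r := hr.1
  calc α * (2 * |inner ℝ (F r) (Complex.I * w)|) ≤ α * (2 * (‖F r‖ * ‖w‖)) := by gcongr
    _ ≤ r * ‖w‖ ^ 2 + α ^ 2 / r * ‖F r‖ ^ 2 := by
        have : r * ‖w‖ ^ 2 + α ^ 2 / r * ‖F r‖ ^ 2 - α * (2 * (‖F r‖ * ‖w‖)) =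
            (r * ‖w‖ - α * ‖F r‖) ^ 2 / r := by field_simp; ring
        have h3 : 0 ≤ (r * ‖w‖ - α * ‖F r‖) ^ 2 / r := by positivity
        linarith

/-- Half a turn of `u` swaps the two particles, so symmetry of `ψ` gives the period `π`. The two
particles contribute `1/2` each to the angular potential, hence flux `π α` over the half circle, and
the fixed particles, being outside the disc, add none. -/
theorem angular_estimate (h0 : 0 ≤ α) (h1 : α ≤ 1) (hψ : ContDiff ℝ 1 ψ)
    (hsymm : ∀ p q, ψ (p, q) = ψ (q, p)) (R : ℂ) {r : ℝ} (hr : 0 < r)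
    (hy : ∀ l ∈ s, r < ‖y l - R‖) (c : ℝ) :
    ENNReal.ofReal (α ^ 2) * ∫⁻ θ in Set.Ioc c (c + Real.pi),
        ‖ψ (R + r * Complex.exp ((θ : ℝ) * Complex.I), R - r * Complex.exp ((θ : ℝ) * Complex.I))‖ₑ ^ 2 ≤
      ENNReal.ofReal (r ^ 2) * ∫⁻ θ in Set.Ioc c (c + Real.pi),
        ‖covRel α s y ψ R (Complex.I * Complex.exp ((θ : ℝ) * Complex.I))
          (r * Complex.exp ((θ : ℝ) * Complex.I))‖ₑ ^ 2 := by
  set e : ℝ → ℂ := fun θ => Complex.exp (θ * Complex.I)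
  have he : Continuous e := by fun_prop
  have hen : ∀ θ, ‖e θ‖ = 1 := fun θ => Complex.norm_exp_ofReal_mul_I θ
  set F : ℝ → ℂ := fun θ => ψ (R + r * e θ, R - r * e θ)
  set F' : ℝ → ℂ := fun θ =>
    fderiv ℝ ψ (R + r * e θ, R - r * e θ) (r * (Complex.I * e θ), -(r * (Complex.I * e θ)))
  set a : ℝ → ℝ := fun θ => α * relPot s y R (Complex.I * (r * e θ)) (r * e θ)
  have hF : ∀ θ, HasDerivAt F (F' θ) θ := by
    intro θ
    have h2 : HasDerivAt (fun θ : ℝ => (r : ℂ) * e θ) (r * (Complex.I * e θ)) θ := by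
      have h3 : HasDerivAt (fun θ : ℝ => (θ : ℂ) * Complex.I) Complex.I θ := by
        simpa using (Complex.ofRealCLM.hasDerivAt (x := θ)).mul_const Complex.I
      exact (h3.cexp.const_mul (r : ℂ)).congr_deriv (by simp only [e]; ring)
    have h4 : HasDerivAt (fun θ : ℝ => ((R + r * e θ, R - r * e θ) : ℂ × ℂ))
        (r * (Complex.I * e θ), -(r * (Complex.I * e θ))) θ :=
      (h2.const_add R).prodMk (h2.const_sub R)
    exact ((hψ.differentiable one_ne_zero _).hasFDerivAt).comp_hasDerivAt θ h4
  have hdψ : Continuous (fderiv ℝ ψ) := hψ.continuous_fderiv one_ne_zero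
  have hF'c : Continuous F' := (hdψ.comp (by fun_prop)).clm_apply (by fun_prop)
  have hFc : Continuous F := continuous_iff_continuousAt.2 fun t => (hF t).continuousAt
  have hrc : (r : ℂ) ≠ 0 := by exact_mod_cast hr.ne'
  have hene : ∀ θ, e θ ≠ 0 := fun θ => Complex.exp_ne_zero _
  have hne : ∀ l ∈ s, ∀ z : ℂ, ‖z‖ = 1 → R + r * z - y l ≠ 0 := by
    intro l hl z hz h
    have h5 := hy l hl
    rw [show y l - R = r * z by linear_combination -h, norm_mul, hz, Complex.norm_real,
      Real.norm_eq_abs, abs_of_pos hr] at h5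
    linarith
  have hne' : ∀ l ∈ s, ∀ θ, R - r * e θ - y l ≠ 0 := by
    intro l hl θ
    have := hne l hl (-e θ) (by rw [norm_neg, hen])
    intro h; apply this; linear_combination h
  have hpot : ∀ θ, relPot s y R (Complex.I * (r * e θ)) (r * e θ) = 1 + ∑ l ∈ s,
      ((Complex.I * (r * e θ) / (R + r * e θ - y l)).im -
        (Complex.I * (r * e θ) / (R - r * e θ - y l)).im) := by
    intro θ
    have h6 : Complex.I * (r * e θ) / (R + r * e θ - (R - r * e θ)) = (1 / 2 : ℝ) * Complex.I := by
      rw [show R + r * e θ - (R - r * e θ) = 2 * (r * e θ) by ring]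
      have := hene θ
      push_cast
      field_simp
    have h7 : Complex.I * (r * e θ) / (R - r * e θ - (R + r * e θ)) = (-(1 / 2) : ℝ) * Complex.I := by
      rw [show R - r * e θ - (R + r * e θ) = -(2 * (r * e θ)) by ring]
      have := hene θ
      push_cast
      field_simp
    rw [relPot, pairPot, pairPot, h6, h7, Finset.sum_sub_distrib, Complex.im_ofReal_mul,
      Complex.im_ofReal_mul, Complex.I_im]
    ring
  have hterm : ∀ l ∈ s, Continuous fun θ => ((Complex.I * (r * e θ) / (R + r * e θ - y l)).im -
        (Complex.I * (r * e θ) / (R - r * e θ - y l)).im) := fun l hl =>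
    (Complex.continuous_im.comp (Continuous.div (by fun_prop) (by fun_prop)
      fun θ => hne l hl _ (hen θ))).sub
      (Complex.continuous_im.comp (Continuous.div (by fun_prop) (by fun_prop) (hne' l hl)))
  have ha : Continuous a := by
    simp only [a, hpot]
    exact continuous_const.mul (continuous_const.add (continuous_finsetSum _ hterm))
  have hflux : ∫ θ in c..c + Real.pi, a θ = Real.pi * α := by
    simp only [a, hpot]
    rw [intervalIntegral.integral_const_mul, intervalIntegral.integral_add
      (by simp) ((continuous_finsetSum _ hterm).intervalIntegrable _ _),
      intervalIntegral.integral_finsetSum (fun l hl => (hterm l hl).intervalIntegrable _ _),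
      Finset.sum_eq_zero (fun l hl => integral_im_div_sub_eq_zero hr (hy l hl) c)]
    simp; ring
  have hper : F (c + Real.pi) = F c := by
    have : e (c + Real.pi) = -e c := by
      simp only [e]; push_cast; rw [add_mul, Complex.exp_add, Complex.exp_pi_mul_I]; ring
    simp only [F, this]
    rw [hsymm]
    congr 2 <;> ring
  have key := halfCircle_hardy α h0 h1 c F F' a hF hF'c ha hper hflux
  have hcov : ∀ θ, ‖-Complex.I * F' θ + a θ * F θ‖ ^ 2 =
      r ^ 2 * ‖covRel α s y ψ R (Complex.I * e θ) (r * e θ)‖ ^ 2 := by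
    intro θ
    have h8 : -Complex.I * F' θ + a θ * F θ = covRel α s y ψ R (Complex.I * (r * e θ)) (r * e θ) := by
      rw [covRel_eq]
      simp only [F', F, a]
      rw [mul_left_comm]
    have h9 : Complex.I * (r * e θ) = r * (Complex.I * e θ) + (0 : ℝ) * 0 := by push_cast; ring
    rw [h8, h9, covRel_linear]
    simp [mul_pow]
  have hle : c ≤ c + Real.pi := by linarith [Real.pi_pos]
  rw [intervalIntegral.integral_of_le hle, intervalIntegral.integral_of_le hle] at key
  have key2 := ENNReal.ofReal_le_ofReal key
  rw [ENNReal.ofReal_mul (by positivity), ofReal_integral_eq_lintegral_ofReal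
      ((Continuous.integrableOn_Icc (by fun_prop)).mono_set Set.Ioc_subset_Icc_self)
      (ae_of_all _ fun _ => by positivity),
    ofReal_integral_eq_lintegral_ofReal
      ((Continuous.integrableOn_Icc (by fun_prop)).mono_set Set.Ioc_subset_Icc_self)
      (ae_of_all _ fun _ => by positivity)] at key2
  simp only [hcov] at key2
  simp only [enorm_sq_eq_ofReal]
  refine key2.trans_eq ?_
  rw [← lintegral_const_mul' _ _ ENNReal.ofReal_ne_top]
  refine lintegral_congr fun θ => ?_
  rw [ENNReal.ofReal_mul (by positivity)]

theorem measurable_pairPot : Measurable fun z : ℂ × ℂ × ℂ => pairPot s y z.2.1 z.2.2 z.1 := by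
  unfold pairPot; fun_prop

theorem measurable_covFst (hψ : ContDiff ℝ 1 ψ) :
    Measurable fun z : ℂ × ℂ × ℂ => covFst α s y ψ z.1 z.2.1 z.2.2 := by
  have hdψ : Continuous (fderiv ℝ ψ) := hψ.continuous_fderiv one_ne_zero
  have h1 : Measurable fun z : ℂ × ℂ × ℂ => fderiv ℝ ψ (z.2.1, z.2.2) (z.1, 0) :=
    ((hdψ.comp (by fun_prop)).clm_apply (by fun_prop)).measurable
  have h2 : Measurable fun z : ℂ × ℂ × ℂ => ψ (z.2.1, z.2.2) :=
    (hψ.continuous.comp (by fun_prop)).measurable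
  have h3 := measurable_pairPot (s := s) (y := y)
  exact (h1.const_mul _).add ((Complex.measurable_ofReal.comp (h3.const_mul α)).mul h2)

theorem measurable_covSnd (hψ : ContDiff ℝ 1 ψ) :
    Measurable fun z : ℂ × ℂ × ℂ => covSnd α s y ψ z.1 z.2.1 z.2.2 := by
  have hdψ : Continuous (fderiv ℝ ψ) := hψ.continuous_fderiv one_ne_zero
  have h1 : Measurable fun z : ℂ × ℂ × ℂ => fderiv ℝ ψ (z.2.1, z.2.2) (0, z.1) :=
    ((hdψ.comp (by fun_prop)).clm_apply (by fun_prop)).measurable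
  have h2 : Measurable fun z : ℂ × ℂ × ℂ => ψ (z.2.1, z.2.2) :=
    (hψ.continuous.comp (by fun_prop)).measurable
  have h3 : Measurable fun z : ℂ × ℂ × ℂ => pairPot s y z.2.2 z.2.1 z.1 :=
    (measurable_pairPot (s := s) (y := y)).comp
      (measurable_fst.prodMk ((measurable_snd.comp measurable_snd).prodMk
        (measurable_fst.comp measurable_snd)))
  exact (h1.const_mul _).add ((Complex.measurable_ofReal.comp (h3.const_mul α)).mul h2)

theorem measurable_pairDensity (hψ : ContDiff ℝ 1 ψ) :
    Measurable fun z : ℂ × ℂ => pairDensity α s y ψ z.1 z.2 := by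
  have h1 : ∀ v, Measurable fun z : ℂ × ℂ => covFst α s y ψ v z.1 z.2 := fun v =>
    (measurable_covFst hψ).comp measurable_prodMk_left
  have h2 : ∀ v, Measurable fun z : ℂ × ℂ => covSnd α s y ψ v z.1 z.2 := fun v =>
    (measurable_covSnd hψ).comp measurable_prodMk_left
  have h3 := h1 1
  have h4 := h1 Complex.I
  have h5 := h2 1
  have h6 := h2 Complex.I
  unfold pairDensity
  fun_prop

theorem measurable_covRel (hψ : ContDiff ℝ 1 ψ) (R : ℂ) :
    Measurable fun z : ℂ × ℂ => covRel α s y ψ R z.1 z.2 := by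
  have h : Measurable fun z : ℂ × ℂ => (z.1, R + z.2, R - z.2) := by fun_prop
  have h1 := (measurable_covFst (α := α) (s := s) (y := y) hψ).comp h
  have h2 := (measurable_covSnd (α := α) (s := s) (y := y) hψ).comp h
  simp only [covRel]
  exact Measurable.sub h1 h2

/-- After integration over the angle, the term `(α² / r) |ψ|²` of the radial bound is traded for `r`
times the squared angular derivative. Together with the radial part this is `r` times the full
relative gradient, hence at most `2 r` times the two-particle density. The strict inequality `σ < ρ`
keeps fixed particles off the circles used. -/
theorem half_disc_estimate (h0 : 0 ≤ α) (h1 : α ≤ 1) (hψ : ContDiff ℝ 1 ψ)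
    (hsymm : ∀ p q, ψ (p, q) = ψ (q, p)) (hdiag : ∀ p, ψ (p, p) = 0) (R : ℂ) {ρ σ : ℝ}
    (hσ : 0 < σ) (hσρ : σ < ρ) (hy : ∀ l ∈ s, ρ ≤ ‖y l - R‖) (c : ℝ) :
    ENNReal.ofReal α * ∫⁻ θ in Set.Ioc c (c + Real.pi),
        ‖ψ (R + σ * Complex.exp ((θ : ℝ) * Complex.I), R - σ * Complex.exp ((θ : ℝ) * Complex.I))‖ₑ ^ 2 ≤
      2 * ∫⁻ r in Set.Ioo 0 ρ, ∫⁻ θ in Set.Ioc c (c + Real.pi), ENNReal.ofReal r *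
        pairDensity α s y ψ (R + r * Complex.exp ((θ : ℝ) * Complex.I))
          (R - r * Complex.exp ((θ : ℝ) * Complex.I)) := by
  have hψm : Measurable ψ := hψ.continuous.measurable
  obtain ⟨P, hP⟩ : ∃ P : ℝ → ℝ → ℝ≥0∞, ∀ r θ, P r θ = ‖ψ (R + r * Complex.exp ((θ : ℝ) * Complex.I),
      R - r * Complex.exp ((θ : ℝ) * Complex.I))‖ₑ ^ 2 := ⟨_, fun _ _ => rfl⟩
  obtain ⟨A, hA⟩ : ∃ A : ℝ → ℝ → ℝ≥0∞, ∀ r θ, A r θ =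
      ‖covRel α s y ψ R (Complex.exp (θ * Complex.I)) (r * Complex.exp (θ * Complex.I))‖ₑ ^ 2 :=
    ⟨_, fun _ _ => rfl⟩
  obtain ⟨B, hB⟩ : ∃ B : ℝ → ℝ → ℝ≥0∞, ∀ r θ, B r θ =
      ‖covRel α s y ψ R (Complex.I * Complex.exp (θ * Complex.I)) (r * Complex.exp (θ * Complex.I))‖ₑ ^ 2 :=
    ⟨_, fun _ _ => rfl⟩
  have mP : Measurable fun z : ℝ × ℝ => P z.1 z.2 := by
    simp only [hP]; fun_prop
  have mA : Measurable fun z : ℝ × ℝ => A z.1 z.2 := by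
    simp only [hA]
    have h : Measurable fun z : ℝ × ℝ =>
      (Complex.exp (z.2 * Complex.I), z.1 * Complex.exp (z.2 * Complex.I)) := by fun_prop
    exact ((measurable_covRel hψ R).comp h).enorm.pow_const 2
  have mB : Measurable fun z : ℝ × ℝ => B z.1 z.2 := by
    simp only [hB]
    have h : Measurable fun z : ℝ × ℝ =>
      (Complex.I * Complex.exp (z.2 * Complex.I), z.1 * Complex.exp (z.2 * Complex.I)) := by fun_prop
    exact ((measurable_covRel hψ R).comp h).enorm.pow_const 2
  have mAr : ∀ r, Measurable (A r) := fun r => mA.comp measurable_prodMk_left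
  have mBr : ∀ r, Measurable (B r) := fun r => mB.comp measurable_prodMk_left
  have mPr : ∀ r, Measurable (P r) := fun r => mP.comp measurable_prodMk_left
  have hAB : ∀ r θ, A r θ + B r θ ≤ 2 * pairDensity α s y ψ (R + r * Complex.exp ((θ : ℝ) * Complex.I))
          (R - r * Complex.exp ((θ : ℝ) * Complex.I)) := by
    intro r θ
    refine le_trans (le_of_eq ?_) (norm_sq_covRel_le R _)
    rw [hA, hB, enorm_sq_eq_ofReal, enorm_sq_eq_ofReal,
      ← ENNReal.ofReal_add (by positivity) (by positivity), norm_sq_covRel_rotate]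
  have hrad : ∀ θ, ENNReal.ofReal α * P σ θ ≤ ∫⁻ r in Set.Ioc 0 σ,
      (ENNReal.ofReal r * A r θ + ENNReal.ofReal (α ^ 2 / r) * P r θ) := by
    intro θ
    have h := radial_estimate (s := s) (y := y) h0 hψ hdiag R θ hσ.le
    rw [ENNReal.ofReal_mul h0] at h
    simp only [hP, hA, enorm_sq_eq_ofReal]
    refine h.trans (setLIntegral_mono' measurableSet_Ioc fun r hr => ?_)
    have hr0 : 0 < r := hr.1
    rw [ENNReal.ofReal_add (by positivity) (by positivity), ENNReal.ofReal_mul hr0.le,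
      ENNReal.ofReal_mul (by positivity)]
  have hang : ∀ r ∈ Set.Ioc 0 σ, ENNReal.ofReal (α ^ 2 / r) * ∫⁻ θ in Set.Ioc c (c + Real.pi), P r θ ≤
      ENNReal.ofReal r * ∫⁻ θ in Set.Ioc c (c + Real.pi), B r θ := by
    intro r hr
    have hr0 : 0 < r := hr.1
    have h := angular_estimate h0 h1 hψ hsymm R hr0 (s := s) (y := y)
      (fun l hl => (hr.2.trans_lt hσρ).trans_le (hy l hl)) c
    simp only [← hP, ← hB] at h
    have e1 : α ^ 2 / r = r⁻¹ * α ^ 2 := by ring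
    have e2 : r = r⁻¹ * r ^ 2 := by field_simp
    rw [e1, ENNReal.ofReal_mul (by positivity), mul_assoc]
    nth_rw 3 [e2]
    rw [ENNReal.ofReal_mul (by positivity), mul_assoc]
    gcongr
  have mint : Measurable fun z : ℝ × ℝ =>
      ENNReal.ofReal z.2 * A z.2 z.1 + ENNReal.ofReal (α ^ 2 / z.2) * P z.2 z.1 := by
    have k1 : Measurable fun z : ℝ × ℝ => A z.2 z.1 := mA.comp measurable_swap
    have k2 : Measurable fun z : ℝ × ℝ => P z.2 z.1 := mP.comp measurable_swap
    fun_prop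
  simp only [← hP]
  rw [← lintegral_const_mul _ (mPr σ)]
  calc _ ≤ ∫⁻ θ in Set.Ioc c (c + Real.pi), ∫⁻ r in Set.Ioc 0 σ,
        (ENNReal.ofReal r * A r θ + ENNReal.ofReal (α ^ 2 / r) * P r θ) := lintegral_mono hrad
    _ = ∫⁻ r in Set.Ioc 0 σ, ∫⁻ θ in Set.Ioc c (c + Real.pi),
        (ENNReal.ofReal r * A r θ + ENNReal.ofReal (α ^ 2 / r) * P r θ) :=
        lintegral_lintegral_swap mint.aemeasurable
    _ ≤ ∫⁻ r in Set.Ioc 0 σ, 2 * ∫⁻ θ in Set.Ioc c (c + Real.pi), ENNReal.ofReal r *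
        pairDensity α s y ψ (R + r * Complex.exp ((θ : ℝ) * Complex.I))
          (R - r * Complex.exp ((θ : ℝ) * Complex.I)) := by
        refine setLIntegral_mono' measurableSet_Ioc fun r hr => ?_
        rw [lintegral_add_left ((mAr r).const_mul _), lintegral_const_mul _ (mAr r),
          lintegral_const_mul _ (mPr r)]
        refine (add_le_add le_rfl (hang r hr)).trans ?_
        rw [← mul_add, ← lintegral_add_left (mAr r), lintegral_const_mul' _ _ ENNReal.ofReal_ne_top,
          mul_left_comm, ← lintegral_const_mul' 2 _ (by simp)]
        gcongr with θ
        exact hAB r θ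
    _ ≤ _ := by
        rw [← lintegral_const_mul' 2 _ (by simp)]
        exact lintegral_mono_set fun r hr => ⟨hr.1, hr.2.trans_lt hσρ⟩

theorem lintegral_ofReal_Ioo {ρ : ℝ} (hρ : 0 ≤ ρ) :
    ∫⁻ r in Set.Ioo 0 ρ, ENNReal.ofReal r = ENNReal.ofReal (ρ ^ 2 / 2) := by
  rw [restrict_Ioo_eq_restrict_Ioc, ← ofReal_integral_eq_lintegral_ofReal (f := fun r : ℝ => r)
      ((continuous_id'.integrableOn_Icc).mono_set Set.Ioc_subset_Icc_self)]
  · rw [← intervalIntegral.integral_of_le hρ]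
    simp
  · exact (ae_restrict_iff' measurableSet_Ioc).2 (ae_of_all _ fun r hr => hr.1.le)

/-- Dyson-type bound on a disc in the relative coordinate. -/
theorem disc_estimate (h0 : 0 ≤ α) (h1 : α ≤ 1) (hψ : ContDiff ℝ 1 ψ)
    (hsymm : ∀ p q, ψ (p, q) = ψ (q, p)) (hdiag : ∀ p, ψ (p, p) = 0) (R : ℂ) {ρ : ℝ}
    (hρ : 0 < ρ) (hy : ∀ l ∈ s, ρ ≤ ‖y l - R‖) :
    ENNReal.ofReal α * ∫⁻ u in Metric.ball (0 : ℂ) ρ, ‖ψ (R + u, R - u)‖ₑ ^ 2 ≤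
      ENNReal.ofReal (ρ ^ 2) * ∫⁻ u in Metric.ball (0 : ℂ) ρ, pairDensity α s y ψ (R + u) (R - u) := by
  have hψm : Measurable ψ := hψ.continuous.measurable
  have m1 : Measurable fun u : ℂ => ‖ψ (R + u, R - u)‖ₑ ^ 2 := by fun_prop
  have m2 : Measurable fun u : ℂ => pairDensity α s y ψ (R + u) (R - u) :=
    (measurable_pairDensity hψ).comp (g := fun z : ℂ × ℂ => pairDensity α s y ψ z.1 z.2)
      (f := fun u => (R + u, R - u)) (by fun_prop)
  rw [lintegral_ball_polar ρ m1, lintegral_ball_polar ρ m2]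
  obtain ⟨P, hP⟩ : ∃ P : ℝ → ℝ → ℝ≥0∞, ∀ r θ, P r θ = ‖ψ (R + r * Complex.exp ((θ : ℝ) * Complex.I),
      R - r * Complex.exp ((θ : ℝ) * Complex.I))‖ₑ ^ 2 := ⟨_, fun _ _ => rfl⟩
  obtain ⟨E, hE⟩ : ∃ E : ℝ → ℝ → ℝ≥0∞, ∀ r θ, E r θ = ENNReal.ofReal r *
      pairDensity α s y ψ (R + r * Complex.exp ((θ : ℝ) * Complex.I))
        (R - r * Complex.exp ((θ : ℝ) * Complex.I)) := ⟨_, fun _ _ => rfl⟩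
  have mE : Measurable fun z : ℝ × ℝ => E z.1 z.2 := by
    simp only [hE]
    have : Measurable fun z : ℝ × ℝ => (z.1 : ℂ) * Complex.exp (z.2 * Complex.I) := by fun_prop
    have := m2.comp this
    exact Measurable.mul (by fun_prop) this
  have mP : Measurable fun z : ℝ × ℝ => P z.1 z.2 := by
    simp only [hP]; fun_prop
  have hhalf : ∀ σ ∈ Set.Ioo 0 ρ, ∀ c, ENNReal.ofReal α * ∫⁻ θ in Set.Ioc c (c + Real.pi), P σ θ ≤
      2 * ∫⁻ r in Set.Ioo 0 ρ, ∫⁻ θ in Set.Ioc c (c + Real.pi), E r θ := by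
    intro σ hσ c
    simp only [hP, hE]
    exact half_disc_estimate h0 h1 hψ hsymm hdiag R hσ.1 hσ.2 hy c
  have hsplit : ∀ f : ℝ → ℝ≥0∞, ∫⁻ θ in Set.Ioc (-Real.pi) Real.pi, f θ =
      (∫⁻ θ in Set.Ioc (-Real.pi) (-Real.pi + Real.pi), f θ) +
        ∫⁻ θ in Set.Ioc 0 (0 + Real.pi), f θ := by
    intro f
    have hπ := Real.pi_pos
    rw [neg_add_cancel, zero_add, ← lintegral_union measurableSet_Ioc,
      Set.Ioc_union_Ioc_eq_Ioc (by linarith) hπ.le]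
    exact Set.disjoint_left.2 fun x hx hx' => absurd hx.2 (not_le.2 hx'.1)
  have hfull : ∀ σ ∈ Set.Ioo 0 ρ, ENNReal.ofReal α * ∫⁻ θ in Set.Ioc (-Real.pi) Real.pi, P σ θ ≤
      2 * ∫⁻ r in Set.Ioo 0 ρ, ∫⁻ θ in Set.Ioc (-Real.pi) Real.pi, E r θ := by
    intro σ hσ
    simp only [hsplit]
    rw [mul_add, lintegral_add_left, mul_add]
    · exact add_le_add (hhalf σ hσ _) (hhalf σ hσ _)
    · exact mE.lintegral_prod_right'
  simp only [← hP, ← hE]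
  set T := ∫⁻ r in Set.Ioo 0 ρ, ∫⁻ θ in Set.Ioc (-Real.pi) Real.pi, E r θ
  calc _ = ∫⁻ σ in Set.Ioo 0 ρ, ENNReal.ofReal σ * (ENNReal.ofReal α *
        ∫⁻ θ in Set.Ioc (-Real.pi) Real.pi, P σ θ) := by
        rw [← lintegral_const_mul' _ _ ENNReal.ofReal_ne_top]
        refine lintegral_congr fun σ => ?_
        rw [lintegral_const_mul' _ _ ENNReal.ofReal_ne_top]
        ring
    -- The bound on the circle of radius `σ` does not depend on `σ`; the weight `σ dσ` has mass `ρ²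
    -- / 2`, which absorbs the factor `2`.
    _ ≤ ∫⁻ σ in Set.Ioo 0 ρ, ENNReal.ofReal σ * (2 * T) :=
        setLIntegral_mono' measurableSet_Ioo fun σ hσ => mul_le_mul' le_rfl (hfull σ hσ)
    _ = ENNReal.ofReal (ρ ^ 2) * T := by
        rw [lintegral_mul_const _ (by fun_prop), lintegral_ofReal_Ioo hρ.le, ← mul_assoc]
        congr 1
        rw [← ENNReal.ofReal_ofNat 2, ← ENNReal.ofReal_mul (by positivity)]
        congr 1; ring

end Disc

/-! ### The two-particle bound in a rectangle -/

theorem lintegral_eq_sub_two_mul (p : ℂ) {f : ℂ → ℝ≥0∞} (hf : Measurable f) :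
    ∫⁻ q, f q = 4 * ∫⁻ u, f (p - 2 * u) := by
  have h1 : ∫⁻ u : ℂ, f (p - 2 * u) = ∫⁻ v, f (p - v) ∂(Measure.map (fun u : ℂ => (2 : ℝ) • u) volume) := by
    rw [lintegral_map (by fun_prop) (by fun_prop)]
    simp
  rw [h1, Measure.map_addHaar_smul _ two_ne_zero, lintegral_smul_measure, lintegral_sub_left_eq_self,
    Complex.finrank_real_complex, smul_eq_mul, ← mul_assoc]
  have : (4 : ℝ≥0∞) * ENNReal.ofReal |((2 : ℝ) ^ 2)⁻¹| = 1 := by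
    rw [← ENNReal.ofReal_ofNat 4, ← ENNReal.ofReal_mul (by norm_num), ← ENNReal.ofReal_one]
    congr 1; norm_num
  rw [this, one_mul]

/-- The real Jacobian of `(R, u) ↦ (R + u, R - u)` on `ℂ × ℂ` is `2² = 4`. -/
theorem lintegral_centerOfMass {H : ℂ × ℂ → ℝ≥0∞} (hH : Measurable H) :
    ∫⁻ z, H z = 4 * ∫⁻ R, ∫⁻ u, H (R + u, R - u) := by
  rw [Measure.volume_eq_prod, lintegral_prod _ hH.aemeasurable]
  have h1 : ∀ p : ℂ, ∫⁻ q, H (p, q) = 4 * ∫⁻ u, H (p, p - 2 * u) := fun p =>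
    lintegral_eq_sub_two_mul p (hH.comp measurable_prodMk_left)
  simp only [h1]
  rw [lintegral_const_mul' _ _ (by simp)]
  congr 1
  have m1 : Measurable fun z : ℂ × ℂ => H (z.1, z.1 - 2 * z.2) := hH.comp (by fun_prop)
  have m2 : Measurable fun z : ℂ × ℂ => H (z.1 + z.2, z.1 - z.2) := hH.comp (by fun_prop)
  rw [lintegral_lintegral_swap (f := fun p u => H (p, p - 2 * u)) m1.aemeasurable,
    lintegral_lintegral_swap (f := fun R u => H (R + u, R - u)) m2.aemeasurable]
  refine lintegral_congr fun u => ?_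
  rw [← lintegral_add_right_eq_self (fun p => H (p, p - 2 * u)) u]
  refine lintegral_congr fun R => ?_
  congr 2; ring

/-- The half-open rectangle with lower left corner `a + b i` and side lengths `ℓ₀`, `ℓ₁`. -/
def rect (a b ℓ₀ ℓ₁ : ℝ) : Set ℂ := {z | z.re ∈ Set.Ico a (a + ℓ₀) ∧ z.im ∈ Set.Ico b (b + ℓ₁)}

theorem measurableSet_rect (a b ℓ₀ ℓ₁ : ℝ) : MeasurableSet (rect a b ℓ₀ ℓ₁) :=
  (measurableSet_Ico.preimage Complex.measurable_re).inter
    (measurableSet_Ico.preimage Complex.measurable_im)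

theorem lintegral_rect (a b ℓ₀ ℓ₁ : ℝ) {f : ℂ → ℝ≥0∞} (hf : Measurable f) :
    ∫⁻ z in rect a b ℓ₀ ℓ₁, f z =
      ∫⁻ x in Set.Ico a (a + ℓ₀), ∫⁻ y in Set.Ico b (b + ℓ₁), f ⟨x, y⟩ := by
  have hpre : Complex.measurableEquivRealProd.symm ⁻¹' (rect a b ℓ₀ ℓ₁) =
      Set.Ico a (a + ℓ₀) ×ˢ Set.Ico b (b + ℓ₁) := by
    ext z; simp [rect, Complex.measurableEquivRealProd]
  rw [← (Complex.volume_preserving_equiv_real_prod.symm).setLIntegral_comp_preimage_emb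
    (MeasurableEquiv.measurableEmbedding _), hpre, Measure.volume_eq_prod, ← Measure.prod_restrict,
    lintegral_prod]
  · rfl
  · exact (hf.comp (MeasurableEquiv.measurable _)).aemeasurable

theorem volume_rect (a b : ℝ) {ℓ₀ ℓ₁ : ℝ} (h : 0 ≤ ℓ₀) :
    volume (rect a b ℓ₀ ℓ₁) = ENNReal.ofReal (ℓ₀ * ℓ₁) := by
  rw [← setLIntegral_one, lintegral_rect _ _ _ _ measurable_const]
  simp [ENNReal.ofReal_mul h, mul_comm]

/-- The line inequality is tensorized over the two sides. The aspect ratio bound puts both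
constants, `2 ℓ₀³ ℓ₁` and `2 ℓ₁³ ℓ₀`, below `4 (ℓ₀ ℓ₁)²`. -/
theorem rect_poincare {χ : ℂ → ℂ} (hχ : ContDiff ℝ 1 χ) {A₀ A₁ : ℂ → ℝ} (hA₀ : Measurable A₀)
    (hA₁ : Measurable A₁) (a b : ℝ) {ℓ₀ ℓ₁ : ℝ} (hℓ : 0 < ℓ₀) (h01 : ℓ₀ ≤ ℓ₁) (h10 : ℓ₁ ≤ 2 * ℓ₀) :
    ∫⁻ z in rect a b ℓ₀ ℓ₁, ∫⁻ z' in rect a b ℓ₀ ℓ₁, ‖‖χ z‖ - ‖χ z'‖‖ₑ ^ 2 ≤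
      ENNReal.ofReal (4 * (ℓ₀ * ℓ₁) ^ 2) * ∫⁻ z in rect a b ℓ₀ ℓ₁,
        (‖-Complex.I * fderiv ℝ χ z 1 + A₀ z * χ z‖ₑ ^ 2 +
          ‖-Complex.I * fderiv ℝ χ z Complex.I + A₁ z * χ z‖ₑ ^ 2) := by
  have hχc := hχ.continuous
  have hdχ : Continuous (fderiv ℝ χ) := hχ.continuous_fderiv one_ne_zero
  have hmk : Measurable fun z : ℝ × ℝ => (⟨z.1, z.2⟩ : ℂ) :=
    Complex.measurableEquivRealProd.symm.measurable
  obtain ⟨F, hF⟩ : ∃ F : ℂ → ℝ≥0∞, ∀ z, F z = ‖-Complex.I * fderiv ℝ χ z 1 + A₀ z * χ z‖ₑ ^ 2 :=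
    ⟨_, fun _ => rfl⟩
  obtain ⟨G, hG⟩ : ∃ G : ℂ → ℝ≥0∞, ∀ z,
      G z = ‖-Complex.I * fderiv ℝ χ z Complex.I + A₁ z * χ z‖ₑ ^ 2 := ⟨_, fun _ => rfl⟩
  have mF : Measurable F := by
    simp only [funext hF]
    have : Measurable fun z => fderiv ℝ χ z 1 := (hdχ.clm_apply continuous_const).measurable
    have := hχc.measurable
    fun_prop
  have mG : Measurable G := by
    simp only [funext hG]
    have : Measurable fun z => fderiv ℝ χ z Complex.I := (hdχ.clm_apply continuous_const).measurable
    have := hχc.measurable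
    fun_prop
  have hχd : ∀ z, HasFDerivAt χ (fderiv ℝ χ z) z := fun z =>
    (hχ.differentiable one_ne_zero z).hasFDerivAt
  have hre : ∀ y t : ℝ, HasDerivAt (fun t : ℝ => (⟨t, y⟩ : ℂ)) 1 t := by
    intro y t
    have : (fun t : ℝ => (⟨t, y⟩ : ℂ)) = fun t : ℝ => (t : ℂ) + y * Complex.I := by
      ext t; simp [Complex.ext_iff]
    rw [this]
    simpa using (Complex.ofRealCLM.hasDerivAt (x := t)).add_const ((y : ℂ) * Complex.I)
  have him : ∀ x t : ℝ, HasDerivAt (fun t : ℝ => (⟨x, t⟩ : ℂ)) Complex.I t := by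
    intro x t
    have : (fun t : ℝ => (⟨x, t⟩ : ℂ)) = fun t : ℝ => (x : ℂ) + t * Complex.I := by
      ext t; simp [Complex.ext_iff]
    rw [this]
    simpa using ((Complex.ofRealCLM.hasDerivAt (x := t)).mul_const Complex.I).const_add (x : ℂ)
  have hX : ∀ y, ∫⁻ x in Set.Ico a (a + ℓ₀), ∫⁻ x' in Set.Ico a (a + ℓ₀),
      ‖‖χ ⟨x, y⟩‖ - ‖χ ⟨x', y⟩‖‖ₑ ^ 2 ≤
      ENNReal.ofReal ℓ₀ ^ 3 * ∫⁻ x in Set.Ico a (a + ℓ₀), F ⟨x, y⟩ := by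
    intro y
    simp only [hF]
    have hc : Continuous fun t : ℝ => (⟨t, y⟩ : ℂ) :=
      continuous_iff_continuousAt.2 fun t => (hre y t).continuousAt
    exact line_poincare (u := fun t => χ ⟨t, y⟩) (u' := fun t => fderiv ℝ χ ⟨t, y⟩ 1)
      (a := fun t => A₀ ⟨t, y⟩) (hA₀.comp hc.measurable)
      (fun t => (hχd _).comp_hasDerivAt t (hre y t))
      ((hdχ.comp hc).clm_apply continuous_const) a ℓ₀
  have hY : ∀ x, ∫⁻ y in Set.Ico b (b + ℓ₁), ∫⁻ y' in Set.Ico b (b + ℓ₁),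
      ‖‖χ ⟨x, y⟩‖ - ‖χ ⟨x, y'⟩‖‖ₑ ^ 2 ≤
      ENNReal.ofReal ℓ₁ ^ 3 * ∫⁻ y in Set.Ico b (b + ℓ₁), G ⟨x, y⟩ := by
    intro x
    simp only [hG]
    have hc : Continuous fun t : ℝ => (⟨x, t⟩ : ℂ) :=
      continuous_iff_continuousAt.2 fun t => (him x t).continuousAt
    exact line_poincare (u := fun t => χ ⟨x, t⟩) (u' := fun t => fderiv ℝ χ ⟨x, t⟩ Complex.I)
      (a := fun t => A₁ ⟨x, t⟩) (hA₁.comp hc.measurable)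
      (fun t => (hχd _).comp_hasDerivAt t (him x t))
      ((hdχ.comp hc).clm_apply continuous_const) b ℓ₁
  have key := prod_poincare (volume.restrict (Set.Ico a (a + ℓ₀)))
    (volume.restrict (Set.Ico b (b + ℓ₁))) (g := fun x y => ‖χ ⟨x, y⟩‖)
    (hχc.measurable.norm.comp hmk) (F := fun x y => F ⟨x, y⟩) (G := fun x y => G ⟨x, y⟩)
    (mF.comp hmk) (mG.comp hmk) _ _ hX hY
  have hm : Measurable fun z : ℂ × ℂ => ‖‖χ z.1‖ - ‖χ z.2‖‖ₑ ^ 2 := by fun_prop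
  simp only [← hF, ← hG]
  rw [lintegral_rect _ _ _ _ hm.lintegral_prod_right', lintegral_add_left mF,
    lintegral_rect _ _ _ _ mF, lintegral_rect _ _ _ _ mG]
  have e1 : ∀ z : ℂ, ∫⁻ z' in rect a b ℓ₀ ℓ₁, ‖‖χ z‖ - ‖χ z'‖‖ₑ ^ 2 =
      ∫⁻ x' in Set.Ico a (a + ℓ₀), ∫⁻ y' in Set.Ico b (b + ℓ₁), ‖‖χ z‖ - ‖χ ⟨x', y'⟩‖‖ₑ ^ 2 :=
    fun z => lintegral_rect _ _ _ _ (by fun_prop)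
  simp only [e1]
  refine key.trans ?_
  rw [mul_add]
  have hℓ1 : 0 < ℓ₁ := hℓ.trans_le h01
  have c1 : 2 * ENNReal.ofReal ℓ₀ ^ 3 * volume.restrict (Set.Ico b (b + ℓ₁)) Set.univ ≤
      ENNReal.ofReal (4 * (ℓ₀ * ℓ₁) ^ 2) := by
    simp only [MeasurableSet.univ, Measure.restrict_apply, Set.univ_inter, Real.volume_Ico,
      add_sub_cancel_left]
    rw [← ENNReal.ofReal_pow hℓ.le, ← ENNReal.ofReal_ofNat 2, ← ENNReal.ofReal_mul (by positivity),
      ← ENNReal.ofReal_mul (by positivity)]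
    refine ENNReal.ofReal_le_ofReal ?_
    have : 0 < ℓ₀ ^ 2 * ℓ₁ := by positivity
    nlinarith
  have c2 : 2 * ENNReal.ofReal ℓ₁ ^ 3 * volume.restrict (Set.Ico a (a + ℓ₀)) Set.univ ≤
      ENNReal.ofReal (4 * (ℓ₀ * ℓ₁) ^ 2) := by
    simp only [MeasurableSet.univ, Measure.restrict_apply, Set.univ_inter, Real.volume_Ico,
      add_sub_cancel_left]
    rw [← ENNReal.ofReal_pow hℓ1.le, ← ENNReal.ofReal_ofNat 2, ← ENNReal.ofReal_mul (by positivity),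
      ← ENNReal.ofReal_mul (by positivity)]
    refine ENNReal.ofReal_le_ofReal ?_
    have : 0 < ℓ₁ ^ 2 * ℓ₀ := by positivity
    nlinarith
  gcongr

section Pair

variable {ι : Type*} {α : ℝ} {s : Finset ι} {y : ι → ℂ} {ψ : ℂ × ℂ → ℂ}

-- A second tensorization, now over the two particles. The constant does not depend on `α` or on the
-- fixed particles, because the underlying inequality for `|ψ|` is diamagnetic.
set_option maxHeartbeats 1000000 in
theorem pair_poincare (hψ : ContDiff ℝ 1 ψ) (a b : ℝ) {ℓ₀ ℓ₁ : ℝ} (hℓ : 0 < ℓ₀) (h01 : ℓ₀ ≤ ℓ₁)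
    (h10 : ℓ₁ ≤ 2 * ℓ₀) :
    ∫⁻ z in rect a b ℓ₀ ℓ₁ ×ˢ rect a b ℓ₀ ℓ₁, ∫⁻ z' in rect a b ℓ₀ ℓ₁ ×ˢ rect a b ℓ₀ ℓ₁,
        ‖‖ψ z‖ - ‖ψ z'‖‖ₑ ^ 2 ≤
      ENNReal.ofReal (8 * (ℓ₀ * ℓ₁) ^ 3) * ∫⁻ z in rect a b ℓ₀ ℓ₁ ×ˢ rect a b ℓ₀ ℓ₁,
        pairDensity α s y ψ z.1 z.2 := by
  set Q := rect a b ℓ₀ ℓ₁ with hQ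
  have hψc := hψ.continuous
  obtain ⟨F, hF⟩ : ∃ F : ℂ → ℂ → ℝ≥0∞, ∀ p q,
      F p q = ‖covFst α s y ψ 1 p q‖ₑ ^ 2 + ‖covFst α s y ψ Complex.I p q‖ₑ ^ 2 := ⟨_, fun _ _ => rfl⟩
  obtain ⟨G, hG⟩ : ∃ G : ℂ → ℂ → ℝ≥0∞, ∀ p q,
      G p q = ‖covSnd α s y ψ 1 p q‖ₑ ^ 2 + ‖covSnd α s y ψ Complex.I p q‖ₑ ^ 2 := ⟨_, fun _ _ => rfl⟩
  have mF : Measurable fun z : ℂ × ℂ => F z.1 z.2 := by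
    have h1 : ∀ v, Measurable fun z : ℂ × ℂ => covFst α s y ψ v z.1 z.2 := fun v =>
      (measurable_covFst hψ).comp measurable_prodMk_left
    simp only [hF]
    exact ((h1 _).enorm.pow_const 2).add ((h1 _).enorm.pow_const 2)
  have mG : Measurable fun z : ℂ × ℂ => G z.1 z.2 := by
    have h1 : ∀ v, Measurable fun z : ℂ × ℂ => covSnd α s y ψ v z.1 z.2 := fun v =>
      (measurable_covSnd hψ).comp measurable_prodMk_left
    simp only [hG]
    exact ((h1 _).enorm.pow_const 2).add ((h1 _).enorm.pow_const 2)
  have hpd : ∀ v q : ℂ, Measurable fun z : ℂ => pairPot s y z q v := fun v q => by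
    unfold pairPot; fun_prop
  have hψd : ∀ z, HasFDerivAt ψ (fderiv ℝ ψ z) z := fun z =>
    (hψ.differentiable one_ne_zero z).hasFDerivAt
  have hX : ∀ q, ∫⁻ p in Q, ∫⁻ p' in Q, ‖‖ψ (p, q)‖ - ‖ψ (p', q)‖‖ₑ ^ 2 ≤
      ENNReal.ofReal (4 * (ℓ₀ * ℓ₁) ^ 2) * ∫⁻ p in Q, F p q := by
    intro q
    have hfd : ∀ p v, fderiv ℝ (fun p => ψ (p, q)) p v = fderiv ℝ ψ (p, q) (v, 0) := by
      intro p v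
      have : HasFDerivAt (fun p => ψ (p, q)) ((fderiv ℝ ψ (p, q)).comp (.inl ℝ ℂ ℂ)) p :=
        (hψd (p, q)).comp p (hasFDerivAt_prodMk_left p q)
      rw [this.fderiv]; simp
    have h := rect_poincare (χ := fun p => ψ (p, q)) (hψ.comp (by fun_prop))
      ((hpd 1 q).const_mul α) ((hpd Complex.I q).const_mul α) a b hℓ h01 h10
    simp only [hfd] at h
    simp only [hF, covFst]
    exact h
  have hY : ∀ p, ∫⁻ q in Q, ∫⁻ q' in Q, ‖‖ψ (p, q)‖ - ‖ψ (p, q')‖‖ₑ ^ 2 ≤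
      ENNReal.ofReal (4 * (ℓ₀ * ℓ₁) ^ 2) * ∫⁻ q in Q, G p q := by
    intro p
    have hfd : ∀ q v, fderiv ℝ (fun q => ψ (p, q)) q v = fderiv ℝ ψ (p, q) (0, v) := by
      intro q v
      have : HasFDerivAt (fun q => ψ (p, q)) ((fderiv ℝ ψ (p, q)).comp (.inr ℝ ℂ ℂ)) q :=
        (hψd (p, q)).comp q (hasFDerivAt_prodMk_right p q)
      rw [this.fderiv]; simp
    have h := rect_poincare (χ := fun q => ψ (p, q)) (hψ.comp (by fun_prop))
      ((hpd 1 p).const_mul α) ((hpd Complex.I p).const_mul α) a b hℓ h01 h10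
    simp only [hfd] at h
    simp only [hG, covSnd]
    exact h
  have key := prod_poincare (volume.restrict Q) (volume.restrict Q) (g := fun p q => ‖ψ (p, q)‖)
    (by fun_prop) mF mG _ _ hX hY
  have hvol : volume.restrict Q Set.univ = ENNReal.ofReal (ℓ₀ * ℓ₁) := by
    rw [Measure.restrict_apply_univ, hQ, volume_rect _ _ hℓ.le]
  have hℓ1 : 0 < ℓ₁ := hℓ.trans_le h01
  have hc : 2 * ENNReal.ofReal (4 * (ℓ₀ * ℓ₁) ^ 2) * volume.restrict Q Set.univ =
      ENNReal.ofReal (8 * (ℓ₀ * ℓ₁) ^ 3) := by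
    rw [hvol, ← ENNReal.ofReal_ofNat 2, ← ENNReal.ofReal_mul (by positivity),
      ← ENNReal.ofReal_mul (by positivity)]
    congr 1; ring
  rw [hc] at key
  have hm : Measurable fun z : (ℂ × ℂ) × (ℂ × ℂ) => ‖‖ψ z.1‖ - ‖ψ z.2‖‖ₑ ^ 2 := by fun_prop
  have hm1 : ∀ z, Measurable fun z' : ℂ × ℂ => ‖‖ψ z‖ - ‖ψ z'‖‖ₑ ^ 2 := by intro z; fun_prop
  simp only [pairDensity, ← hF, ← hG]
  rw [Measure.volume_eq_prod, ← Measure.prod_restrict, lintegral_add_left mF,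
    lintegral_prod _ mF.aemeasurable, lintegral_prod _ mG.aemeasurable,
    lintegral_prod _ hm.lintegral_prod_right'.aemeasurable, mul_add]
  have e1 : ∀ z, ∫⁻ z', ‖‖ψ z‖ - ‖ψ z'‖‖ₑ ^ 2 ∂(volume.restrict Q).prod (volume.restrict Q) =
      ∫⁻ p' in Q, ∫⁻ q' in Q, ‖‖ψ z‖ - ‖ψ (p', q')‖‖ₑ ^ 2 := fun z =>
    lintegral_prod _ (hm1 z).aemeasurable
  simp only [e1]
  exact key

theorem ofReal_mul_le_of_le {x y c d : ℝ} {M E : ℝ≥0∞} (hy : 0 < y)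
    (hd : 0 ≤ d) (h : ENNReal.ofReal x * M ≤ ENNReal.ofReal y * E)
    (hcd : c * y ≤ d * x) : ENNReal.ofReal c * M ≤ ENNReal.ofReal d * E := by
  calc ENNReal.ofReal c * M ≤ ENNReal.ofReal (d / y * x) * M := by
        gcongr
        rw [div_mul_eq_mul_div, le_div_iff₀ hy]; exact hcd
    _ = ENNReal.ofReal (d / y) * (ENNReal.ofReal x * M) := by
        rw [ENNReal.ofReal_mul (by positivity), mul_assoc]
    _ ≤ ENNReal.ofReal (d / y) * (ENNReal.ofReal y * E) := by gcongr
    _ = ENNReal.ofReal d * E := by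
        rw [← mul_assoc, ← ENNReal.ofReal_mul (by positivity), div_mul_cancel₀ _ (Ne.symm hy.ne)]

/-- The two-particle lower bound: for two anyons in a rectangle of bounded aspect ratio, in the
presence of fixed particles outside of it. -/
theorem pair_estimate (h0 : 0 ≤ α) (h1 : α ≤ 1) (hψ : ContDiff ℝ 1 ψ)
    (hsymm : ∀ p q, ψ (p, q) = ψ (q, p)) (hdiag : ∀ p, ψ (p, p) = 0)
    (a b : ℝ) {ℓ₀ ℓ₁ : ℝ} (hℓ : 0 < ℓ₀) (h01 : ℓ₀ ≤ ℓ₁) (h10 : ℓ₁ ≤ 2 * ℓ₀)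
    (hy : ∀ l ∈ s, y l ∉ rect a b ℓ₀ ℓ₁) :
    ENNReal.ofReal (7 * Real.pi / 4 * min α (1 / 100000)) *
        ∫⁻ z in rect a b ℓ₀ ℓ₁ ×ˢ rect a b ℓ₀ ℓ₁, ‖ψ z‖ₑ ^ 2 ≤
      ENNReal.ofReal (ℓ₀ * ℓ₁) * ∫⁻ z in rect a b ℓ₀ ℓ₁ ×ˢ rect a b ℓ₀ ℓ₁,
        pairDensity α s y ψ z.1 z.2 := by
  have hℓ1 : 0 < ℓ₁ := hℓ.trans_le h01
  have hψc := hψ.continuous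
  set Q := rect a b ℓ₀ ℓ₁ with hQ
  -- The margin `ρ` keeps `R + u` and `R - u` in the rectangle for `R ∈ Q'`, `|u| < ρ`. With `ρ = ℓ₀
  -- / 20` the shrunken rectangle still has 81% of the area.
  set ρ : ℝ := ℓ₀ / 20 with hρ
  have hρ0 : 0 < ρ := by positivity
  set Q' := rect (a + ρ) (b + ρ) (ℓ₀ - 2 * ρ) (ℓ₁ - 2 * ρ) with hQ'
  have hQm : MeasurableSet Q := measurableSet_rect _ _ _ _
  have hQ'm : MeasurableSet Q' := measurableSet_rect _ _ _ _
  have hsub : ∀ R ∈ Q', ∀ u : ℂ, ‖u‖ < ρ → R + u ∈ Q := by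
    intro R hR u hu
    have hre := abs_lt.1 ((Complex.abs_re_le_norm u).trans_lt hu)
    have him := abs_lt.1 ((Complex.abs_im_le_norm u).trans_lt hu)
    simp only [hQ', rect, Set.mem_ofPred_eq, Set.mem_Ico] at hR
    simp only [hQ, rect, Set.mem_ofPred_eq, Set.mem_Ico, Complex.add_re, Complex.add_im]
    refine ⟨⟨?_, ?_⟩, ?_, ?_⟩ <;> linarith [hR.1.1, hR.1.2, hR.2.1, hR.2.2, hre.1, hre.2, him.1, him.2]
  -- The close pairs, to which the disc bound applies; `Q ×ˢ Q` is then compared with `B` by the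
  -- Poincaré inequality.
  set B : Set (ℂ × ℂ) := {z | (z.1 + z.2) / 2 ∈ Q' ∧ (z.1 - z.2) / 2 ∈ Metric.ball (0 : ℂ) ρ} with hB
  have hBm : MeasurableSet B := by
    refine MeasurableSet.inter ?_ ?_
    · exact hQ'm.preimage (by fun_prop : Measurable fun z : ℂ × ℂ => (z.1 + z.2) / 2)
    · exact measurableSet_ball.preimage (by fun_prop : Measurable fun z : ℂ × ℂ => (z.1 - z.2) / 2)
  have hBQ : B ⊆ Q ×ˢ Q := by
    rintro ⟨p, q⟩ ⟨hz1, hz2⟩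
    rw [mem_ball_zero_iff] at hz2
    refine ⟨?_, ?_⟩
    · have := hsub _ hz1 _ hz2
      simp only at this
      rwa [show (p + q) / 2 + (p - q) / 2 = p by ring] at this
    · have := hsub _ hz1 (-((p - q) / 2)) (by rwa [norm_neg])
      simp only at this
      rwa [show (p + q) / 2 + -((p - q) / 2) = q by ring] at this
  have hBint : ∀ h : ℂ × ℂ → ℝ≥0∞, Measurable h → ∫⁻ z in B, h z =
      4 * ∫⁻ R in Q', ∫⁻ u in Metric.ball (0 : ℂ) ρ, h (R + u, R - u) := by
    intro h hh
    rw [← lintegral_indicator hBm, lintegral_centerOfMass (hh.indicator hBm),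
      ← lintegral_indicator hQ'm]
    congr 1
    refine lintegral_congr fun R => ?_
    have hmem : ∀ u, ((R + u, R - u) : ℂ × ℂ) ∈ B ↔ R ∈ Q' ∧ u ∈ Metric.ball (0 : ℂ) ρ := by
      intro u
      simp only [hB, Set.mem_ofPred_eq]
      rw [show (R + u + (R - u)) / 2 = R by ring, show (R + u - (R - u)) / 2 = u by ring]
    by_cases hR : R ∈ Q'
    · rw [Set.indicator_of_mem hR, ← lintegral_indicator measurableSet_ball]
      refine lintegral_congr fun u => ?_
      by_cases hu : u ∈ Metric.ball (0 : ℂ) ρ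
      · rw [Set.indicator_of_mem hu, Set.indicator_of_mem ((hmem u).2 ⟨hR, hu⟩)]
      · rw [Set.indicator_of_notMem hu, Set.indicator_of_notMem fun hh => hu ((hmem u).1 hh).2]
    · rw [Set.indicator_of_notMem hR]
      simp only [Set.indicator_of_notMem fun hh => hR ((hmem _).1 hh).1, lintegral_zero]
  have mM : Measurable fun z => ‖ψ z‖ₑ ^ 2 := by fun_prop
  have mE := measurable_pairDensity (α := α) (s := s) (y := y) hψ
  set M := ∫⁻ z in Q ×ˢ Q, ‖ψ z‖ₑ ^ 2 with hM
  set E := ∫⁻ z in Q ×ˢ Q, pairDensity α s y ψ z.1 z.2 with hE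
  set MB := ∫⁻ z in B, ‖ψ z‖ₑ ^ 2 with hMB
  have hdisc : ENNReal.ofReal α * MB ≤ ENNReal.ofReal (ρ ^ 2) * E := by
    calc ENNReal.ofReal α * MB ≤ ENNReal.ofReal (ρ ^ 2) * ∫⁻ z in B, pairDensity α s y ψ z.1 z.2 := by
          rw [hMB, hBint _ mM, hBint _ mE, mul_left_comm, mul_left_comm (ENNReal.ofReal (ρ ^ 2)),
            ← lintegral_const_mul' _ _ ENNReal.ofReal_ne_top,
            ← lintegral_const_mul' _ _ ENNReal.ofReal_ne_top]
          refine mul_le_mul' le_rfl (setLIntegral_mono' hQ'm fun R hR => ?_)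
          refine disc_estimate h0 h1 hψ hsymm hdiag R hρ0 fun l hl => ?_
          by_contra hlt
          refine hy l hl ?_
          have := hsub R hR (y l - R) (not_le.1 hlt)
          rwa [add_sub_cancel] at this
      _ ≤ _ := mul_le_mul' le_rfl (lintegral_mono_set hBQ)
  have hvolQ' : volume Q' = ENNReal.ofReal ((ℓ₀ - 2 * ρ) * (ℓ₁ - 2 * ρ)) :=
    volume_rect _ _ (by simp only [hρ]; linarith)
  have hvolQQ : volume (Q ×ˢ Q) = ENNReal.ofReal ((ℓ₀ * ℓ₁) ^ 2) := by
    rw [Measure.volume_eq_prod, Measure.prod_prod, hQ, volume_rect _ _ hℓ.le,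
      ← ENNReal.ofReal_mul (by positivity), sq]
  have hvolB : volume B = ENNReal.ofReal (4 * ((ℓ₀ - 2 * ρ) * (ℓ₁ - 2 * ρ)) * (Real.pi * ρ ^ 2)) := by
    rw [← setLIntegral_one, hBint _ measurable_const]
    simp only [lintegral_const, one_mul, Measure.restrict_apply_univ, hvolQ', Complex.volume_ball]
    have hq : 0 ≤ (ℓ₀ - 2 * ρ) * (ℓ₁ - 2 * ρ) :=
      mul_nonneg (by simp only [hρ]; linarith) (by simp only [hρ]; linarith)
    generalize (ℓ₀ - 2 * ρ) * (ℓ₁ - 2 * ρ) = K at hq ⊢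
    rw [ENNReal.ofReal_mul (by linarith), ENNReal.ofReal_mul (p := 4) (by norm_num), ENNReal.ofReal_mul Real.pi_pos.le,
      ENNReal.ofReal_pow hρ0.le, ENNReal.ofReal_ofNat]
    have : ENNReal.ofReal Real.pi = (NNReal.pi : ℝ≥0∞) := by
      rw [← NNReal.coe_real_pi, ENNReal.ofReal_coe_nnreal]
    rw [this]; ring
  have hpoin : volume B * M ≤ ENNReal.ofReal (3 / 2 * (ℓ₀ * ℓ₁) ^ 2) * MB +
      ENNReal.ofReal (24 * (ℓ₀ * ℓ₁) ^ 3) * E := by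
    -- Young's inequality; the difference of the two sides is half the square of `‖ψ z'‖ + 2 (‖ψ z'‖
    -- - ‖ψ z‖)`. Integrating over `z' ∈ B` and `z ∈ Q ×ˢ Q` bounds the total mass by that of the
    -- close pairs plus the energy.
    have hpt : ∀ z z', ‖ψ z‖ₑ ^ 2 ≤ ENNReal.ofReal (3 / 2) * ‖ψ z'‖ₑ ^ 2 +
        3 * ‖‖ψ z'‖ - ‖ψ z‖‖ₑ ^ 2 := by
      intro z z'
      simp only [enorm_sq_eq_ofReal]
      rw [← ENNReal.ofReal_ofNat 3, ← ENNReal.ofReal_mul (by norm_num),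
        ← ENNReal.ofReal_mul (by norm_num), ← ENNReal.ofReal_add (by positivity) (by positivity)]
      refine ENNReal.ofReal_le_ofReal ?_
      rw [Real.norm_eq_abs, sq_abs]
      nlinarith [sq_nonneg (‖ψ z'‖ + 2 * (‖ψ z'‖ - ‖ψ z‖))]
    have hP := pair_poincare (α := α) (s := s) (y := y) hψ a b hℓ h01 h10
    rw [← hQ] at hP
    have hm : Measurable fun z : (ℂ × ℂ) × (ℂ × ℂ) => ‖‖ψ z.1‖ - ‖ψ z.2‖‖ₑ ^ 2 := by fun_prop
    have hm1 : ∀ z', Measurable fun z : ℂ × ℂ => ‖‖ψ z'‖ - ‖ψ z‖‖ₑ ^ 2 := by intro z'; fun_prop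
    calc volume B * M = ∫⁻ _ in B, M := by
          rw [lintegral_const, Measure.restrict_apply_univ, mul_comm]
      _ ≤ ∫⁻ z' in B, (ENNReal.ofReal (3 / 2 * (ℓ₀ * ℓ₁) ^ 2) * ‖ψ z'‖ₑ ^ 2 +
            3 * ∫⁻ z in Q ×ˢ Q, ‖‖ψ z'‖ - ‖ψ z‖‖ₑ ^ 2) := by
          refine lintegral_mono fun z' => ?_
          calc M ≤ ∫⁻ z in Q ×ˢ Q, (ENNReal.ofReal (3 / 2) * ‖ψ z'‖ₑ ^ 2 +
                3 * ‖‖ψ z'‖ - ‖ψ z‖‖ₑ ^ 2) := lintegral_mono fun z => hpt z z'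
            _ = _ := by
                rw [lintegral_add_left measurable_const, lintegral_const_mul _ (hm1 z'),
                  lintegral_const, Measure.restrict_apply_univ, hvolQQ,
                  ENNReal.ofReal_mul (by norm_num)]
                ring
      _ = ENNReal.ofReal (3 / 2 * (ℓ₀ * ℓ₁) ^ 2) * MB +
            3 * ∫⁻ z' in B, ∫⁻ z in Q ×ˢ Q, ‖‖ψ z'‖ - ‖ψ z‖‖ₑ ^ 2 := by
          rw [lintegral_add_left (mM.const_mul _), lintegral_const_mul _ mM,
            lintegral_const_mul _ hm.lintegral_prod_right']
      _ ≤ ENNReal.ofReal (3 / 2 * (ℓ₀ * ℓ₁) ^ 2) * MB +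
            3 * (ENNReal.ofReal (8 * (ℓ₀ * ℓ₁) ^ 3) * E) := by
          gcongr
          exact (lintegral_mono_set hBQ).trans hP
      _ = _ := by
          rw [← mul_assoc, ← ENNReal.ofReal_ofNat 3, ← ENNReal.ofReal_mul (by norm_num)]
          congr 3; ring
  -- The cap makes the Poincaré error a small perturbation: by `S ≤ 800 ρ²` it is at most `0.192 S²
  -- ρ²`, against the main term `1.5 S² ρ²`.
  set α' := min α (1 / 100000) with hα'
  have hα'0 : 0 ≤ α' := le_min h0 (by norm_num)
  have hα'1 : α' ≤ 1 / 100000 := min_le_right _ _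
  have hα'α : α' ≤ α := min_le_left _ _
  set S := ℓ₀ * ℓ₁ with hS
  have hS0 : 0 < S := by positivity
  have hcomb : ENNReal.ofReal (α' * (4 * ((ℓ₀ - 2 * ρ) * (ℓ₁ - 2 * ρ)) * (Real.pi * ρ ^ 2))) * M ≤
      ENNReal.ofReal (3 / 2 * S ^ 2 * ρ ^ 2 + 24 * S ^ 3 * α') * E := by
    rw [ENNReal.ofReal_mul hα'0, ← hvolB, mul_assoc]
    calc ENNReal.ofReal α' * (volume B * M) ≤ ENNReal.ofReal α' *
          (ENNReal.ofReal (3 / 2 * S ^ 2) * MB + ENNReal.ofReal (24 * S ^ 3) * E) := by gcongr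
      _ = ENNReal.ofReal (3 / 2 * S ^ 2) * (ENNReal.ofReal α' * MB) +
          ENNReal.ofReal (24 * S ^ 3) * ENNReal.ofReal α' * E := by ring
      _ ≤ ENNReal.ofReal (3 / 2 * S ^ 2) * (ENNReal.ofReal (ρ ^ 2) * E) +
          ENNReal.ofReal (24 * S ^ 3) * ENNReal.ofReal α' * E := by
          refine add_le_add (mul_le_mul' le_rfl ?_) le_rfl
          exact (mul_le_mul' (ENNReal.ofReal_le_ofReal hα'α) le_rfl).trans hdisc
      _ = _ := by
          rw [← mul_assoc, ← ENNReal.ofReal_mul (by positivity), ← ENNReal.ofReal_mul (by positivity),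
            ← add_mul, ← ENNReal.ofReal_add (by positivity) (by positivity)]
  refine ofReal_mul_le_of_le (by positivity) hS0.le hcomb ?_
  have hS2 : S ≤ 800 * ρ ^ 2 := by simp only [hS, hρ]; nlinarith
  have hQ2 : 81 / 100 * S ≤ (ℓ₀ - 2 * ρ) * (ℓ₁ - 2 * ρ) := by simp only [hS, hρ]; nlinarith
  have hY : 3 / 2 * S ^ 2 * ρ ^ 2 + 24 * S ^ 3 * α' ≤ 17 / 10 * S ^ 2 * ρ ^ 2 := by
    have : 24 * S ^ 3 * α' ≤ 24 * S ^ 2 * (800 * ρ ^ 2) * (1 / 100000) := by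
      rw [show 24 * S ^ 3 * α' = 24 * S ^ 2 * S * α' by ring]
      gcongr
    have h5 : 0 ≤ S ^ 2 * ρ ^ 2 := by positivity
    linarith
  -- The constant `7 / 4` is admissible since `(7/4) (17/10) ≤ 4 (81/100)`.
  calc 7 * Real.pi / 4 * α' * (3 / 2 * S ^ 2 * ρ ^ 2 + 24 * S ^ 3 * α')
      ≤ 7 * Real.pi / 4 * α' * (17 / 10 * S ^ 2 * ρ ^ 2) := by gcongr
    _ ≤ S * (α' * (4 * (81 / 100 * S) * (Real.pi * ρ ^ 2))) := by
        have : 0 ≤ Real.pi * α' * S ^ 2 * ρ ^ 2 := by positivity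
        linarith
    _ ≤ _ := by gcongr

end Pair

/-! ### Freezing all particles but two -/

/-- The complex number `z` as a point of the plane. -/
def toPlane : ℂ →L[ℝ] (Fin 2 → ℝ) := ContinuousLinearMap.pi ![Complex.reCLM, Complex.imCLM]

/-- A point of the plane as a complex number. -/
def ofPlane (p : Fin 2 → ℝ) : ℂ := ⟨p 0, p 1⟩

@[simp] theorem toPlane_zero_apply (z : ℂ) : toPlane z 0 = z.re := rfl
@[simp] theorem toPlane_one_apply (z : ℂ) : toPlane z 1 = z.im := rfl
@[simp] theorem toPlane_ofPlane (p : Fin 2 → ℝ) : toPlane (ofPlane p) = p := by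
  ext a; fin_cases a <;> rfl
@[simp] theorem ofPlane_toPlane (z : ℂ) : ofPlane (toPlane z) = z := rfl

/-- The unit vectors of the plane as complex numbers. -/
def unitDir : Fin 2 → ℂ := ![1, Complex.I]

theorem toPlane_unitDir (a : Fin 2) : toPlane (unitDir a) = Pi.single a 1 := by
  ext b; fin_cases a <;> fin_cases b <;> simp [unitDir, toPlane]

theorem lintegral_plane {f : (Fin 2 → ℝ) → ℝ≥0∞} : ∫⁻ p, f p = ∫⁻ z, f (toPlane z) := by
  rw [← Complex.volume_preserving_equiv_pi.lintegral_comp_emb (MeasurableEquiv.measurableEmbedding _)]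
  refine lintegral_congr fun z => ?_
  congr 1
  ext a; fin_cases a <;> simp

/-- In complex notation the potential in direction `v` is `Im (v / z)`, the derivative of `arg z`.
Fluxes thus become contour integrals, and away from the branch cut the potential is a gradient. -/
theorem perpInv_toPlane (z : ℂ) (a : Fin 2) : perpInv (toPlane z) a = (unitDir a / z).im := by
  fin_cases a
  · simp [perpInv, unitDir, Complex.normSq_apply, sq]
  · simp [perpInv, unitDir, Complex.div_im, Complex.normSq_apply, sq]

/-- The configuration `x` with the particles `j`, `k` moved to `z.1`, `z.2`. -/
def movePair {N : ℕ} (x : Config N) (j k : Fin N) (z : ℂ × ℂ) : Config N :=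
  Function.update (Function.update x j (toPlane z.1)) k (toPlane z.2)

section MovePair

variable {N : ℕ} {x : Config N} {j k : Fin N}

theorem movePair_left (hjk : j ≠ k) (z : ℂ × ℂ) : movePair x j k z j = toPlane z.1 := by
  simp [movePair, hjk]

theorem movePair_right (z : ℂ × ℂ) : movePair x j k z k = toPlane z.2 := by
  simp [movePair]

theorem movePair_of_ne {l : Fin N} (hj : l ≠ j) (hk : l ≠ k) (z : ℂ × ℂ) :
    movePair x j k z l = x l := by
  simp [movePair, hj, hk]

theorem movePair_swap (hjk : j ≠ k) (p q : ℂ) :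
    movePair x j k (q, p) = movePair x j k (p, q) ∘ Equiv.swap j k := by
  funext l
  rcases eq_or_ne l j with rfl | hj
  · simp [movePair_left hjk, movePair_right]
  rcases eq_or_ne l k with rfl | hk
  · simp [movePair_left hjk, movePair_right]
  · simp [movePair_of_ne hj hk, Equiv.swap_apply_of_ne_of_ne hj hk]

theorem hasFDerivAt_movePair (hjk : j ≠ k) (z : ℂ × ℂ) :
    HasFDerivAt (movePair x j k)
      ((ContinuousLinearMap.single ℝ (fun _ : Fin N => Fin 2 → ℝ) j).comp
          (toPlane.comp (.fst ℝ ℂ ℂ)) +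
        (ContinuousLinearMap.single ℝ (fun _ : Fin N => Fin 2 → ℝ) k).comp
          (toPlane.comp (.snd ℝ ℂ ℂ))) z := by
  set L := ((ContinuousLinearMap.single ℝ (fun _ : Fin N => Fin 2 → ℝ) j).comp
          (toPlane.comp (.fst ℝ ℂ ℂ)) +
        (ContinuousLinearMap.single ℝ (fun _ : Fin N => Fin 2 → ℝ) k).comp
          (toPlane.comp (.snd ℝ ℂ ℂ))) with hL
  have : movePair x j k = fun z => L z + movePair x j k 0 := by
    funext z l
    rcases eq_or_ne l k with rfl | hk
    · simp [hL, movePair_right, hjk.symm]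
    rcases eq_or_ne l j with rfl | hj
    · simp [hL, movePair_left hjk, hjk]
    · simp [hL, movePair_of_ne hj hk, hj, hk]
  rw [this]
  exact L.hasFDerivAt.add_const _

theorem continuous_movePair (hjk : j ≠ k) : Continuous (movePair x j k) :=
  continuous_iff_continuousAt.2 fun z => (hasFDerivAt_movePair hjk z).continuousAt

theorem contDiff_movePair (hjk : j ≠ k) : ContDiff ℝ 1 (movePair x j k) := by
  refine contDiff_pi.2 fun l => ?_
  rcases eq_or_ne l k with rfl | hk
  · simp only [movePair_right]; exact toPlane.contDiff.comp contDiff_snd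
  rcases eq_or_ne l j with rfl | hj
  · simp only [movePair_left hjk]; exact toPlane.contDiff.comp contDiff_fst
  · simp only [movePair_of_ne hj hk]; exact contDiff_const

theorem vecPot_movePair_left (hjk : j ≠ k) (p q : ℂ) (a : Fin 2) :
    vecPot j (movePair x j k (p, q)) a =
      pairPot ((Finset.univ.erase j).erase k) (fun l => ofPlane (x l)) p q (unitDir a) := by
  rw [vecPot, ← Finset.add_sum_erase _ _ (Finset.mem_erase.2 ⟨hjk.symm, Finset.mem_univ k⟩), pairPot,
    Pi.add_apply, Finset.sum_apply, movePair_left hjk, movePair_right]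
  congr 1
  · rw [← map_sub, perpInv_toPlane]
  · refine Finset.sum_congr rfl fun l hl => ?_
    simp only [Finset.mem_erase] at hl
    rw [movePair_of_ne hl.2.1 hl.1, ← toPlane_ofPlane (x l), ← map_sub, perpInv_toPlane]
    simp

theorem vecPot_movePair_right (hjk : j ≠ k) (p q : ℂ) (a : Fin 2) :
    vecPot k (movePair x j k (p, q)) a =
      pairPot ((Finset.univ.erase j).erase k) (fun l => ofPlane (x l)) q p (unitDir a) := by
  rw [vecPot, ← Finset.add_sum_erase _ _ (Finset.mem_erase.2 ⟨hjk, Finset.mem_univ j⟩), pairPot,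
    Pi.add_apply, Finset.sum_apply, movePair_left hjk, movePair_right, Finset.erase_right_comm]
  congr 1
  · rw [← map_sub, perpInv_toPlane]
  · refine Finset.sum_congr rfl fun l hl => ?_
    simp only [Finset.mem_erase] at hl
    rw [movePair_of_ne hl.2.1 hl.1, ← toPlane_ofPlane (x l), ← map_sub, perpInv_toPlane]
    simp

variable {φ : Config N → ℂ}

theorem covDeriv_movePair_left (hφ : Differentiable ℝ φ) (α : ℝ) (hjk : j ≠ k) (p q : ℂ) (a : Fin 2) :
    covDeriv α j a φ (movePair x j k (p, q)) =
      covFst α ((Finset.univ.erase j).erase k) (fun l => ofPlane (x l))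
        (φ ∘ movePair x j k) (unitDir a) p q := by
  rw [covDeriv, covFst, ((hφ _).hasFDerivAt.comp _ (hasFDerivAt_movePair hjk (p, q))).fderiv,
    vecPot_movePair_left hjk]
  simp [toPlane_unitDir]

theorem covDeriv_movePair_right (hφ : Differentiable ℝ φ) (α : ℝ) (hjk : j ≠ k) (p q : ℂ) (a : Fin 2) :
    covDeriv α k a φ (movePair x j k (p, q)) =
      covSnd α ((Finset.univ.erase j).erase k) (fun l => ofPlane (x l))
        (φ ∘ movePair x j k) (unitDir a) p q := by
  rw [covDeriv, covSnd, ((hφ _).hasFDerivAt.comp _ (hasFDerivAt_movePair hjk (p, q))).fderiv,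
    vecPot_movePair_right hjk]
  simp [toPlane_unitDir]

end MovePair

/-- The kinetic energy density of the particle `j`. -/
def kinDensity {N : ℕ} (α : ℝ) (φ : Config N → ℂ) (j : Fin N) (x : Config N) : ℝ≥0∞ :=
  ∑ a, ‖covDeriv α j a φ x‖ₑ ^ 2

theorem measurable_covDeriv {N : ℕ} {α : ℝ} {φ : Config N → ℂ} (hφ : ContDiff ℝ 1 φ) (j : Fin N)
    (a : Fin 2) : Measurable (covDeriv α j a φ) := by
  have h1 : Measurable fun x => fderiv ℝ φ x (Pi.single j (Pi.single a 1)) :=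
    ((hφ.continuous_fderiv one_ne_zero).clm_apply continuous_const).measurable
  have h2 : Measurable fun x : Config N => vecPot j x a := by
    simp only [vecPot, Finset.sum_apply]
    refine Finset.measurable_sum _ fun k _ => ?_
    fin_cases a <;> simp only [perpInv] <;> simp <;> fun_prop
  have h3 := hφ.continuous.measurable
  unfold covDeriv
  fun_prop

theorem measurable_kinDensity {N : ℕ} {α : ℝ} {φ : Config N → ℂ} (hφ : ContDiff ℝ 1 φ) (j : Fin N) :
    Measurable (kinDensity α φ j) :=
  Finset.measurable_sum _ fun a _ => (measurable_covDeriv hφ j a).enorm.pow_const 2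

theorem lmarginal_pair {N : ℕ} {f : Config N → ℝ≥0∞} (hf : Measurable f) {j k : Fin N} (hjk : j ≠ k)
    (x : Config N) :
    (∫⋯∫⁻_{j, k}, f ∂fun _ => volume) x = ∫⁻ z, f (movePair x j k z) := by
  rw [lmarginal_insert _ hf (by simpa using hjk)]
  have h : ∀ y : Config N, (∫⋯∫⁻_{k}, f ∂fun _ => volume) y =
      ∫⁻ q : ℂ, f (Function.update y k (toPlane q)) := by
    intro y
    rw [lmarginal_singleton]
    exact lintegral_plane
  simp only [h]
  rw [lintegral_plane, Measure.volume_eq_prod, lintegral_prod]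
  · rfl
  · exact (hf.comp (continuous_movePair hjk).measurable).aemeasurable

/-! ### Occupation of cells -/

/-- The half-open rectangle with lower left corner `(a, b)` and side lengths `ℓ₀`, `ℓ₁`. -/
def cell (a b ℓ₀ ℓ₁ : ℝ) : Set (Fin 2 → ℝ) :=
  {p | p 0 ∈ Set.Ico a (a + ℓ₀) ∧ p 1 ∈ Set.Ico b (b + ℓ₁)}

theorem measurableSet_cell (a b ℓ₀ ℓ₁ : ℝ) : MeasurableSet (cell a b ℓ₀ ℓ₁) :=
  (measurableSet_Ico.preimage (measurable_pi_apply 0)).inter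
    (measurableSet_Ico.preimage (measurable_pi_apply 1))

theorem ofPlane_mem_rect {a b ℓ₀ ℓ₁ : ℝ} {p : Fin 2 → ℝ} :
    ofPlane p ∈ rect a b ℓ₀ ℓ₁ ↔ p ∈ cell a b ℓ₀ ℓ₁ := Iff.rfl

open Classical in
/-- The particles of the configuration `x` that lie in `Q`. -/
def particlesIn {N : ℕ} (Q : Set (Fin 2 → ℝ)) (x : Config N) : Finset (Fin N) :=
  Finset.univ.filter fun j => x j ∈ Q

@[simp] theorem mem_particlesIn {N : ℕ} {Q : Set (Fin 2 → ℝ)} {x : Config N} {j : Fin N} :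
    j ∈ particlesIn Q x ↔ x j ∈ Q := by simp [particlesIn]

/-- `G` does not change when particles are moved inside `Q`. -/
def MoveInvariant {N : ℕ} {β : Type*} (Q : Set (Fin 2 → ℝ)) (G : Config N → β) : Prop :=
  ∀ x x' : Config N, (∀ j, x j = x' j ∨ (x j ∈ Q ∧ x' j ∈ Q)) → G x = G x'

theorem moveInvariant_particlesIn {N : ℕ} {Q Q' : Set (Fin 2 → ℝ)} (h : Q' ⊆ Q) :
    MoveInvariant (N := N) Q' (particlesIn Q) := by
  intro x x' hx
  ext j
  rcases hx j with h1 | h1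
  · simp [h1]
  · simp [h h1.1, h h1.2]

theorem MoveInvariant.mono {N : ℕ} {β : Type*} {Q Q' : Set (Fin 2 → ℝ)} {G : Config N → β}
    (hG : MoveInvariant Q G) (h : Q' ⊆ Q) : MoveInvariant Q' G := fun x x' hx =>
  hG x x' fun j => (hx j).imp id fun h1 => ⟨h h1.1, h h1.2⟩

theorem measurableSet_particlesIn_eq {N : ℕ} {Q : Set (Fin 2 → ℝ)} (hQ : MeasurableSet Q)
    (t : Finset (Fin N)) : MeasurableSet {x : Config N | particlesIn Q x = t} := by
  have : {x : Config N | particlesIn Q x = t} = ⋂ j, {x | x j ∈ Q ↔ j ∈ t} := by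
    ext x; simp [Finset.ext_iff]
  rw [this]
  refine MeasurableSet.iInter fun j => ?_
  have h1 : MeasurableSet {x : Config N | x j ∈ Q} := hQ.preimage (measurable_pi_apply j)
  by_cases hj : j ∈ t
  · simpa [hj] using h1
  · simp only [hj, iff_false]
    exact h1.compl

theorem measurable_particlesIn {N : ℕ} {Q : Set (Fin 2 → ℝ)} (hQ : MeasurableSet Q) :
    Measurable[_, ⊤] (particlesIn (N := N) Q) := by
  let _ : MeasurableSpace (Finset (Fin N)) := ⊤
  exact measurable_to_countable' fun t => measurableSet_particlesIn_eq hQ t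

/-- The lower bound on the energy of exactly two particles in a cell. -/
theorem pair_in_cell {N : ℕ} {α : ℝ} (h0 : 0 ≤ α) (h1 : α ≤ 1) {φ : Config N → ℂ} (hφ : IsTest φ)
    (a b : ℝ) {ℓ₀ ℓ₁ : ℝ} (hℓ : 0 < ℓ₀) (h01 : ℓ₀ ≤ ℓ₁) (h10 : ℓ₁ ≤ 2 * ℓ₀)
    {G : Config N → ℝ≥0∞} (hGm : Measurable G) (hG : MoveInvariant (cell a b ℓ₀ ℓ₁) G)
    {t : Finset (Fin N)} (ht : t.card = 2) :
    ENNReal.ofReal (7 * Real.pi / 4 * min α (1 / 100000)) *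
        ∫⁻ x in {x | particlesIn (cell a b ℓ₀ ℓ₁) x = t}, G x * ‖φ x‖ₑ ^ 2 ≤
      ENNReal.ofReal (ℓ₀ * ℓ₁) * ∫⁻ x in {x | particlesIn (cell a b ℓ₀ ℓ₁) x = t},
        G x * ∑ j ∈ t, kinDensity α φ j x := by
  obtain ⟨j, k, hjk, rfl⟩ := Finset.card_eq_two.1 ht
  have hφ1 : ContDiff ℝ 1 φ := hφ.smooth.of_le (by exact_mod_cast le_top)
  set Q := cell a b ℓ₀ ℓ₁ with hQ
  have hQm : MeasurableSet Q := measurableSet_cell _ _ _ _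
  have hSm := measurableSet_particlesIn_eq hQm ({j, k} : Finset (Fin N))
  rw [← lintegral_indicator hSm, ← lintegral_indicator hSm,
    ← lintegral_const_mul' _ _ ENNReal.ofReal_ne_top,
    ← lintegral_const_mul' _ _ ENNReal.ofReal_ne_top]
  have m1 : Measurable fun x => ENNReal.ofReal (7 * Real.pi / 4 * min α (1 / 100000)) *
      Set.indicator {x | particlesIn Q x = {j, k}} (fun x => G x * ‖φ x‖ₑ ^ 2) x :=
    ((hGm.mul (hφ1.continuous.measurable.enorm.pow_const 2)).indicator hSm).const_mul _
  have m2 : Measurable fun x => ENNReal.ofReal (ℓ₀ * ℓ₁) *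
      Set.indicator {x | particlesIn Q x = {j, k}} (fun x => G x * ∑ j ∈ {j, k}, kinDensity α φ j x) x :=
    ((hGm.mul (Finset.measurable_sum _ fun j _ => measurable_kinDensity hφ1 j)).indicator hSm).const_mul _
  -- The pair is integrated first, for frozen positions of all other particles.
  refine lintegral_le_of_lmarginal_le {j, k} m1 m2 fun x => ?_
  rw [lmarginal_pair m1 hjk, lmarginal_pair m2 hjk]
  by_cases hx : ∀ l, l ≠ j → l ≠ k → x l ∉ Q
  swap
  · push Not at hx
    obtain ⟨l, hlj, hlk, hl⟩ := hx
    refine le_of_eq_of_le ?_ zero_le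
    refine (lintegral_congr fun z => ?_).trans lintegral_zero
    rw [Set.indicator_of_notMem, mul_zero]
    intro hz
    have : l ∈ particlesIn Q (movePair x j k z) := by
      rw [mem_particlesIn, movePair_of_ne hlj hlk]; exact hl
    rw [show particlesIn Q (movePair x j k z) = {j, k} from hz] at this
    simp [hlj, hlk] at this
  have hmem : ∀ z, movePair x j k z ∈ {x | particlesIn Q x = {j, k}} ↔
      z ∈ rect a b ℓ₀ ℓ₁ ×ˢ rect a b ℓ₀ ℓ₁ := by
    intro z
    simp only [Set.mem_ofPred_eq, Finset.ext_iff, mem_particlesIn, Finset.mem_insert,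
      Finset.mem_singleton, Set.mem_prod]
    constructor
    · intro h
      have e1 := (h j).2 (Or.inl rfl)
      have e2 := (h k).2 (Or.inr rfl)
      rw [movePair_left hjk] at e1
      rw [movePair_right] at e2
      exact ⟨e1, e2⟩
    · rintro ⟨e1, e2⟩ l
      replace e1 : toPlane z.1 ∈ Q := e1
      replace e2 : toPlane z.2 ∈ Q := e2
      rcases eq_or_ne l j with rfl | hj
      · simpa [movePair_left hjk] using e1
      rcases eq_or_ne l k with rfl | hk
      · simpa [movePair_right] using e2
      · simpa [movePair_of_ne hj hk, hj, hk] using hx l hj hk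
  have hind : ∀ f : Config N → ℝ≥0∞, ∀ z, Set.indicator {x | particlesIn Q x = {j, k}} f
      (movePair x j k z) =
      (rect a b ℓ₀ ℓ₁ ×ˢ rect a b ℓ₀ ℓ₁).indicator (fun z => f (movePair x j k z)) z := by
    intro f z
    by_cases hz : z ∈ rect a b ℓ₀ ℓ₁ ×ˢ rect a b ℓ₀ ℓ₁
    · rw [Set.indicator_of_mem hz, Set.indicator_of_mem ((hmem z).2 hz)]
    · rw [Set.indicator_of_notMem hz, Set.indicator_of_notMem fun h => hz ((hmem z).1 h)]
  have hRm : MeasurableSet (rect a b ℓ₀ ℓ₁ ×ˢ rect a b ℓ₀ ℓ₁) :=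
    (measurableSet_rect _ _ _ _).prod (measurableSet_rect _ _ _ _)
  have hz0 : (⟨a, b⟩ : ℂ) ∈ rect a b ℓ₀ ℓ₁ :=
    ⟨⟨le_rfl, by simpa using hℓ⟩, le_rfl, by simpa using hℓ.trans_le h01⟩
  -- With the pair inside the cell the weight does not depend on where exactly it is, so `G` factors
  -- out of both integrals.
  obtain ⟨g, hg⟩ : ∃ g, ∀ z ∈ rect a b ℓ₀ ℓ₁ ×ˢ rect a b ℓ₀ ℓ₁, G (movePair x j k z) = g := by
    refine ⟨G (movePair x j k (⟨a, b⟩, ⟨a, b⟩)), fun z hz => hG _ _ fun l => ?_⟩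
    rcases eq_or_ne l j with rfl | hj
    · right; simp only [movePair_left hjk]; exact ⟨hz.1, hz0⟩
    rcases eq_or_ne l k with rfl | hk
    · right; simp only [movePair_right]; exact ⟨hz.2, hz0⟩
    · left; simp only [movePair_of_ne hj hk]
  simp only [hind]
  rw [lintegral_const_mul' _ _ ENNReal.ofReal_ne_top, lintegral_const_mul' _ _ ENNReal.ofReal_ne_top,
    lintegral_indicator hRm, lintegral_indicator hRm]
  have hψ1 : ContDiff ℝ 1 (φ ∘ movePair x j k) := hφ1.comp (contDiff_movePair hjk)
  have key := pair_estimate h0 h1 hψ1 (s := (Finset.univ.erase j).erase k)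
    (y := fun l => ofPlane (x l)) (fun p q => by
      simp only [Function.comp]
      rw [movePair_swap hjk q p, hφ.symm]) (fun p => by
      simp only [Function.comp]
      by_contra hne
      refine Set.disjoint_left.1 hφ.off_diagonals (subset_tsupport _ hne) ⟨j, k, hjk, ?_⟩
      rw [movePair_left hjk, movePair_right]) a b hℓ h01 h10 (by
      intro l hl
      simp only [Finset.mem_erase] at hl
      rw [ofPlane_mem_rect]
      exact hx l hl.2.1 hl.1)
  have e1 : ∫⁻ z in rect a b ℓ₀ ℓ₁ ×ˢ rect a b ℓ₀ ℓ₁, G (movePair x j k z) * ‖φ (movePair x j k z)‖ₑ ^ 2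
      = g * ∫⁻ z in rect a b ℓ₀ ℓ₁ ×ˢ rect a b ℓ₀ ℓ₁, ‖(φ ∘ movePair x j k) z‖ₑ ^ 2 := by
    rw [← lintegral_const_mul _ (hψ1.continuous.measurable.enorm.pow_const 2)]
    exact setLIntegral_congr_fun hRm fun z hz => by simp only [hg z hz, Function.comp]
  have e2 : ∫⁻ z in rect a b ℓ₀ ℓ₁ ×ˢ rect a b ℓ₀ ℓ₁,
        G (movePair x j k z) * ∑ i ∈ {j, k}, kinDensity α φ i (movePair x j k z)
      = g * ∫⁻ z in rect a b ℓ₀ ℓ₁ ×ˢ rect a b ℓ₀ ℓ₁, pairDensity α ((Finset.univ.erase j).erase k)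
          (fun l => ofPlane (x l)) (φ ∘ movePair x j k) z.1 z.2 := by
    rw [← lintegral_const_mul _ (measurable_pairDensity hψ1)]
    refine setLIntegral_congr_fun hRm fun z hz => ?_
    simp only [hg z hz]
    congr 1
    have hd := hφ1.differentiable one_ne_zero
    rw [Finset.sum_pair hjk, kinDensity, kinDensity, pairDensity]
    simp only [Fin.sum_univ_two]
    rw [← Prod.mk.eta (p := z)]
    simp only [covDeriv_movePair_left hd α hjk, covDeriv_movePair_right hd α hjk]
    rfl
  rw [e1, e2, mul_left_comm, mul_left_comm (ENNReal.ofReal (ℓ₀ * ℓ₁))]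
  exact mul_le_mul' le_rfl key


/-! ### Induction over bisected cells -/

/-- The number of pair energies, in units of one seventh, that `n` particles in a cell have at
least. -/
def pairWeight (n : ℕ) : ℕ := if n = 2 then 7 else (n + 4) * (n - 1)

theorem pairWeight_le_one {n : ℕ} (hn : n ≤ 1) : pairWeight n = 0 := by
  interval_cases n <;> rfl

/-- The factor `2` is the gain of energy scale when the area is halved. The value `7` at two
particles is what the split `3 = 2 + 1` needs, with equality. Elsewhere the quadratic `(n + 4) (n -
1)` suffices, by `(m + n)² ≤ 2 (m² + n²)`; its linear and constant terms are tuned so that `4 = 2 +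
2` still holds, with equality. -/
theorem pairWeight_add_le {m n : ℕ} (h : 3 ≤ m + n) :
    pairWeight (m + n) ≤ 2 * (pairWeight m + pairWeight n) := by
  have h1 : ∀ n, (n + 4) * (n - 1) ≤ pairWeight n := by
    intro n
    unfold pairWeight
    split_ifs with h
    · subst h; norm_num
    · exact le_rfl
  have h2 : pairWeight (m + n) = (m + n + 4) * (m + n - 1) := by
    unfold pairWeight; rw [if_neg (by omega)]
  rcases Nat.lt_or_ge (m + n) 4 with h3 | h3
  · have : m + n = 3 := by omega
    have hm : m ≤ 3 := by omega
    obtain rfl : n = 3 - m := by omega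
    interval_cases m <;> decide
  have a1 := h1 m
  have a2 := h1 n
  rw [h2]
  rcases Nat.eq_zero_or_pos m with rfl | hm
  · simp only [zero_add] at *; omega
  rcases Nat.eq_zero_or_pos n with rfl | hn
  · simp only [add_zero] at *; omega
  obtain ⟨m', rfl⟩ : ∃ m', m = m' + 1 := ⟨m - 1, by omega⟩
  obtain ⟨n', rfl⟩ : ∃ n', n = n' + 1 := ⟨n - 1, by omega⟩
  simp only [Nat.add_sub_cancel] at a1 a2
  rw [show m' + 1 + (n' + 1) - 1 = m' + n' + 1 by omega]
  have : (m' + 1 + (n' + 1) + 4) * (m' + n' + 1) ≤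
      2 * ((m' + 1 + 4) * m' + (n' + 1 + 4) * n') := by
    zify at h3 ⊢
    nlinarith [sq_nonneg ((m' : ℤ) - n')]
  omega

/-- The local energy bound in the cell `Q` of area `A`, with respect to all weights that ignore the
positions of the particles inside `Q`. -/
def CellBound {N : ℕ} (α : ℝ) (φ : Config N → ℂ) (Q : Set (Fin 2 → ℝ)) (A : ℝ) : Prop :=
  ∀ G : Config N → ℝ≥0∞, Measurable G → MoveInvariant Q G →
    ENNReal.ofReal (7 * Real.pi / 4 * min α (1 / 100000)) *
        ∫⁻ x, G x * (pairWeight (particlesIn Q x).card * ‖φ x‖ₑ ^ 2) ≤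
      ENNReal.ofReal (7 * A) * ∫⁻ x, G x * ∑ j ∈ particlesIn Q x, kinDensity α φ j x

theorem measurable_sum_particlesIn {N : ℕ} {Q : Set (Fin 2 → ℝ)} (hQ : MeasurableSet Q)
    {f : Fin N → Config N → ℝ≥0∞} (hf : ∀ j, Measurable (f j)) :
    Measurable fun x => ∑ j ∈ particlesIn Q x, f j x := by
  classical
  have : (fun x => ∑ j ∈ particlesIn Q x, f j x) = fun x => ∑ j, if x j ∈ Q then f j x else 0 := by
    funext x
    rw [particlesIn, Finset.sum_filter]
  rw [this]
  refine Finset.measurable_sum _ fun j _ => ?_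
  exact Measurable.ite (hQ.preimage (measurable_pi_apply j)) (hf j) measurable_const

/-- Exactly two particles in the cell are treated by the two-particle bound, three or more by the
bounds in the halves and `pairWeight_add_le`. Nothing is counted twice: the two cases are disjoint
events, and each particle of the cell is in exactly one half. -/
theorem CellBound.of_halves {N : ℕ} {α : ℝ} (h0 : 0 ≤ α) (h1 : α ≤ 1) {φ : Config N → ℂ}
    (hφ : IsTest φ) (a b : ℝ) {ℓ₀ ℓ₁ : ℝ} (hℓ : 0 < ℓ₀) (h01 : ℓ₀ ≤ ℓ₁) (h10 : ℓ₁ ≤ 2 * ℓ₀)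
    {Q₁ Q₂ : Set (Fin 2 → ℝ)} (hm1 : MeasurableSet Q₁) (hm2 : MeasurableSet Q₂)
    (hun : cell a b ℓ₀ ℓ₁ = Q₁ ∪ Q₂) (hdis : Disjoint Q₁ Q₂)
    (hQ₁ : CellBound α φ Q₁ (ℓ₀ * ℓ₁ / 2)) (hQ₂ : CellBound α φ Q₂ (ℓ₀ * ℓ₁ / 2)) :
    CellBound α φ (cell a b ℓ₀ ℓ₁) (ℓ₀ * ℓ₁) := by
  classical
  intro G hGm hG
  have hφ1 : ContDiff ℝ 1 φ := hφ.smooth.of_le (by exact_mod_cast le_top)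
  have hℓ1 : 0 < ℓ₁ := hℓ.trans_le h01
  set Q := cell a b ℓ₀ ℓ₁ with hQ
  have hQm : MeasurableSet Q := measurableSet_cell _ _ _ _
  set κ := ENNReal.ofReal (7 * Real.pi / 4 * min α (1 / 100000)) with hκ
  have hφm : Measurable fun x => ‖φ x‖ₑ ^ 2 := hφ1.continuous.measurable.enorm.pow_const 2
  have hkm := fun j => measurable_kinDensity (α := α) hφ1 j
  have hsub1 : Q₁ ⊆ Q := by rw [hun]; exact Set.subset_union_left
  have hsub2 : Q₂ ⊆ Q := by rw [hun]; exact Set.subset_union_right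
  have hpdis : ∀ x : Config N, Disjoint (particlesIn Q₁ x) (particlesIn Q₂ x) := fun x =>
    Finset.disjoint_left.2 fun j hj1 hj2 =>
      Set.disjoint_left.1 hdis (mem_particlesIn.1 hj1) (mem_particlesIn.1 hj2)
  have hpun : ∀ x : Config N, particlesIn Q x = particlesIn Q₁ x ∪ particlesIn Q₂ x := by
    intro x; ext j; simp [hun]
  have hcard : ∀ x : Config N, (particlesIn Q x).card =
      (particlesIn Q₁ x).card + (particlesIn Q₂ x).card := fun x => by
    rw [hpun, Finset.card_union_of_disjoint (hpdis x)]
  have hmc : ∀ P : Finset (Fin N) → Prop, MeasurableSet {x : Config N | P (particlesIn Q x)} := by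
    intro P
    exact measurable_particlesIn hQm (MeasurableSpace.measurableSet_top (s := {t | P t}))
  -- Moving particles inside one half, or inside any subset of the cell, does not change the total
  -- number in the cell, so `H` is an admissible weight for both halves. This is why the induction
  -- hypothesis quantifies over weights.
  set H : Config N → ℝ≥0∞ := fun x => if 3 ≤ (particlesIn Q x).card then G x else 0 with hH
  have hHm : Measurable H := Measurable.ite (hmc fun t => 3 ≤ t.card) hGm measurable_const
  have hHinv : ∀ Q', Q' ⊆ Q → MoveInvariant Q' H := by
    intro Q' hQ' x x' hx
    simp only [hH, moveInvariant_particlesIn hQ' x x' hx, hG.mono hQ' x x' hx]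
  have b1 := hQ₁ H hHm (hHinv _ hsub1)
  have b2 := hQ₂ H hHm (hHinv _ hsub2)
  -- The event of two particles in the cell is split according to which two they are.
  set T : Finset (Finset (Fin N)) := Finset.powersetCard 2 Finset.univ with hT
  set e : Config N → ℝ≥0∞ := fun x => ∑ j ∈ particlesIn Q x, kinDensity α φ j x with he
  have hem : Measurable e := measurable_sum_particlesIn hQm hkm
  have mGφ : Measurable fun x => G x * ‖φ x‖ₑ ^ 2 := hGm.mul hφm
  have mGe : Measurable fun x => G x * e x := hGm.mul hem
  have hpair : κ * ∫⁻ x, ∑ t ∈ T, {x | particlesIn Q x = t}.indicator (fun x => G x * ‖φ x‖ₑ ^ 2) x ≤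
      ENNReal.ofReal (ℓ₀ * ℓ₁) *
        ∫⁻ x, ∑ t ∈ T, {x | particlesIn Q x = t}.indicator (fun x => G x * e x) x := by
    rw [lintegral_finsetSum _ fun t _ =>
        mGφ.indicator (measurableSet_particlesIn_eq hQm t),
      lintegral_finsetSum _ fun t _ =>
        mGe.indicator (measurableSet_particlesIn_eq hQm t), Finset.mul_sum, Finset.mul_sum]
    refine Finset.sum_le_sum fun t ht => ?_
    rw [lintegral_indicator (measurableSet_particlesIn_eq hQm t),
      lintegral_indicator (measurableSet_particlesIn_eq hQm t)]
    refine (pair_in_cell h0 h1 hφ a b hℓ h01 h10 hGm hG (Finset.mem_powersetCard.1 ht).2).trans_eq ?_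
    congr 1
    refine setLIntegral_congr_fun (measurableSet_particlesIn_eq hQm t) fun x hx => ?_
    simp only [he, show particlesIn Q x = t from hx]
  have hsumT : ∀ (f : Config N → ℝ≥0∞) (x : Config N),
      ∑ t ∈ T, {x | particlesIn Q x = t}.indicator f x =
        if (particlesIn Q x).card = 2 then f x else 0 := by
    intro f x
    simp only [Set.indicator_apply, Set.mem_ofPred_eq]
    rw [Finset.sum_ite_eq]
    simp [hT]
  simp only [hsumT] at hpair
  have m2 : Measurable fun x => if (particlesIn Q x).card = 2 then G x * ‖φ x‖ₑ ^ 2 else 0 :=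
    Measurable.ite (hmc fun t => t.card = 2) (hGm.mul hφm) measurable_const
  have hw : ∀ Q' : Set (Fin 2 → ℝ), MeasurableSet Q' →
      Measurable fun x : Config N => (pairWeight (particlesIn Q' x).card : ℝ≥0∞) := by
    intro Q' hQ'
    let _ : MeasurableSpace (Finset (Fin N)) := ⊤
    exact (measurable_from_top (f := fun t : Finset (Fin N) => (pairWeight t.card : ℝ≥0∞))).comp
      (measurable_particlesIn hQ')
  have mw : ∀ Q' : Set (Fin 2 → ℝ), MeasurableSet Q' →
      Measurable fun x : Config N => H x * (pairWeight (particlesIn Q' x).card * ‖φ x‖ₑ ^ 2) :=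
    fun Q' hQ' => hHm.mul ((hw Q' hQ').mul hφm)
  have hpt : ∀ x, G x * (pairWeight (particlesIn Q x).card * ‖φ x‖ₑ ^ 2) ≤
      7 * (if (particlesIn Q x).card = 2 then G x * ‖φ x‖ₑ ^ 2 else 0) +
      2 * (H x * (pairWeight (particlesIn Q₁ x).card * ‖φ x‖ₑ ^ 2) +
        H x * (pairWeight (particlesIn Q₂ x).card * ‖φ x‖ₑ ^ 2)) := by
    intro x
    rcases Nat.lt_or_ge (particlesIn Q x).card 2 with hc | hc
    · rw [pairWeight_le_one (by omega)]; simp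
    rcases Nat.lt_or_ge (particlesIn Q x).card 3 with hc' | hc'
    · have h2 : (particlesIn Q x).card = 2 := by omega
      rw [if_pos h2, h2]
      refine le_add_right (le_of_eq ?_)
      simp only [pairWeight, if_true, Nat.cast_ofNat]
      ring
    · refine le_add_left ?_
      simp only [hH, if_pos hc']
      rw [hcard] at hc' ⊢
      have h3 : (pairWeight ((particlesIn Q₁ x).card + (particlesIn Q₂ x).card) : ℝ≥0∞) ≤
          2 * (pairWeight (particlesIn Q₁ x).card + pairWeight (particlesIn Q₂ x).card) := by
        exact_mod_cast pairWeight_add_le hc'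
      calc _ ≤ G x * (2 * (pairWeight (particlesIn Q₁ x).card + pairWeight (particlesIn Q₂ x).card) *
            ‖φ x‖ₑ ^ 2) := by gcongr
        _ = _ := by ring
  have mE : Measurable fun x => if (particlesIn Q x).card = 2 then G x * e x else 0 :=
    Measurable.ite (hmc fun t => t.card = 2) (hGm.mul hem) measurable_const
  have m1e : Measurable fun x => H x * ∑ j ∈ particlesIn Q₁ x, kinDensity α φ j x :=
    hHm.mul (measurable_sum_particlesIn hm1 hkm)
  have mws : Measurable fun x => H x * (pairWeight (particlesIn Q₁ x).card * ‖φ x‖ₑ ^ 2) +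
      H x * (pairWeight (particlesIn Q₂ x).card * ‖φ x‖ₑ ^ 2) := (mw _ hm1).add (mw _ hm2)
  calc κ * ∫⁻ x, G x * (pairWeight (particlesIn Q x).card * ‖φ x‖ₑ ^ 2)
      ≤ κ * ∫⁻ x, (7 * (if (particlesIn Q x).card = 2 then G x * ‖φ x‖ₑ ^ 2 else 0) +
          2 * (H x * (pairWeight (particlesIn Q₁ x).card * ‖φ x‖ₑ ^ 2) +
            H x * (pairWeight (particlesIn Q₂ x).card * ‖φ x‖ₑ ^ 2))) :=
        mul_le_mul' le_rfl (lintegral_mono hpt)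
    _ = 7 * (κ * ∫⁻ x, (if (particlesIn Q x).card = 2 then G x * ‖φ x‖ₑ ^ 2 else 0)) +
        2 * (κ * (∫⁻ x, H x * (pairWeight (particlesIn Q₁ x).card * ‖φ x‖ₑ ^ 2)) +
          κ * ∫⁻ x, H x * (pairWeight (particlesIn Q₂ x).card * ‖φ x‖ₑ ^ 2)) := by
        rw [lintegral_add_left (m2.const_mul _), lintegral_const_mul _ m2, lintegral_const_mul _ mws,
          lintegral_add_left (mw _ hm1)]
        ring
    _ ≤ 7 * (ENNReal.ofReal (ℓ₀ * ℓ₁) * ∫⁻ x, (if (particlesIn Q x).card = 2 then G x * e x else 0)) +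
        2 * (ENNReal.ofReal (7 * (ℓ₀ * ℓ₁ / 2)) *
            (∫⁻ x, H x * ∑ j ∈ particlesIn Q₁ x, kinDensity α φ j x) +
          ENNReal.ofReal (7 * (ℓ₀ * ℓ₁ / 2)) *
            ∫⁻ x, H x * ∑ j ∈ particlesIn Q₂ x, kinDensity α φ j x) := by
        gcongr
    _ = ENNReal.ofReal (7 * (ℓ₀ * ℓ₁)) *
        ∫⁻ x, ((if (particlesIn Q x).card = 2 then G x * e x else 0) +
          (H x * (∑ j ∈ particlesIn Q₁ x, kinDensity α φ j x) +
            H x * ∑ j ∈ particlesIn Q₂ x, kinDensity α φ j x)) := by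
        rw [lintegral_add_left mE, lintegral_add_left m1e]
        have c1 : 2 * ENNReal.ofReal (7 * (ℓ₀ * ℓ₁ / 2)) = ENNReal.ofReal (7 * (ℓ₀ * ℓ₁)) := by
          rw [← ENNReal.ofReal_ofNat 2, ← ENNReal.ofReal_mul (by norm_num)]
          congr 1; ring
        have c2 : 7 * ENNReal.ofReal (ℓ₀ * ℓ₁) = ENNReal.ofReal (7 * (ℓ₀ * ℓ₁)) := by
          rw [ENNReal.ofReal_mul (p := 7) (by norm_num), ENNReal.ofReal_ofNat]
        rw [← c2, ← mul_add, ← mul_assoc 2, c1, ← c2]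
        ring
    _ ≤ ENNReal.ofReal (7 * (ℓ₀ * ℓ₁)) * ∫⁻ x, G x * e x := by
        refine mul_le_mul' le_rfl (lintegral_mono fun x => ?_)
        simp only []
        rw [← mul_add, ← Finset.sum_union (hpdis x), ← hpun]
        simp only [hH]
        by_cases hc : (particlesIn Q x).card = 2
        · rw [if_pos hc, if_neg (by omega), zero_mul, add_zero]
        · rw [if_neg hc, zero_add]
          split_ifs
          · exact le_rfl
          · simp

theorem CellBound.of_card_le_one {N : ℕ} {α : ℝ} {φ : Config N → ℂ} {Q : Set (Fin 2 → ℝ)} (A : ℝ)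
    (h : ∀ x, φ x ≠ 0 → (particlesIn Q x).card ≤ 1) : CellBound α φ Q A := by
  intro G _ _
  have : ∀ x, G x * (pairWeight (particlesIn Q x).card * ‖φ x‖ₑ ^ 2) = 0 := by
    intro x
    by_cases hx : φ x = 0
    · simp [hx]
    · rw [pairWeight_le_one (h x hx)]; simp
  simp [this]

theorem cell_split_left (a b ℓ₀ ℓ₁ : ℝ) (_h : 0 ≤ ℓ₀) :
    cell a b ℓ₀ ℓ₁ = cell a b (ℓ₀ / 2) ℓ₁ ∪ cell (a + ℓ₀ / 2) b (ℓ₀ / 2) ℓ₁ ∧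
      Disjoint (cell a b (ℓ₀ / 2) ℓ₁) (cell (a + ℓ₀ / 2) b (ℓ₀ / 2) ℓ₁) := by
  constructor
  · ext p
    simp only [cell, Set.mem_union, Set.mem_ofPred_eq, Set.mem_Ico]
    constructor
    · rintro ⟨⟨h1, h2⟩, h3⟩
      rcases lt_or_ge (p 0) (a + ℓ₀ / 2) with h4 | h4
      · exact Or.inl ⟨⟨h1, h4⟩, h3⟩
      · exact Or.inr ⟨⟨h4, by linarith⟩, h3⟩
    · rintro (⟨⟨h1, h2⟩, h3⟩ | ⟨⟨h1, h2⟩, h3⟩)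
      · exact ⟨⟨h1, by linarith⟩, h3⟩
      · exact ⟨⟨by linarith, by linarith⟩, h3⟩
  · refine Set.disjoint_left.2 fun p hp hp' => ?_
    exact absurd hp.1.2 (not_lt.2 hp'.1.1)

theorem cell_split_right (a b ℓ₀ ℓ₁ : ℝ) (_h : 0 ≤ ℓ₁) :
    cell a b ℓ₀ ℓ₁ = cell a b ℓ₀ (ℓ₁ / 2) ∪ cell a (b + ℓ₁ / 2) ℓ₀ (ℓ₁ / 2) ∧
      Disjoint (cell a b ℓ₀ (ℓ₁ / 2)) (cell a (b + ℓ₁ / 2) ℓ₀ (ℓ₁ / 2)) := by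
  constructor
  · ext p
    simp only [cell, Set.mem_union, Set.mem_ofPred_eq, Set.mem_Ico]
    constructor
    · rintro ⟨h3, h1, h2⟩
      rcases lt_or_ge (p 1) (b + ℓ₁ / 2) with h4 | h4
      · exact Or.inl ⟨h3, h1, h4⟩
      · exact Or.inr ⟨h3, h4, by linarith⟩
    · rintro (⟨h3, h1, h2⟩ | ⟨h3, h1, h2⟩)
      · exact ⟨h3, h1, by linarith⟩
      · exact ⟨h3, by linarith, by linarith⟩
  · refine Set.disjoint_left.2 fun p hp hp' => ?_
    exact absurd hp.2.2 (not_lt.2 hp'.2.1)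

theorem isClosed_diagonals (N : ℕ) : IsClosed (diagonals N) := by
  have : diagonals N = ⋃ j : Fin N, ⋃ k : Fin N, {x : Config N | j ≠ k ∧ x j = x k} := by
    ext x; simp [diagonals]
  rw [this]
  refine isClosed_iUnion_of_finite fun j => isClosed_iUnion_of_finite fun k => ?_
  by_cases h : j = k
  · simp [h]
  · simp only [ne_eq, h, not_false_eq_true, true_and]
    exact isClosed_eq (continuous_apply j) (continuous_apply k)

/-- The compact support has positive distance from the closed set of diagonals, and placing `x_j` on
top of `x_k` reaches a diagonal by a displacement of size `‖x j - x k‖`. -/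
theorem IsTest.exists_separation {N : ℕ} {φ : Config N → ℂ} (hφ : IsTest φ) :
    ∃ δ > 0, ∀ x, φ x ≠ 0 → ∀ j k, j ≠ k → δ ≤ ‖x j - x k‖ := by
  obtain ⟨δ, hδ, hd⟩ := hφ.off_diagonals.exists_thickenings hφ.compact.isCompact
    (isClosed_diagonals N)
  refine ⟨δ, hδ, fun x hx j k hjk => ?_⟩
  by_contra hlt
  have h1 : x ∈ Metric.thickening δ (tsupport φ) :=
    Metric.self_subset_thickening hδ _ (subset_tsupport _ hx)
  have h2 : x ∈ Metric.thickening δ (diagonals N) := by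
    refine Metric.mem_thickening_iff.2 ⟨Function.update x j (x k), ⟨j, k, hjk, ?_⟩, ?_⟩
    · simp [hjk.symm]
    · rw [dist_eq_norm, pi_norm_lt_iff hδ]
      intro l
      rcases eq_or_ne l j with rfl | hl
      · simpa using hlt
      · simpa [hl] using hδ
  exact Set.disjoint_left.1 hd h1 h2

/-- Each step cuts a square into two rectangles of ratio `1 : 2` and these into squares, so the
aspect ratio never exceeds two. Below the separation length a half-open cell contains at most one
particle, and the bound is trivial. -/
theorem CellBound.square {N : ℕ} {α : ℝ} (h0 : 0 ≤ α) (h1 : α ≤ 1) {φ : Config N → ℂ}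
    (hφ : IsTest φ) (a b : ℝ) {ℓ : ℝ} (hℓ : 0 < ℓ) :
    CellBound α φ (cell a b ℓ ℓ) (ℓ * ℓ) := by
  obtain ⟨δ, hδ, hsep⟩ := hφ.exists_separation
  have main : ∀ n : ℕ, ∀ a b ℓ : ℝ, 0 < ℓ → ℓ ≤ 2 ^ n * δ → CellBound α φ (cell a b ℓ ℓ) (ℓ * ℓ) := by
    intro n
    induction n with
    | zero =>
      intro a b ℓ hℓ hle
      refine CellBound.of_card_le_one _ fun x hx => ?_
      rw [Finset.card_le_one]
      intro j hj k hk
      by_contra hjk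
      have h3 := hsep x hx j k hjk
      rw [mem_particlesIn] at hj hk
      have h4 : ‖x j - x k‖ < δ := by
        rw [pi_norm_lt_iff hδ]
        intro i
        rw [Real.norm_eq_abs, abs_lt]
        obtain ⟨⟨j1, j2⟩, j3, j4⟩ := hj
        obtain ⟨⟨k1, k2⟩, k3, k4⟩ := hk
        simp only [pow_zero, one_mul] at hle
        fin_cases i <;> simp only [Pi.sub_apply] <;> constructor <;> simp <;> linarith
      linarith
    | succ n ih =>
      intro a b ℓ hℓ hle
      have hle' : ℓ / 2 ≤ 2 ^ n * δ := by rw [pow_succ] at hle; linarith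
      have half : ∀ a b : ℝ, CellBound α φ (cell a b (ℓ / 2) ℓ) (ℓ / 2 * ℓ) := by
        intro a b
        obtain ⟨hu, hd⟩ := cell_split_right a b (ℓ / 2) ℓ hℓ.le
        have e : ℓ / 2 * ℓ / 2 = ℓ / 2 * (ℓ / 2) := by ring
        refine CellBound.of_halves h0 h1 hφ a b (by linarith) (by linarith) (by linarith)
          (measurableSet_cell _ _ _ _) (measurableSet_cell _ _ _ _) hu hd ?_ ?_
        · rw [e]; exact ih _ _ _ (by linarith) hle'
        · rw [e]; exact ih _ _ _ (by linarith) hle'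
      obtain ⟨hu, hd⟩ := cell_split_left a b ℓ ℓ hℓ.le
      have e : ℓ * ℓ / 2 = ℓ / 2 * ℓ := by ring
      refine CellBound.of_halves h0 h1 hφ a b hℓ le_rfl (by linarith)
          (measurableSet_cell _ _ _ _) (measurableSet_cell _ _ _ _) hu hd ?_ ?_
      · rw [e]; exact half _ _
      · rw [e]; exact half _ _
  obtain ⟨n, hn⟩ := pow_unbounded_of_one_lt (ℓ / δ) one_lt_two
  exact main n a b ℓ hℓ (by rw [div_lt_iff₀ hδ] at hn; exact hn.le)

/-! ### Lower bound in the unit square -/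

theorem configsIn_eq_pi (N : ℕ) (Ω : Set (Fin 2 → ℝ)) :
    configsIn N Ω = Set.univ.pi fun _ => Ω := by
  ext x; simp [configsIn]

theorem measurableSet_configsIn {N : ℕ} {Ω : Set (Fin 2 → ℝ)} (h : MeasurableSet Ω) :
    MeasurableSet (configsIn N Ω) := by
  rw [configsIn_eq_pi]; exact MeasurableSet.univ_pi fun _ => h

theorem cell_unit : cell 0 0 1 1 = Set.univ.pi fun _ : Fin 2 => Set.Ico (0 : ℝ) 1 := by
  ext p; simp [cell, Fin.forall_fin_two]

theorem unitSquare_eq_pi : unitSquare = Set.univ.pi fun _ : Fin 2 => Set.Icc (0 : ℝ) 1 := by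
  rw [Set.pi_univ_Icc]; rfl

theorem cell_unit_subset : cell 0 0 1 1 ⊆ unitSquare := by
  rw [cell_unit, unitSquare_eq_pi]
  exact Set.pi_mono fun _ _ => Set.Ico_subset_Icc_self

theorem configsIn_cell_ae_eq (N : ℕ) :
    configsIn N (cell 0 0 1 1) =ᵐ[volume] configsIn N unitSquare := by
  rw [configsIn_eq_pi, configsIn_eq_pi, cell_unit, unitSquare_eq_pi]
  exact Measure.ae_eq_set_pi fun _ _ => Measure.ae_eq_set_pi fun _ _ => Ico_ae_eq_Icc

theorem energy_lower_bound_test {N : ℕ} {α : ℝ} (h0 : 0 ≤ α) (h1 : α ≤ 1) {φ : Config N → ℂ}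
    (hφ : IsTest φ) :
    ENNReal.ofReal (7 * Real.pi / 4 * min α (1 / 100000)) * pairWeight N *
        ∫⁻ x in configsIn N unitSquare, ‖φ x‖ₑ ^ 2 ≤
      7 * ∑ j, ∫⁻ x in configsIn N unitSquare, ∑ a, ‖covDeriv α j a φ x‖ₑ ^ 2 := by
  have hφ1 : ContDiff ℝ 1 φ := hφ.smooth.of_le (by exact_mod_cast le_top)
  set Q := cell 0 0 1 1 with hQ
  have hQm : MeasurableSet Q := measurableSet_cell _ _ _ _
  have hSm : MeasurableSet (configsIn N Q) := measurableSet_configsIn hQm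
  have hcount : ∀ x ∈ configsIn N Q, particlesIn Q x = Finset.univ := by
    intro x hx; ext j; simpa using hx j
  -- The indicator of "all particles are in the cell" is blind to motion inside the cell, hence an
  -- admissible weight. It forces the particle number to be `N`.
  have key := CellBound.square h0 h1 hφ 0 0 one_pos ((configsIn N Q).indicator 1)
    (measurable_one.indicator hSm) (by
      intro x x' hx
      have : x ∈ configsIn N Q ↔ x' ∈ configsIn N Q := by
        refine forall_congr' fun j => ?_
        rcases hx j with h | h
        · rw [h]
        · exact ⟨fun _ => h.2, fun _ => h.1⟩
      by_cases hx' : x' ∈ configsIn N Q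
      · rw [Set.indicator_of_mem hx', Set.indicator_of_mem (this.2 hx')]; rfl
      · rw [Set.indicator_of_notMem hx', Set.indicator_of_notMem (fun h => hx' (this.1 h))])
  have hi : ∀ f : Config N → ℝ≥0∞, ∫⁻ x, (configsIn N Q).indicator 1 x * f x =
      ∫⁻ x in configsIn N Q, f x := by
    intro f
    rw [← lintegral_indicator hSm]
    refine lintegral_congr fun x => ?_
    by_cases hx : x ∈ configsIn N Q <;> simp [hx]
  have e1 : ∫⁻ x in configsIn N Q, (pairWeight (particlesIn Q x).card : ℝ≥0∞) * ‖φ x‖ₑ ^ 2 =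
      ∫⁻ x in configsIn N Q, (pairWeight N : ℝ≥0∞) * ‖φ x‖ₑ ^ 2 :=
    setLIntegral_congr_fun hSm fun x hx => by
      simp only [hcount x hx, Finset.card_univ, Fintype.card_fin]
  have e2 : ∫⁻ x in configsIn N Q, ∑ j ∈ particlesIn Q x, kinDensity α φ j x =
      ∫⁻ x in configsIn N Q, ∑ j, kinDensity α φ j x :=
    setLIntegral_congr_fun hSm fun x hx => by simp only [hcount x hx]
  rw [hi, hi, e1, e2,
    lintegral_const_mul _ (hφ1.continuous.measurable.enorm.pow_const 2), ← mul_assoc,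
    lintegral_finsetSum _ fun j _ => measurable_kinDensity hφ1 j,
    setLIntegral_congr (configsIn_cell_ae_eq N)] at key
  refine key.trans ?_
  simp only [mul_one]
  rw [ENNReal.ofReal_ofNat]
  refine mul_le_mul' le_rfl (Finset.sum_le_sum fun j _ => ?_)
  exact lintegral_mono_set fun x hx l => cell_unit_subset (hx l)

theorem lintegral_enorm_sq_eq {X : Type*} [MeasurableSpace X] (μ : Measure X) (f : X → ℂ) :
    ∫⁻ x, ‖f x‖ₑ ^ 2 ∂μ = eLpNorm f 2 μ ^ 2 := by
  have h := eLpNorm_nnreal_pow_eq_lintegral (f := f) (μ := μ) (p := 2) two_ne_zero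
  simp only [NNReal.coe_ofNat, ENNReal.rpow_ofNat] at h
  rw [← h]; rfl

theorem tendsto_lintegral_enorm_sq {X : Type*} [MeasurableSpace X] {μ : Measure X} {f : ℕ → X → ℂ}
    {g : X → ℂ} (hf : ∀ n, AEStronglyMeasurable (f n) μ) (hg : MemLp g 2 μ)
    (h : Tendsto (fun n => eLpNorm (f n - g) 2 μ) atTop (𝓝 0)) (S : Set X) :
    Tendsto (fun n => ∫⁻ x in S, ‖f n x‖ₑ ^ 2 ∂μ) atTop (𝓝 (∫⁻ x in S, ‖g x‖ₑ ^ 2 ∂μ)) := by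
  simp only [lintegral_enorm_sq_eq]
  refine ((ENNReal.continuous_pow 2).tendsto _).comp ?_
  set ε : ℕ → ℝ≥0∞ := fun n => eLpNorm (f n - g) 2 (μ.restrict S)
  have hε : Tendsto ε atTop (𝓝 0) :=
    tendsto_of_tendsto_of_tendsto_of_le_of_le tendsto_const_nhds h (fun _ => zero_le)
      (fun n => eLpNorm_mono_measure _ Measure.restrict_le_self)
  have hgS : MemLp g 2 (μ.restrict S) := hg.restrict S
  have hfS : ∀ n, AEStronglyMeasurable (f n) (μ.restrict S) := fun n => (hf n).restrict
  have h1 : ∀ n, eLpNorm (f n) 2 (μ.restrict S) ≤ eLpNorm g 2 (μ.restrict S) + ε n := by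
    intro n
    have := eLpNorm_add_le (μ := μ.restrict S) hgS.1 ((hfS n).sub hgS.1) (p := 2) one_le_two
    rwa [add_sub_cancel] at this
  have h2 : ∀ n, eLpNorm g 2 (μ.restrict S) - ε n ≤ eLpNorm (f n) 2 (μ.restrict S) := by
    intro n
    rw [tsub_le_iff_right]
    have := eLpNorm_sub_le (μ := μ.restrict S) (hfS n) ((hfS n).sub hgS.1) (p := 2) one_le_two
    rwa [sub_sub_cancel] at this
  refine tendsto_of_tendsto_of_tendsto_of_le_of_le ?_ ?_ h2 h1
  · simpa using ENNReal.Tendsto.sub tendsto_const_nhds hε (Or.inl hgS.2.ne)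
  · simpa using tendsto_const_nhds.add hε

theorem IsTest.contDiff_one {N : ℕ} {φ : Config N → ℂ} (hφ : IsTest φ) : ContDiff ℝ 1 φ :=
  hφ.smooth.of_le (by exact_mod_cast le_top)

/-- Norm and energy over the cube both converge along the approximating test functions, so the bound
survives the closure of the operator. -/
theorem energy_lower_bound {N : ℕ} {α : ℝ} (h0 : 0 ≤ α) (h1 : α ≤ 1) {Ψ : Config N → ℂ}
    {F : Fin N → Fin 2 → Config N → ℂ} (h : IsCovGrad α Ψ F) :
    ENNReal.ofReal (7 * Real.pi / 4 * min α (1 / 100000)) * pairWeight N *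
        ∫⁻ x in configsIn N unitSquare, ‖Ψ x‖ₑ ^ 2 ≤ 7 * kineticEnergy unitSquare F := by
  obtain ⟨φ, hφ, hφΨ, hφF⟩ := h.approx
  have hS : MeasurableSet (configsIn N unitSquare) :=
    measurableSet_configsIn (by unfold unitSquare; exact measurableSet_Icc)
  set S := configsIn N unitSquare
  have hk : kineticEnergy unitSquare F = ∑ j, ∑ a, ∫⁻ x in S, ‖F j a x‖ₑ ^ 2 := by
    refine Finset.sum_congr rfl fun j _ => lintegral_finsetSum' _ fun a _ => ?_
    exact ((h.memLp_grad j a).1.restrict.enorm).pow_const 2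
  have hkn : ∀ n, ∑ j, ∫⁻ x in S, ∑ a, ‖covDeriv α j a (φ n) x‖ₑ ^ 2 =
      ∑ j, ∑ a, ∫⁻ x in S, ‖covDeriv α j a (φ n) x‖ₑ ^ 2 := fun n => by
    refine Finset.sum_congr rfl fun j _ => lintegral_finsetSum _ fun a _ => ?_
    exact (measurable_covDeriv (hφ n).contDiff_one j a).enorm.pow_const 2
  have t1 := tendsto_lintegral_enorm_sq
    (fun n => (hφ n).contDiff_one.continuous.aestronglyMeasurable) h.memLp hφΨ S
  have t2 : Tendsto (fun n => ∑ j, ∑ a, ∫⁻ x in S, ‖covDeriv α j a (φ n) x‖ₑ ^ 2) atTop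
      (𝓝 (∑ j, ∑ a, ∫⁻ x in S, ‖F j a x‖ₑ ^ 2)) :=
    tendsto_finsetSum _ fun j _ => tendsto_finsetSum _ fun a _ =>
      tendsto_lintegral_enorm_sq
        (fun n => (measurable_covDeriv (hφ n).contDiff_one j a).aestronglyMeasurable)
        (h.memLp_grad j a) (hφF j a) S
  rw [hk]
  refine le_of_tendsto_of_tendsto'
    (ENNReal.Tendsto.const_mul t1 (Or.inr (ENNReal.mul_ne_top ENNReal.ofReal_ne_top (by simp))))
    (ENNReal.Tendsto.const_mul t2 (Or.inr (by simp))) fun n => ?_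
  rw [← hkn]
  exact energy_lower_bound_test h0 h1 (hφ n)

/-- The lower bound on the Neumann ground-state energy. -/
theorem neumannEnergy_ge {N : ℕ} {α : ℝ} (h0 : 0 ≤ α) (h1 : α ≤ 1) (hN : 1 ≤ N) :
    ENNReal.ofReal (Real.pi / 4 * min α (1 / 100000) * (((N : ℝ) + 4) * ((N : ℝ) - 1))) ≤
      neumannEnergy N α unitSquare := by
  refine le_sInf ?_
  rintro E ⟨Ψ, F, hF, hΨ, rfl⟩
  have key := energy_lower_bound h0 h1 hF
  rw [hΨ, mul_one] at key
  have hα' : 0 ≤ min α (1 / 100000) := le_min h0 (by norm_num)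
  have hw : (((N : ℝ) + 4) * ((N : ℝ) - 1)) ≤ (pairWeight N : ℝ) := by
    unfold pairWeight
    split_ifs with h
    · subst h; norm_num
    · push_cast [Nat.cast_sub hN]; exact le_rfl
  have h7 : ENNReal.ofReal (7 * Real.pi / 4 * min α (1 / 100000)) * pairWeight N =
      7 * ENNReal.ofReal (Real.pi / 4 * min α (1 / 100000) * pairWeight N) := by
    rw [← ENNReal.ofReal_natCast, ← ENNReal.ofReal_mul (by positivity), ← ENNReal.ofReal_ofNat 7,
      ← ENNReal.ofReal_mul (by norm_num)]
    congr 1; ring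
  rw [h7] at key
  have := (ENNReal.mul_le_mul_iff_right (by norm_num) (by simp)).1 key
  exact (ENNReal.ofReal_le_ofReal (by gcongr)).trans this

theorem neumannEnergy_le_dirichletEnergy (N : ℕ) (α : ℝ) (Ω : Set (Fin 2 → ℝ)) :
    neumannEnergy N α Ω ≤ dirichletEnergy N α Ω := by
  refine sInf_le_sInf ?_
  rintro E ⟨Ψ, F, hF, -, hΨ, rfl⟩
  exact ⟨Ψ, F, hF, hΨ, rfl⟩

/-! ### Trial states: norms and expectations -/

/-- The ingredients of a trial state with at most `n` particles in each of the boxes `K b`: one-body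
profiles `f b`, a two-body cutoff `g` between particles of the same box, a bound `w` on the
interaction of such particles, and a majorant `e` of the indicator of `{g < 1}`. -/
structure TrialData (α : ℝ) (n : ℕ) (B : Type) [LinearOrder B] where
  f : B → (Fin 2 → ℝ) → ℝ
  K : B → Set (Fin 2 → ℝ)
  g : (Fin 2 → ℝ) → ℝ
  w : (Fin 2 → ℝ) → ℝ≥0∞
  e : (Fin 2 → ℝ) → ℝ≥0∞
  (A T V₁ V₂ : ℝ≥0∞)
  f_smooth : ∀ b, ContDiff ℝ ((⊤ : ℕ∞) : WithTop ℕ∞) (f b)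
  f_mem : ∀ b p, f b p ∈ Set.Icc (0 : ℝ) 1
  K_compact : ∀ b, IsCompact (K b)
  f_eq_zero : ∀ b, ∀ p ∉ K b, f b p = 0
  sep : ∀ b b', b' < b → ∀ p ∈ K b, ∀ q ∈ K b', ofPlane (p - q) ∈ Complex.slitPlane
  g_smooth : ContDiff ℝ ((⊤ : ℕ∞) : WithTop ℕ∞) g
  g_mem : ∀ z, g z ∈ Set.Icc (0 : ℝ) 1
  g_neg : ∀ z, g (-z) = g z
  g_zero : 0 ∉ tsupport g
  w_meas : Measurable w
  e_meas : Measurable e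
  one_le_e : ∀ z, g z ≠ 1 → 1 ≤ e z
  deriv_le : ∀ b, ∀ p ∈ K b, ∀ q ∈ K b, ∀ a,
    ‖fderiv ℝ g (p - q) (Pi.single a 1)‖ₑ ≤ w (p - q)
  pot_le : ∀ b, ∀ p ∈ K b, ∀ q ∈ K b, ∀ a, ‖α * perpInv (p - q) a * g (p - q)‖ₑ ≤ w (p - q)
  A_ne_zero : A ≠ 0
  A_ne_top : A ≠ ⊤
  mass : ∀ b, 2 * A ≤ ∫⁻ p, ENNReal.ofReal (f b p ^ 2)
  lintegral_e : n * ∫⁻ z, e z ≤ A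
  lintegral_deriv : ∀ b a, ∫⁻ p, ‖fderiv ℝ (f b) p (Pi.single a 1)‖ₑ ^ 2 ≤ A * T
  lintegral_w : ∫⁻ z, w z ≤ A * V₁
  lintegral_w_sq : ∫⁻ z, w z ^ 2 ≤ A * V₂

namespace TrialData

variable {α : ℝ} {n : ℕ} {B : Type} [LinearOrder B] (D : TrialData α n B) {N : ℕ}

/-- The cutoff between the particles `j` and `k`. -/
def pairFactor (c : Fin N → B) (x : Config N) (j k : Fin N) : ℝ :=
  if j ≠ k ∧ c j = c k then D.g (x j - x k) else 1

/-- The modulus of the trial state for the particles in `S`. -/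
def amp (c : Fin N → B) (S : Finset (Fin N)) (x : Config N) : ℝ :=
  (∏ j ∈ S, D.f (c j) (x j)) * ∏ j ∈ S, ∏ k ∈ S, D.pairFactor c x j k

variable {c : Fin N → B} {S : Finset (Fin N)} {j : Fin N}

theorem pairFactor_mem (x : Config N) (j k : Fin N) :
    D.pairFactor c x j k ∈ Set.Icc (0 : ℝ) 1 := by
  unfold pairFactor
  split_ifs
  · exact D.g_mem _
  · simp

theorem pairFactor_self (x : Config N) (j : Fin N) : D.pairFactor c x j j = 1 := by
  simp [pairFactor]

theorem pairFactor_comm (x : Config N) (j k : Fin N) :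
    D.pairFactor c x j k = D.pairFactor c x k j := by
  unfold pairFactor
  rw [← D.g_neg, neg_sub]
  congr 1
  rw [ne_comm, eq_comm (a := c j)]

theorem amp_empty (x : Config N) : D.amp c ∅ x = 1 := by simp [amp]

theorem amp_insert (hj : j ∉ S) (x : Config N) :
    D.amp c (insert j S) x =
      D.f (c j) (x j) * (∏ k ∈ S, D.pairFactor c x j k ^ 2) * D.amp c S x := by
  unfold amp
  simp only [Finset.prod_insert hj, D.pairFactor_self, Finset.prod_mul_distrib,
    fun k => D.pairFactor_comm (c := c) x k j, Finset.prod_pow]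
  ring

theorem amp_nonneg (x : Config N) : 0 ≤ D.amp c S x :=
  mul_nonneg (Finset.prod_nonneg fun _ _ => (D.f_mem _ _).1)
    (Finset.prod_nonneg fun _ _ => Finset.prod_nonneg fun _ _ => (D.pairFactor_mem _ _ _).1)

theorem amp_insert_le (hj : j ∉ S) (x : Config N) : D.amp c (insert j S) x ≤ D.amp c S x := by
  rw [D.amp_insert hj]
  refine mul_le_of_le_one_left (D.amp_nonneg x) ?_
  refine mul_le_one₀ (D.f_mem _ _).2
    (Finset.prod_nonneg fun _ _ => pow_nonneg (D.pairFactor_mem _ _ _).1 _) ?_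
  exact Finset.prod_le_one (fun _ _ => pow_nonneg (D.pairFactor_mem _ _ _).1 _)
    fun _ _ => pow_le_one₀ (D.pairFactor_mem _ _ _).1 (D.pairFactor_mem _ _ _).2

theorem amp_update (hj : j ∉ S) (x : Config N) (y : Fin 2 → ℝ) :
    D.amp c S (Function.update x j y) = D.amp c S x := by
  have h : ∀ k ∈ S, Function.update x j y k = x k := fun k hk =>
    Function.update_of_ne (ne_of_mem_of_not_mem hk hj) _ _
  unfold amp pairFactor
  congr 1
  · exact Finset.prod_congr rfl fun k hk => by rw [h k hk]
  · exact Finset.prod_congr rfl fun k hk => Finset.prod_congr rfl fun l hl => by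
      rw [h k hk, h l hl]

theorem pairFactor_update {k : Fin N} (hk : k ≠ j) (x : Config N) (y : Fin 2 → ℝ) :
    D.pairFactor c (Function.update x j y) j k =
      if c j = c k then D.g (y - x k) else 1 := by
  simp [pairFactor, hk, hk.symm]

theorem contDiff_pairFactor (j k : Fin N) :
    ContDiff ℝ ((⊤ : ℕ∞) : WithTop ℕ∞) fun x => D.pairFactor c x j k := by
  unfold pairFactor
  split_ifs
  · exact D.g_smooth.comp ((contDiff_apply ℝ (Fin 2 → ℝ) j).sub (contDiff_apply ℝ (Fin 2 → ℝ) k))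
  · exact contDiff_const

theorem contDiff_amp : ContDiff ℝ ((⊤ : ℕ∞) : WithTop ℕ∞) (D.amp c S) := by
  refine ContDiff.mul (contDiff_prod fun j _ => ?_)
    (contDiff_prod fun j _ => contDiff_prod fun k _ => D.contDiff_pairFactor j k)
  exact (D.f_smooth _).comp (contDiff_apply ℝ (Fin 2 → ℝ) j)

theorem continuous_amp : Continuous (D.amp c S) := D.contDiff_amp.continuous

/-- Restoring a particle costs at most a factor `A`, whatever the positions of the others. Its
profile has mass at least `2 A`, and the cutoffs against the at most `n` particles of its box
destroy mass at most `n ∫ e ≤ A`. -/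
theorem le_lintegral_amp_sq (hc : (Finset.univ.filter fun k => c k = c j).card ≤ n) (hj : j ∉ S)
    (x : Config N) :
    D.A * ENNReal.ofReal (D.amp c S x ^ 2) ≤
      ∫⁻ y, ENNReal.ofReal (D.amp c (insert j S) (Function.update x j y) ^ 2) := by
  set I := S.filter fun k => c k = c j with hI
  set F : (Fin 2 → ℝ) → ℝ := fun y => D.f (c j) y *
    ∏ k ∈ S, D.pairFactor c (Function.update x j y) j k ^ 2 with hF
  have hFm : Measurable fun y => ENNReal.ofReal (F y ^ 2) := by
    have : Continuous F := by
      refine (D.f_smooth _).continuous.mul (continuous_finsetProd _ fun k _ => ?_)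
      exact ((D.contDiff_pairFactor j k).continuous.comp
        (continuous_const.update j continuous_id)).pow 2
    exact (this.pow 2).measurable.ennreal_ofReal
  have hval : ∀ y, ENNReal.ofReal (D.amp c (insert j S) (Function.update x j y) ^ 2) =
      ENNReal.ofReal (F y ^ 2) * ENNReal.ofReal (D.amp c S x ^ 2) := by
    intro y
    rw [D.amp_insert hj, D.amp_update hj, Function.update_self, mul_pow,
      ENNReal.ofReal_mul (sq_nonneg _)]
  simp only [hval]
  rw [lintegral_mul_const _ hFm]
  refine mul_le_mul' ?_ le_rfl
  have hpt : ∀ y, ENNReal.ofReal (D.f (c j) y ^ 2) ≤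
      ENNReal.ofReal (F y ^ 2) + ∑ k ∈ I, D.e (y - x k) := by
    intro y
    -- Either every cutoff equals one and `F y` is the bare profile, or one term of the sum of `e`
    -- is at least one and so dominates the squared profile.
    by_cases h : ∀ k ∈ I, D.g (y - x k) = 1
    · refine le_add_right (le_of_eq ?_)
      have : F y = D.f (c j) y := by
        simp only [hF]
        rw [Finset.prod_eq_one, mul_one]
        intro k hk
        rw [D.pairFactor_update (ne_of_mem_of_not_mem hk hj)]
        split_ifs with hck
        · rw [h k (by simp [hI, hk, hck]), one_pow]
        · simp
      rw [this]
    · push Not at h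
      obtain ⟨k, hk, hg⟩ := h
      refine le_add_left (le_trans ?_
        ((D.one_le_e _ hg).trans (Finset.single_le_sum (f := fun k => D.e (y - x k)) (fun _ _ => zero_le) hk)))
      rw [ENNReal.ofReal_le_one]
      exact pow_le_one₀ (D.f_mem _ _).1 (D.f_mem _ _).2
  have hsum : ∫⁻ y, ∑ k ∈ I, D.e (y - x k) ≤ D.A := by
    have he : ∀ k, Measurable fun y => D.e (y - x k) := fun k =>
      D.e_meas.comp (measurable_sub_const' _)
    rw [lintegral_finsetSum _ fun k _ => he k]
    simp only [lintegral_sub_right_eq_self D.e, Finset.sum_const, nsmul_eq_mul]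
    refine le_trans (mul_le_mul' ?_ le_rfl) D.lintegral_e
    exact_mod_cast (Finset.card_le_card fun k hk => by simp [hI] at hk; simp [hk.2]).trans hc
  have h2 := (D.mass (c j)).trans (lintegral_mono hpt)
  rw [lintegral_add_left hFm, two_mul] at h2
  exact (ENNReal.add_le_add_iff_right D.A_ne_top).1 (h2.trans (add_le_add le_rfl hsum))

/-- The integral of `F` over the absent particle `j` yields at most `A V`, and the factor `A` is
used up by restoring `j`. Expectations are thereby bounded relative to the norm, which never has to
be computed; `W` is a spectator. -/
theorem lintegral_mul_amp_sq_le (hc : (Finset.univ.filter fun k => c k = c j).card ≤ n)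
    (hj : j ∉ S) {F W : Config N → ℝ≥0∞} (hF : Measurable F) (hW : Measurable W) {V : ℝ≥0∞}
    (hFV : ∀ x, ∫⁻ y, F (Function.update x j y) ≤ D.A * V)
    (hWj : ∀ x y, W (Function.update x j y) = W x) :
    ∫⁻ x, F x * (W x * ENNReal.ofReal (D.amp c S x ^ 2)) ≤
      V * ∫⁻ x, W x * ENNReal.ofReal (D.amp c (insert j S) x ^ 2) := by
  have hm : ∀ S, Measurable fun x => ENNReal.ofReal (D.amp c S x ^ 2) := fun S =>
    (D.continuous_amp.pow 2).measurable.ennreal_ofReal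
  have hWm : ∀ S, Measurable fun x => W x * ENNReal.ofReal (D.amp c S x ^ 2) := fun S =>
    hW.mul (hm S)
  rw [← lintegral_const_mul _ (hWm _)]
  refine lintegral_le_of_lmarginal_le {j} (hF.mul (hWm _)) ((hWm _).const_mul V) fun x => ?_
  rw [lmarginal_singleton, lmarginal_singleton]
  simp only [hWj, D.amp_update hj]
  have hFj : Measurable fun y => F (Function.update x j y) := hF.comp (measurable_update x)
  rw [lintegral_mul_const _ hFj, lintegral_const_mul, lintegral_const_mul]
  · calc _ ≤ D.A * V * (W x * ENNReal.ofReal (D.amp c S x ^ 2)) := mul_le_mul' (hFV x) le_rfl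
      _ = V * (W x * (D.A * ENNReal.ofReal (D.amp c S x ^ 2))) := by ring
      _ ≤ _ := mul_le_mul' le_rfl (mul_le_mul' le_rfl (D.le_lintegral_amp_sq hc hj x))
  · exact (hm _).comp (measurable_update x)
  · exact ((hm _).comp (measurable_update x)).const_mul _

/-- By the same inequality, restoring a particle to a nonzero amplitude cannot give zero. -/
theorem exists_amp_pos (hc : ∀ b, (Finset.univ.filter fun k => c k = b).card ≤ n)
    (S : Finset (Fin N)) : ∃ x, 0 < D.amp c S x := by
  induction S using Finset.induction_on with
  | empty => exact ⟨0, by simp [D.amp_empty]⟩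
  | insert j S hj ih =>
    obtain ⟨x, hx⟩ := ih
    by_contra! h
    have key := D.le_lintegral_amp_sq (hc (c j)) hj x
    have h0 : ∀ y, D.amp c (insert j S) (Function.update x j y) = 0 := fun y =>
      le_antisymm (h _) (D.amp_nonneg _)
    simp only [h0, zero_pow two_ne_zero, ENNReal.ofReal_zero, lintegral_zero, nonpos_iff_eq_zero,
      mul_eq_zero, D.A_ne_zero, false_or, ENNReal.ofReal_eq_zero] at key
    exact absurd key (not_le.2 (by positivity))

variable (c) in
/-- The squared norm of the modulus of the trial state. -/
def normSq : ℝ≥0∞ := ∫⁻ x : Config N, ENNReal.ofReal (D.amp c Finset.univ x ^ 2)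

theorem measurable_w_sub (j k : Fin N) : Measurable fun x : Config N => D.w (x j - x k) :=
  D.w_meas.comp ((measurable_pi_apply j).sub (measurable_pi_apply k))

theorem lintegral_fst_mul_amp_sq_le (hc : ∀ b, (Finset.univ.filter fun k => c k = b).card ≤ n)
    (j : Fin N) {F : Config N → ℝ≥0∞} (hF : Measurable F) {V : ℝ≥0∞}
    (hFV : ∀ x, ∫⁻ y, F (Function.update x j y) ≤ D.A * V) :
    ∫⁻ x, F x * ENNReal.ofReal (D.amp c (Finset.univ.erase j) x ^ 2) ≤ V * D.normSq c := by
  have := D.lintegral_mul_amp_sq_le (hc (c j)) (Finset.notMem_erase j Finset.univ) hF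
    (W := fun _ => 1) measurable_const hFV fun _ _ => rfl
  simpa [Finset.insert_erase (Finset.mem_univ j), normSq] using this

theorem lintegral_deriv_mul_amp_sq_le
    (hc : ∀ b, (Finset.univ.filter fun k => c k = b).card ≤ n) (j : Fin N) (a : Fin 2) :
    ∫⁻ x, ‖fderiv ℝ (D.f (c j)) (x j) (Pi.single a 1)‖ₑ ^ 2 *
      ENNReal.ofReal (D.amp c (Finset.univ.erase j) x ^ 2) ≤ D.T * D.normSq c := by
  refine D.lintegral_fst_mul_amp_sq_le hc j ?_ fun x => ?_
  · have : Continuous fun x : Config N => fderiv ℝ (D.f (c j)) (x j) (Pi.single a 1) :=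
      (((D.f_smooth (c j)).continuous_fderiv (by simp)).comp (continuous_apply j)).clm_apply
        continuous_const
    exact this.measurable.enorm.pow_const 2
  · simpa using D.lintegral_deriv (c j) a

theorem lintegral_w_sq_mul_amp_sq_le
    (hc : ∀ b, (Finset.univ.filter fun k => c k = b).card ≤ n) {j k : Fin N} (hk : k ≠ j) :
    ∫⁻ x, D.w (x j - x k) ^ 2 * ENNReal.ofReal (D.amp c (Finset.univ.erase j) x ^ 2) ≤
      D.V₂ * D.normSq c := by
  refine D.lintegral_fst_mul_amp_sq_le hc j ((D.measurable_w_sub j k).pow_const 2) fun x => ?_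
  simp only [Function.update_self, Function.update_of_ne hk]
  rw [lintegral_sub_right_eq_self (fun z => D.w z ^ 2)]
  exact D.lintegral_w_sq

/-- Particle `k` is dropped from the amplitude as well. Integrating `w (x j - x k)` over `x k`
restores `k`, then integrating `w (x j - x l)` over `x j` restores `j`; each costs `V₁`. -/
theorem lintegral_w_mul_w_mul_amp_sq_le
    (hc : ∀ b, (Finset.univ.filter fun k => c k = b).card ≤ n) {j k l : Fin N} (hk : k ≠ j)
    (hl : l ≠ j) (hkl : k ≠ l) :
    ∫⁻ x, D.w (x j - x k) * D.w (x j - x l) *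
        ENNReal.ofReal (D.amp c (Finset.univ.erase j) x ^ 2) ≤ D.V₁ ^ 2 * D.normSq c := by
  have hkm : k ∈ Finset.univ.erase j := by simp [hk]
  have h1 := D.lintegral_mul_amp_sq_le (hc (c k)) (Finset.notMem_erase k (Finset.univ.erase j))
    (D.measurable_w_sub j k) (D.measurable_w_sub j l) (V := D.V₁) (fun x => by
      simp only [Function.update_self, Function.update_of_ne hk.symm]
      rw [lintegral_sub_left_eq_self]
      exact D.lintegral_w) (fun x y => by
      simp only [Function.update_of_ne hk.symm, Function.update_of_ne hkl.symm])
  have h2 := D.lintegral_fst_mul_amp_sq_le hc j (D.measurable_w_sub j l) (V := D.V₁) (fun x => by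
      simp only [Function.update_self, Function.update_of_ne hl]
      rw [lintegral_sub_right_eq_self D.w]
      exact D.lintegral_w)
  rw [Finset.insert_erase hkm] at h1
  calc _ ≤ ∫⁻ x, D.w (x j - x k) * (D.w (x j - x l) *
        ENNReal.ofReal (D.amp c ((Finset.univ.erase j).erase k) x ^ 2)) := by
        refine lintegral_mono fun x => ?_
        rw [mul_assoc]
        refine mul_le_mul' le_rfl (mul_le_mul' le_rfl (ENNReal.ofReal_le_ofReal ?_))
        refine pow_le_pow_left₀ (D.amp_nonneg x) ?_ 2
        have := D.amp_insert_le (c := c) (Finset.notMem_erase k (Finset.univ.erase j)) x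
        rwa [Finset.insert_erase hkm] at this
    _ ≤ _ := h1
    _ ≤ D.V₁ * (D.V₁ * D.normSq c) := mul_le_mul' le_rfl h2
    _ = _ := by ring

/-- The square is expanded: at most `n` diagonal terms cost `V₂` each, and at most `n²` products
with distinct partners cost `V₁²` each. -/
theorem lintegral_sum_w_sq_mul_amp_sq_le
    (hc : ∀ b, (Finset.univ.filter fun k => c k = b).card ≤ n) (j : Fin N) :
    ∫⁻ x, (∑ k ∈ (Finset.univ.erase j).filter fun k => c j = c k, D.w (x j - x k)) ^ 2 *
        ENNReal.ofReal (D.amp c (Finset.univ.erase j) x ^ 2) ≤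
      (n * D.V₂ + n ^ 2 * D.V₁ ^ 2) * D.normSq c := by
  set I := (Finset.univ.erase j).filter fun k => c j = c k with hI
  have hIj : ∀ k ∈ I, k ≠ j := fun k hk => by simp [hI] at hk; exact hk.1
  have hIn : (I.card : ℝ≥0∞) ≤ n := by
    exact_mod_cast (Finset.card_le_card fun k hk => by simp [hI] at hk; simp [hk.2]).trans
      (hc (c j))
  have hm : Measurable fun x => ENNReal.ofReal (D.amp c (Finset.univ.erase j) x ^ 2) :=
    (D.continuous_amp.pow 2).measurable.ennreal_ofReal
  have hm2 : ∀ k l, Measurable fun x : Config N => D.w (x j - x k) * D.w (x j - x l) *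
      ENNReal.ofReal (D.amp c (Finset.univ.erase j) x ^ 2) := fun k l =>
    ((D.measurable_w_sub j k).mul (D.measurable_w_sub j l)).mul hm
  have hm1 : ∀ k, Measurable fun x : Config N => ∑ l ∈ I, D.w (x j - x l) * D.w (x j - x k) *
      ENNReal.ofReal (D.amp c (Finset.univ.erase j) x ^ 2) := fun k =>
    Finset.measurable_fun_sum _ fun l _ => hm2 l k
  simp only [sq (∑ k ∈ I, _), Finset.sum_mul, Finset.mul_sum]
  rw [lintegral_finsetSum _ fun k _ => hm1 k]
  calc _ ≤ ∑ k ∈ I, ∑ l ∈ I, ((if k = l then D.V₂ else 0) + D.V₁ ^ 2) * D.normSq c := by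
        refine Finset.sum_le_sum fun k hk => ?_
        rw [lintegral_finsetSum _ fun l _ => hm2 l k]
        refine Finset.sum_le_sum fun l hl => ?_
        split_ifs with hkl
        · subst hkl
          simp only [← sq]
          exact (D.lintegral_w_sq_mul_amp_sq_le hc (hIj k hk)).trans
            (mul_le_mul' le_self_add le_rfl)
        · rw [zero_add]
          exact D.lintegral_w_mul_w_mul_amp_sq_le hc (hIj l hl) (hIj k hk) (Ne.symm hkl)
    _ = (I.card * D.V₂ + I.card ^ 2 * D.V₁ ^ 2) * D.normSq c := by
        simp only [← Finset.sum_mul, Finset.sum_add_distrib, Finset.sum_const, nsmul_eq_mul]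
        congr 2
        · rw [Finset.sum_congr rfl fun k hk => Finset.sum_ite_eq I k fun _ => D.V₂]
          simp +contextual
        · ring
    _ ≤ _ := by gcongr

end TrialData

/-! ### The phase that gauges away other boxes -/

theorem contDiff_ofPlane {r : WithTop ℕ∞} : ContDiff ℝ r ofPlane := by
  have : ofPlane = fun p => Complex.equivRealProdCLM.symm (p 0, p 1) := by
    funext p; apply Complex.ext <;> simp [ofPlane]
  rw [this]
  exact Complex.equivRealProdCLM.symm.contDiff.comp
    ((contDiff_apply ℝ ℝ 0).prodMk (contDiff_apply ℝ ℝ 1))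

theorem contDiffAt_arg {r : WithTop ℕ∞} {z : ℂ} (hz : z ∈ Complex.slitPlane) :
    ContDiffAt ℝ r Complex.arg z := by
  have h : ContDiffAt ℝ r Complex.log z := (Complex.contDiffAt_log hz).restrict_scalars ℝ
  have h2 := Complex.imCLM.contDiff.contDiffAt.comp z h
  exact h2.congr_of_eventuallyEq (Eventually.of_forall fun w => by simp [Complex.log_im])

theorem perpInv_neg (z : Fin 2 → ℝ) (a : Fin 2) : perpInv (-z) a = -perpInv z a := by
  fin_cases a <;> simp [perpInv] <;> ring

theorem hasDerivAt_arg_ofPlane {z : Fin 2 → ℝ} (hz : ofPlane z ∈ Complex.slitPlane) (s : ℝ)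
    (a : Fin 2) :
    HasDerivAt (fun t : ℝ => Complex.arg (ofPlane (z + (t * s) • Pi.single a 1)))
      (s * perpInv z a) 0 := by
  have h1 : HasDerivAt (fun t : ℝ => ofPlane z + ((t * s : ℝ) : ℂ) * unitDir a)
      ((s : ℂ) * unitDir a) 0 := by
    have : HasDerivAt (fun t : ℝ => ((t * s : ℝ) : ℂ)) (s : ℂ) 0 := by
      simpa using ((hasDerivAt_id (0 : ℝ)).mul_const s).ofReal_comp
    exact (this.mul_const _).const_add _
  have h2 : HasDerivAt (fun t : ℝ => Complex.log (ofPlane z + ((t * s : ℝ) : ℂ) * unitDir a))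
      ((s : ℂ) * unitDir a / ofPlane z) 0 := by
    have h1' : HasDerivAt (fun t : ℝ => ofPlane z + ((t * s : ℝ) : ℂ) * unitDir a)
      ((s : ℂ) * unitDir a) 0 := h1
    have := h1'.clog_real (by simpa using hz)
    simpa using this
  have h3 := Complex.imCLM.hasFDerivAt.comp_hasDerivAt (0 : ℝ) h2
  have e1 : (fun t : ℝ => Complex.arg (ofPlane (z + (t * s) • Pi.single a 1))) =
      Complex.imCLM ∘ fun t : ℝ => Complex.log (ofPlane z + ((t * s : ℝ) : ℂ) * unitDir a) := by
    funext t
    simp only [Function.comp, Complex.imCLM_apply, Complex.log_im]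
    congr 1
    rw [← ofPlane_toPlane (ofPlane z + _), map_add, toPlane_ofPlane]
    congr 2
    rw [← toPlane_unitDir, ← Complex.real_smul, map_smul]
  have e2 : s * perpInv z a = Complex.imCLM ((s : ℂ) * unitDir a / ofPlane z) := by
    rw [Complex.imCLM_apply, mul_div_assoc, Complex.im_ofReal_mul, ← perpInv_toPlane,
      toPlane_ofPlane]
  rw [e1, e2]
  exact h3

/-- The phase `∑ arg (x_j - x_k)` over the pairs of particles in different boxes. -/
def boxPhase {N : ℕ} {B : Type} [LinearOrder B] (c : Fin N → B) (x : Config N) : ℝ :=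
  ∑ j, ∑ k, if c k < c j then Complex.arg (ofPlane (x j - x k)) else 0

theorem update_add_smul {N : ℕ} (x : Config N) (j : Fin N) (v : Fin 2 → ℝ) (t : ℝ) (k : Fin N) :
    Function.update x j (x j + t • v) k = x k + (t * if k = j then 1 else 0) • v := by
  rcases eq_or_ne k j with rfl | h
  · simp
  · simp [h]

theorem update_add_smul_eq {N : ℕ} (x : Config N) (j : Fin N) (v : Fin 2 → ℝ) (t : ℝ) :
    Function.update x j (x j + t • v) = x + t • (Pi.single j v : Config N) := by
  funext k
  rw [update_add_smul]
  rcases eq_or_ne k j with rfl | h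
  · simp
  · simp [h]

theorem hasDerivAt_update_add_smul {N : ℕ} (x : Config N) (j : Fin N) (v : Fin 2 → ℝ) :
    HasDerivAt (fun t : ℝ => Function.update x j (x j + t • v)) (Pi.single j v) 0 := by
  simp only [update_add_smul_eq]
  simpa using ((hasDerivAt_id (0 : ℝ)).smul_const (Pi.single j v : Config N)).const_add x

theorem fderiv_single_eq {N : ℕ} {φ : Config N → ℂ} {x : Config N} (hφ : DifferentiableAt ℝ φ x)
    (j : Fin N) (v : Fin 2 → ℝ) {d : ℂ}
    (hd : HasDerivAt (fun t : ℝ => φ (Function.update x j (x j + t • v))) d 0) :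
    fderiv ℝ φ x (Pi.single j v) = d := by
  have h0 : Function.update x j (x j + (0 : ℝ) • v) = x := by simp
  have h1 : HasFDerivAt φ (fderiv ℝ φ x) (Function.update x j (x j + (0 : ℝ) • v)) := by
    rw [h0]; exact hφ.hasFDerivAt
  exact (h1.comp_hasDerivAt (0 : ℝ) (hasDerivAt_update_add_smul x j v)).unique hd

/-- Particle `j` enters the angles with a plus sign towards lower boxes and with a minus sign
towards higher ones. Since `perpInv` is odd, either case contributes `perpInv (x j - x k)`, which is
the full potential created by the other boxes. -/
theorem hasDerivAt_boxPhase {N : ℕ} {B : Type} [LinearOrder B] {c : Fin N → B} {x : Config N}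
    (hx : ∀ j k, c k < c j → ofPlane (x j - x k) ∈ Complex.slitPlane) (j : Fin N) (a : Fin 2) :
    HasDerivAt (fun t : ℝ => boxPhase c (Function.update x j (x j + t • Pi.single a 1)))
      (∑ k, if c j = c k then 0 else perpInv (x j - x k) a) 0 := by
  have h : HasDerivAt (fun t : ℝ => boxPhase c (Function.update x j (x j + t • Pi.single a 1)))
      (∑ l, ∑ k, if c k < c l then
        ((if l = j then 1 else 0) - (if k = j then 1 else 0)) * perpInv (x l - x k) a else 0) 0 := by
    unfold boxPhase
    refine HasDerivAt.fun_sum fun l _ => HasDerivAt.fun_sum fun k _ => ?_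
    by_cases hlk : c k < c l
    · have := hasDerivAt_arg_ofPlane (hx l k hlk)
        ((if l = j then 1 else 0) - (if k = j then 1 else 0)) a
      simp only [hlk, if_true, update_add_smul]
      refine this.congr_of_eventuallyEq (Eventually.of_forall fun t => ?_)
      dsimp only
      congr 2
      module
    · simp only [hlk, if_false]
      exact hasDerivAt_const _ _
  convert h using 1
  have e1 : ∀ l k, (if c k < c l then
        ((if l = j then 1 else 0) - (if k = j then 1 else 0)) * perpInv (x l - x k) a else 0) =
      (if l = j then (if c k < c j then perpInv (x j - x k) a else 0) else 0) +
      (if k = j then (if c j < c l then perpInv (x j - x l) a else 0) else 0) := by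
    intro l k
    by_cases hl : l = j <;> by_cases hk : k = j
    · subst hl; subst hk; simp
    · subst hl; simp [hk]
    · subst hk
      have := perpInv_neg (x k - x l) a
      rw [neg_sub] at this
      simp [hl, this]
    · simp [hl, hk]
  simp only [e1, Finset.sum_add_distrib, Finset.sum_ite_eq', Finset.mem_univ, if_true]
  rw [Finset.sum_comm]
  simp only [Finset.sum_ite_eq', Finset.mem_univ, if_true]
  rw [← Finset.sum_add_distrib]
  refine Finset.sum_congr rfl fun k _ => ?_
  rcases lt_trichotomy (c k) (c j) with h | h | h
  · simp [h, h.ne', h.not_gt]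
  · simp [h]
  · simp [h, h.ne, h.not_gt]

theorem exists_hasDerivAt_prod {ι : Type*} [DecidableEq ι] (s : Finset ι) {q : ι → ℝ → ℝ} {q' : ι → ℝ}
    (hq : ∀ k ∈ s, HasDerivAt (q k) (q' k) 0) (h1 : ∀ k ∈ s, ‖q k 0‖ₑ ≤ 1) :
    ∃ d, HasDerivAt (fun t => ∏ k ∈ s, q k t) d 0 ∧ ‖d‖ₑ ≤ ∑ k ∈ s, ‖q' k‖ₑ := by
  refine ⟨_, HasDerivAt.fun_finsetProd hq, (enorm_sum_le _ _).trans
    (Finset.sum_le_sum fun k hk => ?_)⟩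
  rw [smul_eq_mul, enorm_mul]
  refine mul_le_of_le_one_left zero_le ?_
  have : ∀ u : Finset ι, ‖∏ i ∈ u, q i 0‖ₑ = ∏ i ∈ u, ‖q i 0‖ₑ := fun u => by
    induction u using Finset.induction_on with
    | empty => simp
    | insert i u hi ih => rw [Finset.prod_insert hi, Finset.prod_insert hi, enorm_mul, ih]
  rw [this]
  exact Finset.prod_le_one' fun i hi => h1 i (Finset.mem_of_mem_erase hi)

/-! ### Energy for one distribution of the particles -/

namespace TrialData

variable {α : ℝ} {n : ℕ} {B : Type} [LinearOrder B] (D : TrialData α n B) {N : ℕ}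

/-- The trial state with the particle `j` in the box `c j`. -/
def psi (c : Fin N → B) (x : Config N) : ℂ :=
  (D.amp c Finset.univ x : ℂ) * Complex.exp (-Complex.I * (α * boxPhase c x : ℝ))

/-- The configurations with the particle `j` in the box `c j`. -/
def region (c : Fin N → B) : Set (Config N) := Set.univ.pi fun j => D.K (c j)

variable {c : Fin N → B} {j : Fin N} {x : Config N}

theorem isCompact_region : IsCompact (D.region c) := isCompact_univ_pi fun _ => D.K_compact _

theorem slitPlane_of_mem_region (hx : x ∈ D.region c) (j k : Fin N) (h : c k < c j) :
    ofPlane (x j - x k) ∈ Complex.slitPlane :=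
  D.sep _ _ h _ (hx j trivial) _ (hx k trivial)

/-- A particle in two different boxes would put the difference `0` in the slit plane. Hence the
states of different distributions have disjoint supports. -/
theorem eq_of_mem_region {c' : Fin N → B} (h : x ∈ D.region c) (h' : x ∈ D.region c') : c = c' := by
  funext j
  have h0 : ofPlane (x j - x j) ∉ Complex.slitPlane := by
    have : ofPlane (x j - x j) = 0 := by simp [ofPlane]; rfl
    rw [this]; simp
  rcases lt_trichotomy (c j) (c' j) with hlt | heq | hlt
  · exact absurd (D.sep _ _ hlt _ (h' j trivial) _ (h j trivial)) h0
  · exact heq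
  · exact absurd (D.sep _ _ hlt _ (h j trivial) _ (h' j trivial)) h0

theorem enorm_psi_sq : ‖D.psi c x‖ₑ ^ 2 = ENNReal.ofReal (D.amp c Finset.univ x ^ 2) := by
  rw [enorm_sq_eq_ofReal, psi, norm_mul, Complex.norm_real, neg_mul, ← mul_neg, mul_comm Complex.I,
    ← Complex.ofReal_neg, Complex.norm_exp_ofReal_mul_I, mul_one, Real.norm_eq_abs, sq_abs]

theorem amp_eq_zero (hx : x ∉ D.region c) : D.amp c Finset.univ x = 0 := by
  simp only [region, Set.mem_pi, Set.mem_univ, true_imp_iff, not_forall] at hx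
  obtain ⟨j, hj⟩ := hx
  rw [amp, Finset.prod_eq_zero (Finset.mem_univ j) (D.f_eq_zero _ _ hj), zero_mul]

theorem psi_eq_zero (hx : x ∉ D.region c) : D.psi c x = 0 := by
  simp [psi, D.amp_eq_zero hx]

theorem tsupport_psi_subset : tsupport (D.psi c) ⊆ D.region c :=
  closure_minimal (fun x hx => by by_contra h; exact hx (D.psi_eq_zero h))
    D.isCompact_region.isClosed

theorem contDiff_psi : ContDiff ℝ ((⊤ : ℕ∞) : WithTop ℕ∞) (D.psi c) := by
  refine contDiff_iff_contDiffAt.2 fun x => ?_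
  by_cases hx : x ∈ tsupport (D.psi c)
  swap
  · exact contDiffAt_const.congr_of_eventuallyEq (notMem_tsupport_iff_eventuallyEq.1 hx)
  have hx' := D.tsupport_psi_subset hx
  have hphase : ContDiffAt ℝ ((⊤ : ℕ∞) : WithTop ℕ∞) (boxPhase c) x := by
    refine ContDiffAt.sum fun j _ => ContDiffAt.sum fun k _ => ?_
    by_cases h : c k < c j
    · simp only [h, if_true]
      refine (contDiffAt_arg (D.slitPlane_of_mem_region hx' j k h)).comp x
        (f := fun x : Config N => ofPlane (x j - x k)) ?_
      exact (contDiff_ofPlane.comp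
        ((contDiff_apply ℝ (Fin 2 → ℝ) j).sub (contDiff_apply ℝ (Fin 2 → ℝ) k))).contDiffAt
    · simp only [h, if_false]; exact contDiffAt_const
  refine ContDiffAt.mul ?_ (ContDiffAt.cexp (contDiffAt_const.mul ?_))
  · exact Complex.ofRealCLM.contDiff.contDiffAt.comp x D.contDiff_amp.contDiffAt
  · exact Complex.ofRealCLM.contDiff.contDiffAt.comp x (contDiffAt_const.mul hphase)

theorem covDeriv_psi_eq_zero (a : Fin 2) (hx : x ∉ D.region c) : covDeriv α j a (D.psi c) x = 0 := by
  have : fderiv ℝ (D.psi c) x = 0 := by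
    have h : D.psi c =ᶠ[𝓝 x] 0 := notMem_tsupport_iff_eventuallyEq.1 fun h => hx (D.tsupport_psi_subset h)
    rw [h.fderiv_eq]; simp
  simp [covDeriv, this, D.psi_eq_zero hx]

theorem exists_hasDerivAt_factor (hx : x ∈ D.region c) (j : Fin N) (a : Fin 2) :
    ∃ d : ℝ, HasDerivAt (fun t : ℝ => D.f (c j) (x j + t • Pi.single a 1) *
        ∏ k ∈ Finset.univ.erase j,
          D.pairFactor c (Function.update x j (x j + t • Pi.single a 1)) j k ^ 2) d 0 ∧
      ‖d‖ₑ ≤ ‖fderiv ℝ (D.f (c j)) (x j) (Pi.single a 1)‖ₑ +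
        2 * ∑ k ∈ (Finset.univ.erase j).filter fun k => c j = c k, D.w (x j - x k) := by
  have hline : ∀ p : Fin 2 → ℝ, HasDerivAt (fun t : ℝ => p + t • (Pi.single a 1 : Fin 2 → ℝ))
      (Pi.single a 1) 0 := fun p => by
    simpa using ((hasDerivAt_id (0 : ℝ)).smul_const (Pi.single a 1 : Fin 2 → ℝ)).const_add p
  have hcomp : ∀ {u : (Fin 2 → ℝ) → ℝ}, ContDiff ℝ ((⊤ : ℕ∞) : WithTop ℕ∞) u → ∀ p,
      HasDerivAt (fun t : ℝ => u (p + t • (Pi.single a 1 : Fin 2 → ℝ)))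
        (fderiv ℝ u p (Pi.single a 1)) 0 := by
    intro u hu p
    have h1 : HasFDerivAt u (fderiv ℝ u p) (p + (0 : ℝ) • (Pi.single a 1 : Fin 2 → ℝ)) := by
      rw [zero_smul, add_zero]; exact (hu.differentiable (by simp) p).hasFDerivAt
    exact h1.comp_hasDerivAt (0 : ℝ) (hline p)
  have hpf1 : ∀ k, ‖D.pairFactor c x j k‖ₑ ≤ 1 := fun k => by
    rw [Real.enorm_eq_ofReal (D.pairFactor_mem _ _ _).1, ENNReal.ofReal_le_one]
    exact (D.pairFactor_mem _ _ _).2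
  have hf1 : ‖D.f (c j) (x j)‖ₑ ≤ 1 := by
    rw [Real.enorm_eq_ofReal (D.f_mem _ _).1, ENNReal.ofReal_le_one]
    exact (D.f_mem _ _).2
  have hupd : Function.update x j (x j + (0 : ℝ) • (Pi.single a 1 : Fin 2 → ℝ)) = x := by simp
  obtain ⟨d, hd, hdle⟩ := exists_hasDerivAt_prod (Finset.univ.erase j)
    (q := fun k t => D.pairFactor c (Function.update x j (x j + t • Pi.single a 1)) j k ^ 2)
    (q' := fun k => if c j = c k then
      2 * D.g (x j - x k) * fderiv ℝ D.g (x j - x k) (Pi.single a 1) else 0)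
    (fun k hk => by
      simp only [D.pairFactor_update (Finset.ne_of_mem_erase hk)]
      by_cases h : c j = c k
      · simp only [h, if_true]
        have := (hcomp D.g_smooth (x j - x k)).fun_pow 2
        simp only [add_sub_right_comm]
        simpa using this
      · simp only [h, if_false]; exact hasDerivAt_const _ _)
    (fun k _ => by
      simp only [hupd, enorm_pow]
      exact pow_le_one₀ zero_le (hpf1 k))
  refine ⟨_, (hcomp (D.f_smooth (c j)) (x j)).mul hd, ?_⟩
  refine (enorm_add_le _ _).trans (add_le_add ?_ ?_)
  · rw [enorm_mul]
    refine mul_le_of_le_one_right zero_le ?_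
    simp only [hupd]
    rw [Real.enorm_eq_ofReal (Finset.prod_nonneg fun _ _ => sq_nonneg _), ENNReal.ofReal_le_one]
    exact Finset.prod_le_one (fun _ _ => sq_nonneg _)
      fun k _ => pow_le_one₀ (D.pairFactor_mem _ _ _).1 (D.pairFactor_mem _ _ _).2
  · rw [enorm_mul, zero_smul, add_zero]
    refine (mul_le_of_le_one_left zero_le hf1).trans (hdle.trans ?_)
    rw [Finset.mul_sum, Finset.sum_filter]
    refine Finset.sum_le_sum fun k _ => ?_
    split_ifs with h
    · rw [enorm_mul, enorm_mul, mul_assoc]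
      refine mul_le_mul' (by simp [Real.enorm_eq_ofReal]) ?_
      refine (mul_le_of_le_one_left zero_le ?_).trans
        (D.deriv_le (c j) _ (hx j trivial) _ (h ▸ hx k trivial) a)
      rw [Real.enorm_eq_ofReal (D.g_mem _).1, ENNReal.ofReal_le_one]
      exact (D.g_mem _).2
    · simp

/-- The phase cancels the potential of all particles in other boxes. For each partner in the same
box the squared cutoff contributes `2 w` through its derivative, and the remaining potential
contributes one more `w`. The amplitude of the particles other than `j` stays as a common factor. -/
theorem enorm_covDeriv_psi_le (hx : x ∈ D.region c) (j : Fin N) (a : Fin 2) :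
    ‖covDeriv α j a (D.psi c) x‖ₑ ≤ ‖D.amp c (Finset.univ.erase j) x‖ₑ *
      (‖fderiv ℝ (D.f (c j)) (x j) (Pi.single a 1)‖ₑ +
        3 * ∑ k ∈ (Finset.univ.erase j).filter fun k => c j = c k, D.w (x j - x k)) := by
  obtain ⟨d, hd, hdle⟩ := D.exists_hasDerivAt_factor hx j a
  set r : ℝ → ℝ := fun t => D.f (c j) (x j + t • Pi.single a 1) *
        ∏ k ∈ Finset.univ.erase j,
          D.pairFactor c (Function.update x j (x j + t • Pi.single a 1)) j k ^ 2 with hr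
  set v := D.amp c (Finset.univ.erase j) x with hv
  set I := (Finset.univ.erase j).filter fun k => c j = c k with hI
  have hamp : ∀ t : ℝ, D.amp c Finset.univ (Function.update x j (x j + t • Pi.single a 1)) =
      r t * v := by
    intro t
    have := D.amp_insert (c := c) (Finset.notMem_erase j Finset.univ)
      (Function.update x j (x j + t • Pi.single a 1))
    rw [Finset.insert_erase (Finset.mem_univ j), D.amp_update (Finset.notMem_erase j _),
      Function.update_self] at this
    exact this
  have hupd : Function.update x j (x j + (0 : ℝ) • (Pi.single a 1 : Fin 2 → ℝ)) = x := by simp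
  have hΘ := hasDerivAt_boxPhase (D.slitPlane_of_mem_region hx) j a
  set θ := ∑ k, if c j = c k then 0 else perpInv (x j - x k) a with hθ
  have hpot : vecPot j x a - θ = ∑ k ∈ I, perpInv (x j - x k) a := by
    rw [vecPot, Finset.sum_apply, hθ, ← Finset.add_sum_erase _ _ (Finset.mem_univ j), if_pos rfl,
      zero_add, ← Finset.sum_sub_distrib, hI, Finset.sum_filter]
    refine Finset.sum_congr rfl fun k _ => ?_
    split_ifs <;> simp
  set E : ℂ := Complex.exp (-Complex.I * (α * boxPhase c x : ℝ)) with hE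
  have hEn : ‖E‖ₑ = 1 := by
    rw [← ofReal_norm, hE, neg_mul, ← mul_neg, mul_comm Complex.I, ← Complex.ofReal_neg,
      Complex.norm_exp_ofReal_mul_I, ENNReal.ofReal_one]
  have hder : HasDerivAt (fun t : ℝ => D.psi c (Function.update x j (x j + t • Pi.single a 1)))
      ((d * v : ℝ) * E + (r 0 * v : ℝ) * (E * (-Complex.I * (α * θ : ℝ)))) 0 := by
    have h1 := ((hΘ.const_mul α).ofReal_comp.const_mul (-Complex.I)).cexp
    have h2 := (hd.mul_const v).ofReal_comp
    have h3 := h2.mul h1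
    simp only [hupd] at h3
    refine h3.congr_of_eventuallyEq (Eventually.of_forall fun t => ?_)
    simp only [psi, hamp, Pi.mul_apply]
  have hfd := fderiv_single_eq ((D.contDiff_psi (c := c)).differentiable (by simp) x) j _ hder
  have hψ : D.psi c x = (r 0 * v : ℝ) * E := by
    rw [psi, ← hamp 0, hupd]
  have hval : covDeriv α j a (D.psi c) x =
      (v : ℂ) * E * (-Complex.I * (d : ℂ) + ((∑ k ∈ I, α * perpInv (x j - x k) a * r 0 : ℝ) : ℂ)) := by
    have hs : ∑ k ∈ I, α * perpInv (x j - x k) a * r 0 = α * (vecPot j x a - θ) * r 0 := by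
      rw [hpot, Finset.mul_sum, Finset.sum_mul]
    rw [covDeriv, hfd, hψ, hs]
    push_cast
    linear_combination (α * θ * r 0 * v * E : ℂ) * Complex.I_mul_I
  rw [hval, enorm_mul, enorm_mul, hEn, mul_one]
  refine mul_le_mul' (le_of_eq ?_) ?_
  · rw [← ofReal_norm, Complex.norm_real, ofReal_norm]
  refine (enorm_add_le _ _).trans ?_
  have h1 : ‖-Complex.I * (d : ℂ)‖ₑ = ‖d‖ₑ := by
    rw [← ofReal_norm, norm_mul, norm_neg, Complex.norm_I, one_mul, Complex.norm_real,
      ofReal_norm]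
  have h2 : ‖((∑ k ∈ I, α * perpInv (x j - x k) a * r 0 : ℝ) : ℂ)‖ₑ ≤
      ∑ k ∈ I, D.w (x j - x k) := by
    rw [← ofReal_norm, Complex.norm_real, ofReal_norm]
    refine (enorm_sum_le _ _).trans (Finset.sum_le_sum fun k hk => ?_)
    have hkj : k ≠ j ∧ c j = c k := by simpa [hI] using hk
    refine le_trans ?_ (D.pot_le (c j) _ (hx j trivial) _ (hkj.2 ▸ hx k trivial) a)
    rw [enorm_mul, enorm_mul _ (D.g _)]
    refine mul_le_mul' le_rfl ?_
    have hpm : ∀ l, 0 ≤ D.pairFactor c x j l ^ 2 ∧ D.pairFactor c x j l ^ 2 ≤ 1 := fun l =>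
      ⟨sq_nonneg _, pow_le_one₀ (D.pairFactor_mem _ _ _).1 (D.pairFactor_mem _ _ _).2⟩
    have hr0 : r 0 = D.f (c j) (x j) * ∏ l ∈ Finset.univ.erase j, D.pairFactor c x j l ^ 2 := by
      simp only [hr, zero_smul, add_zero, Function.update_eq_self]
    -- Only the factor for `k` is needed to tame the singularity at `x j = x k`; all others are at
    -- most one, and `g² ≤ g`.
    have hprod : ∏ l ∈ Finset.univ.erase j, D.pairFactor c x j l ^ 2 ≤ D.g (x j - x k) := by
      rw [← Finset.mul_prod_erase _ _ (Finset.mem_erase.2 ⟨hkj.1, Finset.mem_univ k⟩)]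
      have hg : D.pairFactor c x j k = D.g (x j - x k) := by simp [pairFactor, hkj.1.symm, hkj.2]
      rw [hg]
      refine (mul_le_of_le_one_right (sq_nonneg _)
        (Finset.prod_le_one (fun l _ => (hpm l).1) fun l _ => (hpm l).2)).trans ?_
      exact pow_le_of_le_one (D.g_mem _).1 (D.g_mem _).2 two_ne_zero
    have hprod0 := Finset.prod_nonneg (s := Finset.univ.erase j) fun l _ => (hpm l).1
    rw [hr0, Real.enorm_eq_ofReal (mul_nonneg (D.f_mem _ _).1 hprod0),
      Real.enorm_eq_ofReal (D.g_mem _).1]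
    exact ENNReal.ofReal_le_ofReal
      ((mul_le_of_le_one_left hprod0 (D.f_mem _ _).2).trans hprod)
  calc _ ≤ (‖fderiv ℝ (D.f (c j)) (x j) (Pi.single a 1)‖ₑ + 2 * ∑ k ∈ I, D.w (x j - x k)) +
        ∑ k ∈ I, D.w (x j - x k) := add_le_add (h1.le.trans hdle) h2
    _ = _ := by ring

theorem lintegral_covDeriv_psi_le (hc : ∀ b, (Finset.univ.filter fun k => c k = b).card ≤ n)
    (j : Fin N) (a : Fin 2) :
    ∫⁻ x, ‖covDeriv α j a (D.psi c) x‖ₑ ^ 2 ≤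
      (4 * D.T + 36 * (n * D.V₂ + n ^ 2 * D.V₁ ^ 2)) * D.normSq c := by
  have hsq : ∀ u v : ℝ≥0∞, (u + 3 * v) ^ 2 ≤ 4 * u ^ 2 + 36 * v ^ 2 := by
    intro u v
    rcases le_total u (3 * v) with h | h
    · calc _ ≤ (3 * v + 3 * v) ^ 2 := by gcongr
        _ = 36 * v ^ 2 := by ring
        _ ≤ _ := le_add_self
    · calc _ ≤ (u + u) ^ 2 := by gcongr
        _ = 4 * u ^ 2 := by ring
        _ ≤ _ := le_self_add
  set P : Config N → ℝ≥0∞ := fun x => ENNReal.ofReal (D.amp c (Finset.univ.erase j) x ^ 2) with hP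
  set G : Config N → ℝ≥0∞ := fun x => ‖fderiv ℝ (D.f (c j)) (x j) (Pi.single a 1)‖ₑ ^ 2 with hG
  set W : Config N → ℝ≥0∞ := fun x =>
    (∑ k ∈ (Finset.univ.erase j).filter fun k => c j = c k, D.w (x j - x k)) ^ 2 with hW
  have hPm : Measurable P := (D.continuous_amp.pow 2).measurable.ennreal_ofReal
  have hWm : Measurable W :=
    (Finset.measurable_fun_sum _ fun k _ => D.measurable_w_sub j k).pow_const 2
  have hpt : ∀ x, ‖covDeriv α j a (D.psi c) x‖ₑ ^ 2 ≤ 4 * (G x * P x) + 36 * (W x * P x) := by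
    intro x
    by_cases hx : x ∈ D.region c
    · calc _ ≤ _ := pow_le_pow_left₀ zero_le (D.enorm_covDeriv_psi_le hx j a) 2
        _ ≤ P x * (4 * G x + 36 * W x) := by
          rw [mul_pow]
          refine mul_le_mul' (le_of_eq ?_) (hsq _ _)
          rw [hP, ← enorm_pow, Real.enorm_eq_ofReal (sq_nonneg _)]
        _ = _ := by ring
    · simp [D.covDeriv_psi_eq_zero a hx]
  have hWP : Measurable fun x => 36 * (W x * P x) := (hWm.mul hPm).const_mul 36
  refine (lintegral_mono hpt).trans ?_
  rw [lintegral_add_right _ hWP, lintegral_const_mul' _ _ (by simp),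
    lintegral_const_mul' _ _ (by simp), add_mul, mul_assoc, mul_assoc]
  exact add_le_add (mul_le_mul' le_rfl (D.lintegral_deriv_mul_amp_sq_le hc j a))
    (mul_le_mul' le_rfl (D.lintegral_sum_w_sq_mul_amp_sq_le hc j))

end TrialData

/-! ### Symmetrization and the Dirichlet bound -/

theorem enorm_sum_sq_eq {ι : Type*} (s : Finset ι) {z : ι → ℂ}
    (hz : ∀ c ∈ s, ∀ c' ∈ s, z c ≠ 0 → z c' ≠ 0 → c = c') :
    ‖∑ c ∈ s, z c‖ₑ ^ 2 = ∑ c ∈ s, ‖z c‖ₑ ^ 2 := by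
  by_cases h : ∃ c ∈ s, z c ≠ 0
  · obtain ⟨c, hc, hzc⟩ := h
    have h0 : ∀ c' ∈ s, c' ≠ c → z c' = 0 := fun c' hc' hne => by
      by_contra h; exact hne (hz c' hc' c hc h hzc)
    rw [Finset.sum_eq_single_of_mem c hc h0,
      Finset.sum_eq_single_of_mem c hc fun c' hc' hne => by simp [h0 c' hc' hne]]
  · push Not at h
    rw [Finset.sum_eq_zero h, Finset.sum_eq_zero fun c hc => by simp [h c hc]]
    simp

theorem covDeriv_sum {N : ℕ} {ι : Type*} (s : Finset ι) (α : ℝ) {φ : ι → Config N → ℂ}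
    (hφ : ∀ c, Differentiable ℝ (φ c)) (j : Fin N) (a : Fin 2) (x : Config N) :
    covDeriv α j a (fun x => ∑ c ∈ s, φ c x) x = ∑ c ∈ s, covDeriv α j a (φ c) x := by
  simp only [covDeriv]
  rw [fderiv_fun_sum fun c _ => hφ c x]
  simp only [sum_apply, Finset.mul_sum, Finset.sum_add_distrib]

theorem covDeriv_const_mul {N : ℕ} (α : ℝ) {φ : Config N → ℂ} (hφ : Differentiable ℝ φ) (z : ℂ)
    (j : Fin N) (a : Fin 2) (x : Config N) :
    covDeriv α j a (fun x => z * φ x) x = z * covDeriv α j a φ x := by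
  simp only [covDeriv]
  rw [fderiv_const_mul (hφ x)]
  simp only [smul_apply, smul_eq_mul]
  ring

theorem IsTest.const_mul {N : ℕ} {φ : Config N → ℂ} (hφ : IsTest φ) (z : ℂ) :
    IsTest fun x => z * φ x where
  smooth := contDiff_const.mul hφ.smooth
  compact := hφ.compact.mul_left
  off_diagonals := hφ.off_diagonals.mono_left
    (closure_mono (Function.support_mul_subset_right (fun _ => z) φ))
  symm σ x := by rw [hφ.symm]

theorem memLp_two_of_lintegral_ne_top {X : Type*} [MeasurableSpace X] {μ : Measure X} {f : X → ℂ}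
    (hf : AEStronglyMeasurable f μ) (h : ∫⁻ x, ‖f x‖ₑ ^ 2 ∂μ ≠ ⊤) : MemLp f 2 μ := by
  rw [lintegral_enorm_sq_eq] at h
  exact ⟨hf, lt_top_iff_ne_top.2 fun h' => h (by simp [h'])⟩

theorem IsTest.isCovGrad {N : ℕ} {α : ℝ} {φ : Config N → ℂ} (hφ : IsTest φ)
    (h : ∀ j a, ∫⁻ x, ‖covDeriv α j a φ x‖ₑ ^ 2 ≠ ⊤) :
    IsCovGrad α φ fun j a => covDeriv α j a φ where
  memLp := hφ.smooth.continuous.memLp_of_hasCompactSupport hφ.compact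
  symm σ := Eventually.of_forall fun x => hφ.symm σ x
  memLp_grad j a := memLp_two_of_lintegral_ne_top
    (measurable_covDeriv hφ.contDiff_one j a).aestronglyMeasurable (h j a)
  approx := ⟨fun _ => φ, fun _ => hφ, by simp, by simp⟩

/-- A test function supported in `Ω^N` bounds the Dirichlet energy. -/
theorem dirichletEnergy_le_of_isTest {N : ℕ} {α : ℝ} {Ω : Set (Fin 2 → ℝ)} {φ : Config N → ℂ}
    (hφ : IsTest φ) (hΩ : tsupport φ ⊆ configsIn N Ω) (h0 : ∃ x, φ x ≠ 0) {Λ : ℝ≥0∞} (hΛ : Λ ≠ ⊤)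
    (h : ∀ j a, ∫⁻ x, ‖covDeriv α j a φ x‖ₑ ^ 2 ≤ Λ * ∫⁻ x, ‖φ x‖ₑ ^ 2) :
    dirichletEnergy N α Ω ≤ 2 * N * Λ := by
  have hφd : Differentiable ℝ φ := hφ.smooth.differentiable (by simp)
  set M := ∫⁻ x, ‖φ x‖ₑ ^ 2 with hM
  have hM0 : M ≠ 0 := by
    obtain ⟨x, hx⟩ := h0
    have hcont : Continuous fun x => ‖φ x‖ₑ ^ 2 :=
      (ENNReal.continuous_pow 2).comp hφ.smooth.continuous.enorm
    refine ((lintegral_pos_iff_support hcont.measurable).2 ?_).ne'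
    exact hcont.isOpen_support.measure_pos _ ⟨x, by simp [hx]⟩
  have hMt : M ≠ ⊤ := by
    have : MemLp φ 2 volume := hφ.smooth.continuous.memLp_of_hasCompactSupport hφ.compact
    rw [hM, lintegral_enorm_sq_eq]
    exact ENNReal.pow_ne_top this.2.ne
  set z : ℂ := (((Real.sqrt M.toReal)⁻¹ : ℝ) : ℂ) with hz
  have hzn : ‖z‖ₑ ^ 2 = M⁻¹ := by
    rw [enorm_sq_eq_ofReal, hz, Complex.norm_real, Real.norm_eq_abs, sq_abs, inv_pow,
      Real.sq_sqrt ENNReal.toReal_nonneg, ENNReal.ofReal_inv_of_pos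
        (ENNReal.toReal_pos hM0 hMt), ENNReal.ofReal_toReal hMt]
  have hscale : ∀ u : Config N → ℂ, ∫⁻ x, ‖z * u x‖ₑ ^ 2 = M⁻¹ * ∫⁻ x, ‖u x‖ₑ ^ 2 := by
    intro u
    simp only [enorm_mul, mul_pow, hzn]
    rw [lintegral_const_mul' _ _ (by simpa using hM0)]
  have hgrad : ∀ j a, ∫⁻ x, ‖covDeriv α j a (fun x => z * φ x) x‖ₑ ^ 2 ≤ Λ := by
    intro j a
    simp only [covDeriv_const_mul α hφd]
    rw [hscale]
    calc _ ≤ M⁻¹ * (Λ * M) := mul_le_mul' le_rfl (h j a)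
      _ = Λ * (M⁻¹ * M) := by ring
      _ = Λ := by rw [ENNReal.inv_mul_cancel hM0 hMt, mul_one]
  have htest := hφ.const_mul z
  have hsupp : ∀ x ∉ configsIn N Ω, φ x = 0 := fun x hx =>
    image_eq_zero_of_notMem_tsupport fun h => hx (hΩ h)
  have hnorm : ∫⁻ x in configsIn N Ω, ‖z * φ x‖ₑ ^ 2 = 1 := by
    rw [setLIntegral_eq_of_support_subset, hscale, ENNReal.inv_mul_cancel hM0 hMt]
    intro x hx
    by_contra hx'
    simp [hsupp x hx'] at hx
  have hle : dirichletEnergy N α Ω ≤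
      kineticEnergy Ω fun j a => covDeriv α j a fun x => z * φ x :=
    sInf_le ⟨_, _, htest.isCovGrad fun j a => ((hgrad j a).trans_lt hΛ.lt_top).ne,
      ⟨tsupport φ, hφ.compact, hΩ, Eventually.of_forall fun x hx => by
        rw [image_eq_zero_of_notMem_tsupport hx, mul_zero]⟩, hnorm, rfl⟩
  calc _ ≤ _ := hle
    _ ≤ ∑ j : Fin N, ∑ _a : Fin 2, Λ := by
        refine Finset.sum_le_sum fun j _ => ?_
        refine (setLIntegral_le_lintegral _ _).trans ?_
        rw [lintegral_finsetSum _ fun a _ =>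
          (measurable_covDeriv htest.contDiff_one j a).enorm.pow_const 2]
        exact Finset.sum_le_sum fun a _ => hgrad j a
    _ = 2 * N * Λ := by simp; ring

namespace TrialData

variable {α : ℝ} {n : ℕ} {B : Type} [LinearOrder B] (D : TrialData α n B) {N : ℕ}

theorem psi_comp (c : Fin N → B) (σ : Equiv.Perm (Fin N)) (x : Config N) :
    D.psi (c ∘ σ) (x ∘ σ) = D.psi c x := by
  have h1 : D.amp (c ∘ σ) Finset.univ (x ∘ σ) = D.amp c Finset.univ x := by
    have hpf : ∀ j k, D.pairFactor (c ∘ σ) (x ∘ σ) j k = D.pairFactor c x (σ j) (σ k) := by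
      intro j k; simp [pairFactor]
    simp only [amp, hpf, Function.comp]
    rw [Equiv.prod_comp σ fun j => D.f (c j) (x j),
      Equiv.prod_comp σ fun j => ∏ k, D.pairFactor c x j (σ k)]
    congr 1
    exact Finset.prod_congr rfl fun j _ => Equiv.prod_comp σ fun k => D.pairFactor c x j k
  have h2 : boxPhase (c ∘ σ) (x ∘ σ) = boxPhase c x := by
    simp only [boxPhase, Function.comp]
    rw [Equiv.sum_comp σ fun j => ∑ k, if c (σ k) < c j then
      Complex.arg (ofPlane (x j - x (σ k))) else 0]
    exact Finset.sum_congr rfl fun j _ => Equiv.sum_comp σ fun k => if c k < c j then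
      Complex.arg (ofPlane (x j - x k)) else 0
  rw [psi, psi, h1, h2]

/-- The configurations allowed by `psi c`. -/
def core (c : Fin N → B) : Set (Config N) :=
  D.region c ∩ {x | ∀ j k, j ≠ k → c j = c k → x j - x k ∈ tsupport D.g}

theorem isCompact_core (c : Fin N → B) : IsCompact (D.core c) := by
  refine D.isCompact_region.inter_right ?_
  simp only [Set.ofPred_forall]
  refine isClosed_iInter fun j => isClosed_iInter fun k => isClosed_iInter fun _ =>
    isClosed_iInter fun _ => ?_
  exact (isClosed_tsupport D.g).preimage ((continuous_apply j).sub (continuous_apply k))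

theorem mem_core_of_psi_ne_zero {c : Fin N → B} {x : Config N} (h : D.psi c x ≠ 0) :
    x ∈ D.core c := by
  refine ⟨by_contra fun hx => h (D.psi_eq_zero hx), fun j k hjk hc => subset_tsupport _ ?_⟩
  intro hg
  apply h
  have : D.pairFactor c x j k = 0 := by rw [pairFactor, if_pos ⟨hjk, hc⟩, hg]
  have h0 : ∏ j, ∏ k, D.pairFactor c x j k = 0 :=
    Finset.prod_eq_zero (Finset.mem_univ j) (Finset.prod_eq_zero (Finset.mem_univ k) this)
  rw [psi, amp, h0]
  simp

theorem disjoint_core_diagonals (c : Fin N → B) : Disjoint (D.core c) (diagonals N) := by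
  rw [Set.disjoint_left]
  rintro x ⟨hx, hg⟩ ⟨j, k, hjk, hxjk⟩
  have h0 : ofPlane 0 ∉ Complex.slitPlane := by
    have : ofPlane 0 = 0 := rfl
    rw [this]; simp
  rcases lt_trichotomy (c j) (c k) with h | h | h
  · have := D.slitPlane_of_mem_region hx k j h
    rw [hxjk, sub_self] at this; exact h0 this
  · have := hg j k hjk h
    rw [hxjk, sub_self] at this; exact D.g_zero this
  · have := D.slitPlane_of_mem_region hx j k h
    rw [hxjk, sub_self] at this; exact h0 this

variable [Fintype B]

variable (n B N) in
/-- The distributions of the particles over the boxes with at most `n` particles per box. -/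
def distributions : Finset (Fin N → B) :=
  Finset.univ.filter fun c => ∀ b, (Finset.univ.filter fun k => c k = b).card ≤ n

theorem mem_distributions {c : Fin N → B} :
    c ∈ distributions n B N ↔ ∀ b, (Finset.univ.filter fun k => c k = b).card ≤ n := by
  simp [distributions]

/-- The symmetric trial state. -/
def phi (x : Config N) : ℂ := ∑ c ∈ distributions n B N, D.psi c x

theorem comp_mem_distributions {c : Fin N → B} (hc : c ∈ distributions n B N)
    (σ : Equiv.Perm (Fin N)) : c ∘ σ ∈ distributions n B N := by
  rw [mem_distributions] at hc ⊢
  intro b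
  refine le_trans (le_of_eq ?_) (hc b)
  exact Finset.card_equiv σ (by simp)

theorem phi_comp (σ : Equiv.Perm (Fin N)) (x : Config N) : D.phi (x ∘ σ) = D.phi x := by
  refine Finset.sum_bij' (fun c _ => c ∘ σ.symm) (fun c _ => c ∘ σ)
    (fun c hc => comp_mem_distributions hc _) (fun c hc => comp_mem_distributions hc _)
    (fun c _ => by ext j; simp) (fun c _ => by ext j; simp) fun c _ => ?_
  rw [← D.psi_comp (c ∘ σ.symm) σ x]
  congr 1
  ext j; simp

theorem tsupport_phi_subset : tsupport (D.phi (N := N)) ⊆ ⋃ c, D.core c := by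
  refine closure_minimal (fun x hx => ?_) (isClosed_iUnion_of_finite fun c =>
    (D.isCompact_core c).isClosed)
  obtain ⟨c, _, hc⟩ := Finset.exists_ne_zero_of_sum_ne_zero hx
  exact Set.mem_iUnion.2 ⟨c, D.mem_core_of_psi_ne_zero hc⟩

theorem isTest_phi : IsTest (D.phi (N := N)) where
  smooth := ContDiff.sum fun _ _ => D.contDiff_psi
  compact := (isCompact_iUnion fun c => D.isCompact_core c).of_isClosed_subset
    (isClosed_tsupport _) D.tsupport_phi_subset
  off_diagonals := (Set.disjoint_iUnion_left.2 fun c => D.disjoint_core_diagonals c).mono_left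
    D.tsupport_phi_subset
  symm := D.phi_comp

theorem enorm_phi_sq (x : Config N) :
    ‖D.phi x‖ₑ ^ 2 = ∑ c ∈ distributions n B N, ‖D.psi c x‖ₑ ^ 2 :=
  enorm_sum_sq_eq _ fun _ _ _ _ h h' => D.eq_of_mem_region
    (D.mem_core_of_psi_ne_zero h).1 (D.mem_core_of_psi_ne_zero h').1

/-- At each point at most one distribution contributes, so norm and energy are both sums over
distributions and the bound holds term by term. -/
theorem lintegral_covDeriv_phi_le (j : Fin N) (a : Fin 2) :
    ∫⁻ x, ‖covDeriv α j a D.phi x‖ₑ ^ 2 ≤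
      (4 * D.T + 36 * (n * D.V₂ + n ^ 2 * D.V₁ ^ 2)) * ∫⁻ x : Config N, ‖D.phi x‖ₑ ^ 2 := by
  have h1 : ∀ x, ‖covDeriv α j a D.phi x‖ₑ ^ 2 =
      ∑ c ∈ distributions n B N, ‖covDeriv α j a (D.psi c) x‖ₑ ^ 2 := by
    intro x
    unfold phi
    rw [covDeriv_sum _ α fun c => D.contDiff_psi.differentiable (by simp)]
    refine enorm_sum_sq_eq _ fun c _ c' _ h h' => D.eq_of_mem_region (x := x) ?_ ?_
    · by_contra hx; exact h (D.covDeriv_psi_eq_zero a hx)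
    · by_contra hx; exact h' (D.covDeriv_psi_eq_zero a hx)
  simp only [h1, D.enorm_phi_sq]
  rw [lintegral_finsetSum _ fun c _ => (measurable_covDeriv
      (D.contDiff_psi.of_le (by exact_mod_cast le_top)) j a).enorm.pow_const 2,
    lintegral_finsetSum _ fun c _ => D.contDiff_psi.continuous.measurable.enorm.pow_const 2,
    Finset.mul_sum]
  refine Finset.sum_le_sum fun c hc => ?_
  simp only [D.enorm_psi_sq]
  exact D.lintegral_covDeriv_psi_le (mem_distributions.1 hc) j a

theorem exists_phi_ne_zero {c : Fin N → B} (hc : c ∈ distributions n B N) :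
    ∃ x, D.phi (N := N) x ≠ 0 := by
  obtain ⟨x, hx⟩ := D.exists_amp_pos (mem_distributions.1 hc) Finset.univ
  refine ⟨x, fun h => ?_⟩
  have h2 := D.enorm_phi_sq x
  rw [h, enorm_zero, zero_pow two_ne_zero, eq_comm, Finset.sum_eq_zero_iff] at h2
  have h3 := h2 c hc
  rw [D.enorm_psi_sq, ENNReal.ofReal_eq_zero] at h3
  exact absurd h3 (not_le.2 (by positivity))

theorem dirichletEnergy_le {c : Fin N → B} (hc : c ∈ distributions n B N)
    {Ω : Set (Fin 2 → ℝ)} (hΩ : ∀ b, D.K b ⊆ Ω)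
    (hfin : 4 * D.T + 36 * (n * D.V₂ + n ^ 2 * D.V₁ ^ 2) ≠ ⊤) :
    dirichletEnergy N α Ω ≤ 2 * N * (4 * D.T + 36 * (n * D.V₂ + n ^ 2 * D.V₁ ^ 2)) := by
  refine dirichletEnergy_le_of_isTest D.isTest_phi ?_ (D.exists_phi_ne_zero hc) hfin
    D.lintegral_covDeriv_phi_le
  refine D.tsupport_phi_subset.trans (Set.iUnion_subset fun c x hx j => hΩ (c j) (hx.1 j trivial))

end TrialData

/-! ### Radial integrals and the logarithmic cutoff -/

theorem lintegral_radial {ρ : ℝ} {F : ℝ → ℝ≥0∞} (hF : Measurable F) (hρ : ∀ r, ρ ≤ r → F r = 0) :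
    ∫⁻ p, F ‖ofPlane p‖ =
      ENNReal.ofReal (2 * Real.pi) * ∫⁻ r in Set.Ioo 0 ρ, ENNReal.ofReal r * F r := by
  have hF' : Measurable fun z : ℂ => F ‖z‖ := hF.comp measurable_norm
  rw [lintegral_plane]
  simp only [ofPlane_toPlane]
  rw [← setLIntegral_eq_of_support_subset (s := Metric.ball (0 : ℂ) ρ), lintegral_ball_polar _ hF',
    ← lintegral_const_mul' _ _ ENNReal.ofReal_ne_top]
  · refine setLIntegral_congr_fun measurableSet_Ioo fun r hr => ?_
    have hn : ∀ θ : ℝ, ‖(r : ℂ) * Complex.exp (θ * Complex.I)‖ = r := fun θ => by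
      rw [norm_mul, Complex.norm_exp_ofReal_mul_I, mul_one, Complex.norm_real,
        Real.norm_of_nonneg hr.1.le]
    simp only [hn, lintegral_const, Measure.restrict_apply_univ, Real.volume_Ioc]
    rw [mul_comm]
    congr 2
    ring
  · intro z hz
    rw [Metric.mem_ball, dist_zero_right]
    by_contra h
    exact hz (hρ _ (not_lt.1 h))

/-- The function `c / r` on `[r₀, R)`. -/
def annulusInv (c r₀ R : ℝ) : ℝ → ℝ≥0∞ := (Set.Ico r₀ R).indicator fun r => ENNReal.ofReal (c / r)

theorem measurable_annulusInv (c r₀ R : ℝ) : Measurable (annulusInv c r₀ R) :=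
  (measurable_const.div measurable_id).ennreal_ofReal.indicator measurableSet_Ico

theorem annulusInv_eq_zero {c r₀ R r : ℝ} (h : R ≤ r) : annulusInv c r₀ R r = 0 :=
  Set.indicator_of_notMem (fun h' => not_lt.2 h h'.2) _

theorem lintegral_annulusInv_le {c r₀ R : ℝ} (hc : 0 ≤ c) :
    ∫⁻ p, annulusInv c r₀ R ‖ofPlane p‖ ≤ ENNReal.ofReal (2 * Real.pi * c * R) := by
  rw [lintegral_radial (measurable_annulusInv c r₀ R) fun r => annulusInv_eq_zero]
  calc _ ≤ ENNReal.ofReal (2 * Real.pi) * ∫⁻ _r in Set.Ioo 0 R, ENNReal.ofReal c := by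
        refine mul_le_mul' le_rfl (setLIntegral_mono' measurableSet_Ioo fun r hr => ?_)
        rw [annulusInv, Set.indicator_apply]
        split_ifs
        · rw [← ENNReal.ofReal_mul hr.1.le, mul_div_cancel₀ _ hr.1.ne']
        · simp
    _ = _ := by
        rw [lintegral_const, Measure.restrict_apply_univ, Real.volume_Ioo, sub_zero,
          ← ENNReal.ofReal_mul hc, ← ENNReal.ofReal_mul (by positivity)]
        congr 1; ring

/-- The area element turns `1 / r²` into `1 / r`. The resulting logarithm, of order `κ` for the
annulus used below, is outweighed by the prefactor `1 / κ²`. -/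
theorem lintegral_annulusInv_sq_le {c r₀ R : ℝ} (h0 : 0 < r₀) (hR : r₀ ≤ R) :
    ∫⁻ p, annulusInv c r₀ R ‖ofPlane p‖ ^ 2 ≤
      ENNReal.ofReal (2 * Real.pi * c ^ 2 * Real.log (R / r₀)) := by
  rw [lintegral_radial (ρ := R) ((measurable_annulusInv c r₀ R).pow_const 2) fun r hr => by
    rw [annulusInv_eq_zero hr, zero_pow two_ne_zero]]
  have hI : ∫⁻ r in Set.Ico r₀ R, ENNReal.ofReal (c ^ 2 * r⁻¹) =
      ENNReal.ofReal (c ^ 2 * Real.log (R / r₀)) := by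
    have hcont : ContinuousOn (fun r : ℝ => c ^ 2 * r⁻¹) (Set.Icc r₀ R) :=
      continuousOn_const.mul (continuousOn_inv₀.mono fun r hr => (h0.trans_le hr.1).ne')
    rw [restrict_Ico_eq_restrict_Ioc, ← ofReal_integral_eq_lintegral_ofReal
      ((hcont.integrableOn_Icc).mono_set Set.Ioc_subset_Icc_self), ← intervalIntegral.integral_of_le hR,
      intervalIntegral.integral_const_mul, integral_inv_of_pos h0 (h0.trans_le hR)]
    exact (ae_restrict_iff' measurableSet_Ioc).2 (ae_of_all _ fun r hr =>
      mul_nonneg (sq_nonneg c) (inv_nonneg.2 (h0.trans hr.1).le))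
  calc _ ≤ ENNReal.ofReal (2 * Real.pi) * ∫⁻ r in Set.Ico r₀ R, ENNReal.ofReal (c ^ 2 * r⁻¹) := by
        refine mul_le_mul' le_rfl ?_
        rw [← lintegral_indicator measurableSet_Ioo, ← lintegral_indicator measurableSet_Ico]
        refine lintegral_mono fun r => ?_
        rw [Set.indicator_apply, Set.indicator_apply, annulusInv, Set.indicator_apply]
        by_cases hr : r ∈ Set.Ico r₀ R
        · have hr0 : 0 < r := h0.trans_le hr.1
          simp only [hr, if_true]
          split_ifs
          · rcases le_total 0 c with hc | hc
            · rw [← ENNReal.ofReal_pow (div_nonneg hc hr0.le), ← ENNReal.ofReal_mul hr0.le]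
              refine ENNReal.ofReal_le_ofReal (le_of_eq ?_)
              field_simp
            · rw [ENNReal.ofReal_of_nonpos (div_nonpos_of_nonpos_of_nonneg hc hr0.le)]
              simp
          · exact zero_le
        · simp [hr]
    _ = _ := by
        rw [hI, ← ENNReal.ofReal_mul (by positivity)]
        congr 1; ring

theorem lintegral_disc {ρ : ℝ} (hρ : 0 ≤ ρ) :
    ∫⁻ p, (Set.Iio ρ).indicator (1 : ℝ → ℝ≥0∞) ‖ofPlane p‖ = ENNReal.ofReal (Real.pi * ρ ^ 2) := by
  rw [lintegral_radial (ρ := ρ) (measurable_one.indicator measurableSet_Iio) fun r hr => by simp [hr]]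
  rw [setLIntegral_congr_fun (g := fun r => ENNReal.ofReal r) measurableSet_Ioo fun r hr => by
    simp [hr.2], lintegral_ofReal_Ioo hρ, ← ENNReal.ofReal_mul (by positivity)]
  congr 1; ring

theorem norm_ofPlane_sq (p : Fin 2 → ℝ) : ‖ofPlane p‖ ^ 2 = p 0 ^ 2 + p 1 ^ 2 := by
  rw [← Complex.normSq_eq_norm_sq, Complex.normSq_apply]; simp [ofPlane]; ring

theorem abs_apply_le_norm_ofPlane (p : Fin 2 → ℝ) (a : Fin 2) : |p a| ≤ ‖ofPlane p‖ := by
  fin_cases a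
  · exact Complex.abs_re_le_norm (ofPlane p)
  · exact Complex.abs_im_le_norm (ofPlane p)

theorem abs_perpInv_le (p : Fin 2 → ℝ) (a : Fin 2) : |perpInv p a| ≤ ‖ofPlane p‖⁻¹ := by
  rw [← toPlane_ofPlane p, perpInv_toPlane, ofPlane_toPlane]
  refine (Complex.abs_im_le_norm _).trans ?_
  rw [norm_div, div_eq_mul_inv]
  refine mul_le_of_le_one_left (by positivity) ?_
  fin_cases a <;> simp [unitDir]

theorem exists_abs_deriv_smoothTransition_le :
    ∃ L : ℝ, 0 ≤ L ∧ ∀ u, |deriv Real.smoothTransition u| ≤ L := by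
  have hc : Continuous (deriv Real.smoothTransition) :=
    (Real.smoothTransition.contDiff (n := 1)).continuous_deriv le_rfl
  have hs : HasCompactSupport (deriv Real.smoothTransition) := by
    refine HasCompactSupport.intro (isCompact_Icc (a := (0 : ℝ)) (b := 1)) fun u hu => ?_
    rw [Set.mem_Icc, not_and_or, not_le, not_le] at hu
    rcases hu with hu | hu
    · have : Real.smoothTransition =ᶠ[𝓝 u] fun _ => 0 := by
        filter_upwards [Iio_mem_nhds hu] with v hv
        exact Real.smoothTransition.zero_of_nonpos (le_of_lt hv)
      rw [this.deriv_eq, deriv_const]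
    · have : Real.smoothTransition =ᶠ[𝓝 u] fun _ => 1 := by
        filter_upwards [Ioi_mem_nhds hu] with v hv
        exact Real.smoothTransition.one_of_one_le (le_of_lt hv)
      rw [this.deriv_eq, deriv_const]
  obtain ⟨L, hL⟩ := hc.bounded_above_of_compact_support hs
  exact ⟨L, (norm_nonneg _).trans (hL 0), hL⟩

/-- A smooth cutoff of the origin at the scales between `exp (-3κ) / m` and `exp (-κ) / m`, whose
gradient is of order `1 / (κ |z|)`. -/
def logCutoff (m κ : ℝ) (z : Fin 2 → ℝ) : ℝ :=
  Real.smoothTransition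
    (Real.log (m ^ 2 * (z 0 ^ 2 + z 1 ^ 2) + Real.exp (-(6 * κ))) / (2 * κ) + 2)

section LogCutoff

variable {m κ : ℝ}

theorem logCutoff_arg_pos (m κ : ℝ) (z : Fin 2 → ℝ) :
    0 < m ^ 2 * (z 0 ^ 2 + z 1 ^ 2) + Real.exp (-(6 * κ)) := by positivity

/-- The summand `exp (-6 κ)` keeps the logarithm smooth at the origin. -/
theorem contDiff_logCutoff (m κ : ℝ) : ContDiff ℝ ((⊤ : ℕ∞) : WithTop ℕ∞) (logCutoff m κ) := by
  refine Real.smoothTransition.contDiff.comp (ContDiff.add (ContDiff.div_const (ContDiff.log ?_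
    fun z => (logCutoff_arg_pos m κ z).ne') _) contDiff_const)
  fun_prop

theorem logCutoff_eq_zero (hm : 0 < m) (hκ : 1 ≤ κ) {z : Fin 2 → ℝ}
    (hz : ‖ofPlane z‖ ≤ Real.exp (-(3 * κ)) / m) : logCutoff m κ z = 0 := by
  refine Real.smoothTransition.zero_of_nonpos ?_
  rw [← norm_ofPlane_sq]
  have h1 : m ^ 2 * ‖ofPlane z‖ ^ 2 ≤ Real.exp (-(6 * κ)) := by
    rw [le_div_iff₀ hm] at hz
    have := pow_le_pow_left₀ (by positivity) hz 2
    rw [← Real.exp_nat_mul] at this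
    have e : Real.exp (-(6 * κ)) = Real.exp (((2 : ℕ) : ℝ) * -(3 * κ)) := by push_cast; ring_nf
    rw [e]
    linarith
  -- The regularization raises the bound on the argument of the logarithm to at most `2 exp (-6 κ)`,
  -- and the factor two is absorbed by `exp (2 κ)`.
  have h2 : m ^ 2 * ‖ofPlane z‖ ^ 2 + Real.exp (-(6 * κ)) ≤ Real.exp (-(4 * κ)) := by
    have h3 : Real.exp (-(4 * κ)) = Real.exp (2 * κ) * Real.exp (-(6 * κ)) := by
      rw [← Real.exp_add]; ring_nf
    have h4 : 2 ≤ Real.exp (2 * κ) := by linarith [Real.add_one_le_exp (2 * κ)]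
    rw [h3]
    nlinarith [Real.exp_pos (-(6 * κ))]
  have h5 := Real.log_le_log (by positivity) h2
  rw [Real.log_exp] at h5
  have : Real.log (m ^ 2 * ‖ofPlane z‖ ^ 2 + Real.exp (-(6 * κ))) / (2 * κ) ≤ -2 := by
    rw [div_le_iff₀ (by positivity)]; linarith
  linarith

theorem logCutoff_eq_one (hm : 0 < m) (hκ : 1 ≤ κ) {z : Fin 2 → ℝ}
    (hz : Real.exp (-κ) / m ≤ ‖ofPlane z‖) : logCutoff m κ z = 1 := by
  refine Real.smoothTransition.one_of_one_le ?_
  rw [← norm_ofPlane_sq]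
  have h1 : Real.exp (-(2 * κ)) ≤ m ^ 2 * ‖ofPlane z‖ ^ 2 + Real.exp (-(6 * κ)) := by
    rw [div_le_iff₀ hm] at hz
    have := pow_le_pow_left₀ (by positivity) hz 2
    rw [← Real.exp_nat_mul] at this
    have e : Real.exp (-(2 * κ)) = Real.exp (((2 : ℕ) : ℝ) * -κ) := by push_cast; ring_nf
    rw [e]
    nlinarith [Real.exp_pos (-(6 * κ))]
  have h5 := Real.log_le_log (by positivity) h1
  rw [Real.log_exp] at h5
  have : -1 ≤ Real.log (m ^ 2 * ‖ofPlane z‖ ^ 2 + Real.exp (-(6 * κ))) / (2 * κ) := by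
    rw [le_div_iff₀ (by positivity)]; linarith
  linarith

theorem abs_fderiv_logCutoff_le {L : ℝ} (hL : ∀ u, |deriv Real.smoothTransition u| ≤ L)
    (hκ : 0 < κ) (z : Fin 2 → ℝ) (a : Fin 2) :
    |fderiv ℝ (logCutoff m κ) z (Pi.single a 1)| ≤ L / (κ * ‖ofPlane z‖) := by
  set q := m ^ 2 * (z 0 ^ 2 + z 1 ^ 2) + Real.exp (-(6 * κ)) with hq
  have hq0 : 0 < q := logCutoff_arg_pos m κ z
  have hproj : ∀ b : Fin 2, HasFDerivAt (fun z : Fin 2 → ℝ => z b)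
      (ContinuousLinearMap.proj (R := ℝ) (φ := fun _ : Fin 2 => ℝ) b) z := fun b =>
    hasFDerivAt_apply b z
  have h1 := ((((hproj 0).pow 2).add ((hproj 1).pow 2)).const_mul (m ^ 2)).add_const
    (Real.exp (-(6 * κ)))
  have h2 := ((h1.log hq0.ne').mul_const (2 * κ)⁻¹).add_const 2
  have hS := ((Real.smoothTransition.contDiff (n := 1)).differentiable one_ne_zero
    (Real.log q / (2 * κ) + 2)).hasDerivAt
  have h3 := hS.comp_hasFDerivAt z h2
  have h4 : fderiv ℝ (logCutoff m κ) z (Pi.single a 1) =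
      deriv Real.smoothTransition (Real.log q / (2 * κ) + 2) * (m ^ 2 * z a / (q * κ)) := by
    have : HasFDerivAt (logCutoff m κ) _ z := h3
    rw [this.fderiv]
    fin_cases a <;> simp <;> field_simp <;> (left; rw [hq]; ring_nf)
  rw [h4, abs_mul, div_eq_mul_inv]
  refine mul_le_mul (hL _) ?_ (abs_nonneg _) ((abs_nonneg _).trans (hL 0))
  set r := ‖ofPlane z‖ with hr
  have hrq : m ^ 2 * r ^ 2 ≤ q := by
    rw [hr, norm_ofPlane_sq, hq]; linarith [Real.exp_pos (-(6 * κ))]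
  have hza : |z a| ≤ r := abs_apply_le_norm_ofPlane z a
  rcases (norm_nonneg (ofPlane z)).eq_or_lt with h | h
  · have hza0 : z a = 0 := abs_nonpos_iff.1 (by rw [hr, ← h] at hza; exact hza)
    rw [hza0]; simp only [mul_zero, zero_div, abs_zero]; positivity
  · rw [← hr] at h
    rw [abs_div, abs_mul, abs_of_pos (mul_pos hq0 hκ), abs_of_nonneg (sq_nonneg m),
      inv_eq_one_div, div_le_div_iff₀ (mul_pos hq0 hκ) (mul_pos hκ h)]
    calc m ^ 2 * |z a| * (κ * r) ≤ m ^ 2 * r * (κ * r) := by gcongr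
      _ = κ * (m ^ 2 * r ^ 2) := by ring
      _ ≤ κ * q := by gcongr
      _ = 1 * (q * κ) := by ring

end LogCutoff

/-! ### The grid of boxes -/

/-- A bump function on the square `[-3/8, 3/8]²`. -/
def squareBump : ContDiffBump (0 : Fin 2 → ℝ) := ⟨1 / 4, 3 / 8, by norm_num, by norm_num⟩

/-- The centre of a box of the grid of unit squares. -/
def boxCenter {m : ℕ} (b : Fin m ×ₗ Fin m) : Fin 2 → ℝ :=
  ![((ofLex b).1 : ℝ) + 1 / 2, ((ofLex b).2 : ℝ) + 1 / 2]

/-- The square of side `2 δ / m` at the centre of the box `b` of the grid of `m²` boxes. -/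
def boxSquare {m : ℕ} (b : Fin m ×ₗ Fin m) (δ : ℝ) : Set (Fin 2 → ℝ) :=
  Set.Icc (fun a => (boxCenter b a - δ) / m) fun a => (boxCenter b a + δ) / m

/-- The bump function of the box `b`. -/
def boxProfile {m : ℕ} (b : Fin m ×ₗ Fin m) (p : Fin 2 → ℝ) : ℝ :=
  squareBump ((m : ℝ) • p - boxCenter b)

section Box

variable {m : ℕ} {b : Fin m ×ₗ Fin m} {δ : ℝ} {p q : Fin 2 → ℝ}

theorem mem_boxSquare (hm : 1 ≤ m) :
    p ∈ boxSquare b δ ↔ ∀ a, |m * p a - boxCenter b a| ≤ δ := by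
  have hm' : (0 : ℝ) < m := by exact_mod_cast hm
  simp only [boxSquare, Set.mem_Icc, Pi.le_def, ← forall_and]
  refine forall_congr' fun a => ?_
  rw [div_le_iff₀ hm', le_div_iff₀ hm', abs_le]
  constructor <;> rintro ⟨h1, h2⟩ <;> constructor <;> linarith

theorem mem_boxSquare_iff_norm_le (hm : 1 ≤ m) (hδ : 0 ≤ δ) :
    p ∈ boxSquare b δ ↔ ‖(m : ℝ) • p - boxCenter b‖ ≤ δ := by
  rw [mem_boxSquare hm, pi_norm_le_iff_of_nonneg hδ]
  rfl

theorem volume_boxSquare (hm : 1 ≤ m) (hδ : 0 ≤ δ) :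
    volume (boxSquare b δ) = ENNReal.ofReal ((2 * δ / m) ^ 2) := by
  have hm' : (0 : ℝ) < m := by exact_mod_cast hm
  have h : ∀ a, (boxCenter b a + δ) / m - (boxCenter b a - δ) / m = 2 * δ / m := fun a => by ring
  rw [boxSquare, Real.volume_Icc_pi]
  simp only [h, Finset.prod_const, Finset.card_univ, Fintype.card_fin]
  rw [ENNReal.ofReal_pow (by positivity)]

theorem boxSquare_subset_unitSquare (hm : 1 ≤ m) (hδ : δ ≤ 1 / 2) :
    boxSquare b δ ⊆ unitSquare := by
  have hm' : (0 : ℝ) < m := by exact_mod_cast hm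
  have h1 : (((ofLex b).1 : ℕ) : ℝ) + 1 ≤ m := by exact_mod_cast (ofLex b).1.2
  have h2 : (((ofLex b).2 : ℕ) : ℝ) + 1 ≤ m := by exact_mod_cast (ofLex b).2.2
  have h3 : (0 : ℝ) ≤ ((ofLex b).1 : ℕ) := by positivity
  have h4 : (0 : ℝ) ≤ ((ofLex b).2 : ℕ) := by positivity
  refine Set.Icc_subset_Icc (fun a => ?_) fun a => ?_
  · refine div_nonneg ?_ hm'.le
    fin_cases a <;> simp [boxCenter] <;> linarith
  · rw [div_le_iff₀ hm']
    fin_cases a <;> simp [boxCenter] <;> linarith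

/-- The half-width `3/8 < 1/2` leaves gaps between boxes. If the first indices differ, the
lexicographic order makes the real part of the difference positive; otherwise its imaginary part is
nonzero. Either way the branch cut of `arg` is avoided. -/
theorem boxSquare_sep (hm : 1 ≤ m) {b' : Fin m ×ₗ Fin m} (hb : b' < b)
    (hp : p ∈ boxSquare b (3 / 8)) (hq : q ∈ boxSquare b' (3 / 8)) :
    ofPlane (p - q) ∈ Complex.slitPlane := by
  have hm' : (0 : ℝ) < m := by exact_mod_cast hm
  rw [mem_boxSquare hm] at hp hq
  have hpos : ∀ a, boxCenter b' a + 1 ≤ boxCenter b a → 0 < p a - q a := by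
    intro a ha
    have h1 := (abs_le.1 (hp a)).1
    have h2 := (abs_le.1 (hq a)).2
    have : 0 < m * (p a - q a) := by linarith
    exact pos_of_mul_pos_right this hm'.le
  rw [Complex.mem_slitPlane_iff]
  rcases Prod.Lex.lt_iff.1 hb with h | ⟨-, h⟩
  · left
    have h' : (((ofLex b').1 : ℕ) : ℝ) + 1 ≤ ((ofLex b).1 : ℕ) := by exact_mod_cast h
    exact hpos 0 (by simp [boxCenter]; linarith)
  · right
    have h' : (((ofLex b').2 : ℕ) : ℝ) + 1 ≤ ((ofLex b).2 : ℕ) := by exact_mod_cast h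
    exact (hpos 1 (by simp [boxCenter]; linarith)).ne'

theorem norm_ofPlane_sub_lt (hm : 1 ≤ m) (hp : p ∈ boxSquare b (3 / 8))
    (hq : q ∈ boxSquare b (3 / 8)) : ‖ofPlane (p - q)‖ < 2 / m := by
  have hm' : (0 : ℝ) < m := by exact_mod_cast hm
  rw [mem_boxSquare hm] at hp hq
  have h : ∀ a, (m * (p - q) a) ^ 2 ≤ 1 := by
    intro a
    have h1 := abs_le.1 (hp a)
    have h2 := abs_le.1 (hq a)
    rw [Pi.sub_apply, sq_le_one_iff_abs_le_one, abs_le]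
    constructor <;> linarith
  rw [lt_div_iff₀ hm']
  refine lt_of_pow_lt_pow_left₀ 2 (by norm_num) ?_
  rw [mul_pow, norm_ofPlane_sq]
  nlinarith [h 0, h 1]

theorem contDiff_boxProfile : ContDiff ℝ ((⊤ : ℕ∞) : WithTop ℕ∞) (boxProfile b) :=
  squareBump.contDiff.comp ((contDiff_const_smul (m : ℝ)).sub contDiff_const)

theorem boxProfile_mem : boxProfile b p ∈ Set.Icc (0 : ℝ) 1 :=
  ⟨squareBump.nonneg, squareBump.le_one⟩

theorem boxProfile_eq_zero (hm : 1 ≤ m) (hp : p ∉ boxSquare b (3 / 8)) : boxProfile b p = 0 := by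
  refine squareBump.zero_of_le_dist ?_
  rw [mem_boxSquare_iff_norm_le hm (by norm_num), not_le] at hp
  rw [dist_zero_right]
  exact hp.le

theorem boxProfile_eq_one (hm : 1 ≤ m) (hp : p ∈ boxSquare b (1 / 4)) : boxProfile b p = 1 := by
  refine squareBump.one_of_mem_closedBall ?_
  rw [mem_boxSquare_iff_norm_le hm (by norm_num)] at hp
  rwa [Metric.mem_closedBall, dist_zero_right]

theorem le_lintegral_boxProfile_sq (hm : 1 ≤ m) :
    ENNReal.ofReal (1 / (4 * m ^ 2)) ≤ ∫⁻ p, ENNReal.ofReal (boxProfile b p ^ 2) := by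
  calc _ = ∫⁻ _p in boxSquare b (1 / 4), (1 : ℝ≥0∞) := by
        rw [setLIntegral_one, volume_boxSquare hm (by norm_num)]
        congr 1; ring
    _ ≤ ∫⁻ p in boxSquare b (1 / 4), ENNReal.ofReal (boxProfile b p ^ 2) := by
        refine setLIntegral_mono' measurableSet_Icc fun p hp => ?_
        rw [boxProfile_eq_one hm hp]; simp
    _ ≤ _ := setLIntegral_le_lintegral _ _

/-- The Dirichlet integral is scale invariant in the plane: the squared gradient grows like `m²`, on
a square of area of order `1 / m²`. -/
theorem lintegral_fderiv_boxProfile_sq_le (hm : 1 ≤ m) {L : ℝ}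
    (hL : ∀ q, ‖fderiv ℝ squareBump q‖ ≤ L) (a : Fin 2) :
    ∫⁻ p, ‖fderiv ℝ (boxProfile b) p (Pi.single a 1)‖ₑ ^ 2 ≤ ENNReal.ofReal (L ^ 2) := by
  have hm' : (0 : ℝ) < m := by exact_mod_cast hm
  have hL0 : 0 ≤ L := (norm_nonneg _).trans (hL 0)
  have hfd : ∀ p, fderiv ℝ (boxProfile b) p (Pi.single a 1) =
      m * fderiv ℝ squareBump ((m : ℝ) • p - boxCenter b) (Pi.single a 1) := by
    intro p
    have h1 : HasFDerivAt (fun p : Fin 2 → ℝ => (m : ℝ) • p - boxCenter b)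
        ((m : ℝ) • ContinuousLinearMap.id ℝ (Fin 2 → ℝ)) p :=
      ((hasFDerivAt_id p).const_smul (m : ℝ)).sub_const _
    have h2 := ((squareBump.contDiff (n := 1)).differentiable one_ne_zero
      ((m : ℝ) • p - boxCenter b)).hasFDerivAt.comp p h1
    have h3 : HasFDerivAt (boxProfile b) _ p := h2
    rw [h3.fderiv]
    simp
  have hzero : ∀ p ∉ boxSquare b (3 / 8), fderiv ℝ (boxProfile b) p (Pi.single a 1) = 0 := by
    intro p hp
    have : boxProfile b =ᶠ[𝓝 p] fun _ => 0 := by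
      filter_upwards [isClosed_Icc.isOpen_compl.mem_nhds hp] with q hq
      exact boxProfile_eq_zero hm hq
    rw [this.fderiv_eq]; simp
  have hbound : ∀ p, ‖fderiv ℝ (boxProfile b) p (Pi.single a 1)‖ₑ ^ 2 ≤
      (boxSquare b (3 / 8)).indicator (fun _ => ENNReal.ofReal ((m * L) ^ 2)) p := by
    intro p
    by_cases hp : p ∈ boxSquare b (3 / 8)
    · rw [Set.indicator_of_mem hp, ← enorm_pow, Real.enorm_eq_ofReal (sq_nonneg _)]
      refine ENNReal.ofReal_le_ofReal ?_
      rw [← sq_abs, hfd, abs_mul, abs_of_pos hm']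
      gcongr
      calc _ ≤ ‖fderiv ℝ squareBump ((m : ℝ) • p - boxCenter b)‖ * ‖(Pi.single a 1 : Fin 2 → ℝ)‖ :=
            ContinuousLinearMap.le_opNorm _ _
        _ ≤ L * 1 := by
            refine mul_le_mul (hL _) ?_ (norm_nonneg _) hL0
            rw [Pi.norm_single]; simp
        _ = L := mul_one L
    · rw [hzero p hp]; simp
  refine (lintegral_mono hbound).trans ?_
  rw [lintegral_indicator_const (s := boxSquare b (3 / 8)) measurableSet_Icc, volume_boxSquare hm (by norm_num),
    ← ENNReal.ofReal_mul (sq_nonneg _)]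
  refine ENNReal.ofReal_le_ofReal ?_
  have : (m * L) ^ 2 * (2 * (3 / 8) / m) ^ 2 = 9 / 16 * L ^ 2 := by field_simp; ring
  rw [this]
  nlinarith [sq_nonneg L]

end Box

theorem exists_norm_fderiv_squareBump_le : ∃ L : ℝ, ∀ q, ‖fderiv ℝ squareBump q‖ ≤ L :=
  ((squareBump.contDiff (n := 1)).continuous_fderiv one_ne_zero).bounded_above_of_compact_support
    (squareBump.hasCompactSupport.fderiv ℝ)

theorem exists_mem_distributions {N n m : ℕ} (h : N ≤ n * (m * m)) :
    ∃ c, c ∈ TrialData.distributions n (Fin m ×ₗ Fin m) N := by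
  have hcard : Fintype.card (Fin N) ≤ Fintype.card (Fin n × (Fin m ×ₗ Fin m)) := by
    have : Fintype.card (Fin m ×ₗ Fin m) = Fintype.card (Fin m × Fin m) :=
      Fintype.card_congr ofLex
    simpa [this] using h
  obtain ⟨ι⟩ := Function.Embedding.nonempty_of_card_le hcard
  refine ⟨fun k => (ι k).2, TrialData.mem_distributions.2 fun b => ?_⟩
  have := Finset.card_le_card_of_injOn (s := Finset.univ.filter fun k => (ι k).2 = b)
    (t := (Finset.univ : Finset (Fin n))) (fun k => (ι k).1) (by simp) (by
      intro k hk l hl hkl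
      simp only [Finset.coe_filter, Finset.mem_univ, true_and, Set.mem_ofPred_eq] at hk hl
      exact ι.injective (Prod.ext hkl (hk.trans hl.symm)))
  simpa using this

/-! ### Interaction weight and grid trial states -/

/-- The weight that dominates the interaction of two particles of the same box. -/
def cutoffWeight (c m κ : ℝ) (z : Fin 2 → ℝ) : ℝ≥0∞ :=
  annulusInv (c / κ) (Real.exp (-(3 * κ)) / m) (2 / m) ‖ofPlane z‖

section CutoffWeight

variable {c m κ : ℝ} {z : Fin 2 → ℝ}

theorem ofReal_le_cutoffWeight (h0 : Real.exp (-(3 * κ)) / m ≤ ‖ofPlane z‖)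
    (hz : ‖ofPlane z‖ < 2 / m) : ENNReal.ofReal (c / κ / ‖ofPlane z‖) ≤ cutoffWeight c m κ z := by
  rw [cutoffWeight, annulusInv, Set.indicator_of_mem (Set.mem_Ico.2 ⟨h0, hz⟩)]

theorem enorm_fderiv_logCutoff_le {L : ℝ} (hL : ∀ u, |deriv Real.smoothTransition u| ≤ L)
    (hLc : L ≤ c) (hm : 0 < m) (hκ : 1 ≤ κ) (hz : ‖ofPlane z‖ < 2 / m) (a : Fin 2) :
    ‖fderiv ℝ (logCutoff m κ) z (Pi.single a 1)‖ₑ ≤ cutoffWeight c m κ z := by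
  rcases lt_or_ge ‖ofPlane z‖ (Real.exp (-(3 * κ)) / m) with h | h
  · have hopen : IsOpen {y : Fin 2 → ℝ | ‖ofPlane y‖ < Real.exp (-(3 * κ)) / m} :=
      isOpen_lt (contDiff_ofPlane (r := 0)).continuous.norm continuous_const
    have : logCutoff m κ =ᶠ[𝓝 z] fun _ => 0 := by
      filter_upwards [hopen.mem_nhds h] with y hy
      exact logCutoff_eq_zero hm hκ (le_of_lt hy)
    rw [this.fderiv_eq]; simp
  · refine le_trans ?_ (ofReal_le_cutoffWeight h hz)
    rw [Real.enorm_eq_ofReal_abs]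
    refine ENNReal.ofReal_le_ofReal ((abs_fderiv_logCutoff_le hL (by linarith) z a).trans ?_)
    rw [← div_div]
    gcongr

theorem enorm_pot_mul_logCutoff_le {α : ℝ} (hα : 0 ≤ α) (hαc : α ≤ c / κ) (hm : 0 < m)
    (hκ : 1 ≤ κ) (hz : ‖ofPlane z‖ < 2 / m) (a : Fin 2) :
    ‖α * perpInv z a * logCutoff m κ z‖ₑ ≤ cutoffWeight c m κ z := by
  rcases lt_or_ge ‖ofPlane z‖ (Real.exp (-(3 * κ)) / m) with h | h
  · rw [logCutoff_eq_zero hm hκ h.le]; simp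
  · refine le_trans ?_ (ofReal_le_cutoffWeight h hz)
    rw [Real.enorm_eq_ofReal_abs]
    refine ENNReal.ofReal_le_ofReal ?_
    have hg : |logCutoff m κ z| ≤ 1 := by
      unfold logCutoff
      rw [abs_of_nonneg (Real.smoothTransition.nonneg _)]; exact Real.smoothTransition.le_one _
    rw [abs_mul, abs_mul, abs_of_nonneg hα, div_eq_mul_inv (c / κ)]
    refine (mul_le_of_le_one_right (by positivity) hg).trans ?_
    exact mul_le_mul hαc (abs_perpInv_le z a) (abs_nonneg _) (hα.trans hαc)

theorem measurable_cutoffWeight : Measurable (cutoffWeight c m κ) :=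
  (measurable_annulusInv _ _ _).comp (contDiff_ofPlane (r := 0)).continuous.norm.measurable

theorem lintegral_cutoffWeight_le (hc : 0 ≤ c) (hκ : 0 < κ) :
    ∫⁻ z, cutoffWeight c m κ z ≤ ENNReal.ofReal (4 * Real.pi * c / (κ * m)) := by
  refine (lintegral_annulusInv_le (by positivity)).trans (le_of_eq ?_)
  congr 1
  field_simp
  ring

theorem lintegral_cutoffWeight_sq_le (hm : 0 < m) (hκ : 1 ≤ κ) :
    ∫⁻ z, cutoffWeight c m κ z ^ 2 ≤ ENNReal.ofReal (8 * Real.pi * c ^ 2 / κ) := by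
  have he : Real.exp (-(3 * κ)) ≤ 1 := by rw [Real.exp_le_one_iff]; linarith
  refine (lintegral_annulusInv_sq_le (by positivity) (by gcongr; linarith)).trans
    (ENNReal.ofReal_le_ofReal ?_)
  have hlog : Real.log (2 / m / (Real.exp (-(3 * κ)) / m)) ≤ 4 * κ := by
    have : 2 / m / (Real.exp (-(3 * κ)) / m) = 2 / Real.exp (-(3 * κ)) := by field_simp
    rw [this, Real.log_div two_ne_zero (Real.exp_pos _).ne', Real.log_exp]
    linarith [Real.log_le_sub_one_of_pos (zero_lt_two (α := ℝ))]
  calc _ ≤ 2 * Real.pi * (c / κ) ^ 2 * (4 * κ) := by gcongr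
    _ = _ := by field_simp; ring

end CutoffWeight

/-- The trial state on the grid of `m²` boxes with at most `n` particles per box. -/
def gridTrialData {α : ℝ} (hα : 0 ≤ α) {n m : ℕ} (hn : 1 ≤ n) (hm : 1 ≤ m) (hαn : α * n ≤ 1)
    {L L' : ℝ} (hL0 : 0 ≤ L) (hL : ∀ u, |deriv Real.smoothTransition u| ≤ L)
    (hL' : ∀ q, ‖fderiv ℝ squareBump q‖ ≤ L') : TrialData α n (Fin m ×ₗ Fin m) :=
  have hm' : (0 : ℝ) < m := by exact_mod_cast hm
  have hn' : (1 : ℝ) ≤ n := by exact_mod_cast hn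
  have hκ : (1 : ℝ) ≤ 20 * n := by linarith
  { f := boxProfile
    K := fun b => boxSquare b (3 / 8)
    -- The value `κ = 20 n` makes the `n` excluded discs, of radius `exp (-κ) / m`, negligible in
    -- area. From `α n ≤ 1` comes `α ≤ 20 / κ`, whence the `20` in the constant `L + 20` of the
    -- weight.
    g := logCutoff m (20 * n)
    w := cutoffWeight (L + 20) m (20 * n)
    e := fun z => (Set.Iio (Real.exp (-(20 * n)) / m)).indicator 1 ‖ofPlane z‖
    -- The profile equals one on a square of area `1 / (4 m²) = 2 A`.
    A := ENNReal.ofReal (1 / (8 * m ^ 2))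
    T := ENNReal.ofReal (8 * m ^ 2 * L' ^ 2)
    -- Orders `m / n` here and `m² / n` for `V₂`, so that `n² V₁²` and `n V₂` are both of order
    -- `m²`, like `T`.
    V₁ := ENNReal.ofReal (2 * Real.pi * (L + 20) * m / n)
    V₂ := ENNReal.ofReal (4 * Real.pi * (L + 20) ^ 2 * m ^ 2 / n)
    f_smooth := fun _ => contDiff_boxProfile
    f_mem := fun _ _ => boxProfile_mem
    K_compact := fun _ => isCompact_Icc
    f_eq_zero := fun _ _ hp => boxProfile_eq_zero hm hp
    sep := fun _ _ hb _ hp _ hq => boxSquare_sep hm hb hp hq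
    g_smooth := contDiff_logCutoff _ _
    g_mem := fun _ => ⟨Real.smoothTransition.nonneg _, Real.smoothTransition.le_one _⟩
    g_neg := fun z => by simp [logCutoff]
    g_zero := by
      rw [notMem_tsupport_iff_eventuallyEq]
      have hopen : IsOpen {y : Fin 2 → ℝ | ‖ofPlane y‖ < Real.exp (-(3 * (20 * n : ℝ))) / m} :=
        isOpen_lt (contDiff_ofPlane (r := 0)).continuous.norm continuous_const
      filter_upwards [hopen.mem_nhds (by
        have : ofPlane 0 = 0 := rfl
        rw [Set.mem_ofPred_eq, this, norm_zero]; positivity)] with y hy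
      exact logCutoff_eq_zero hm' hκ (le_of_lt hy)
    w_meas := measurable_cutoffWeight
    e_meas := (measurable_one.indicator measurableSet_Iio).comp
      (contDiff_ofPlane (r := 0)).continuous.norm.measurable
    one_le_e := fun z hz => by
      rw [Set.indicator_of_mem]
      · simp
      · exact not_le.1 fun h => hz (logCutoff_eq_one hm' hκ h)
    deriv_le := fun _ _ hp _ hq a =>
      enorm_fderiv_logCutoff_le hL (by linarith) hm' hκ (norm_ofPlane_sub_lt hm hp hq) a
    pot_le := fun _ _ hp _ hq a =>
      enorm_pot_mul_logCutoff_le hα (by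
        rw [le_div_iff₀ (by linarith)]; linarith) hm' hκ (norm_ofPlane_sub_lt hm hp hq) a
    A_ne_zero := by
      rw [Ne, ENNReal.ofReal_eq_zero, not_le]; positivity
    A_ne_top := ENNReal.ofReal_ne_top
    mass := fun b => by
      refine le_trans (le_of_eq ?_) (le_lintegral_boxProfile_sq hm)
      rw [← ENNReal.ofReal_ofNat 2, ← ENNReal.ofReal_mul (by norm_num)]
      congr 1
      field_simp
      norm_num
    lintegral_e := by
      rw [lintegral_disc (by positivity), ← ENNReal.ofReal_natCast,
        ← ENNReal.ofReal_mul (by positivity)]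
      refine ENNReal.ofReal_le_ofReal ?_
      have h1 : 40 * (n : ℝ) * Real.exp (-(20 * n)) ^ 2 ≤ 1 := by
        rw [← Real.exp_nat_mul]
        have h2 := Real.add_one_le_exp (40 * (n : ℝ))
        have h3 : Real.exp (40 * (n : ℝ)) * Real.exp (((2 : ℕ) : ℝ) * -(20 * n)) = 1 := by
          rw [← Real.exp_add, Real.exp_eq_one_iff]; push_cast; ring
        nlinarith [Real.exp_pos (((2 : ℕ) : ℝ) * -(20 * (n : ℝ)))]
      have hpi := Real.pi_lt_four
      rw [div_pow, le_div_iff₀ (by positivity)]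
      have e : (n : ℝ) * (Real.pi * (Real.exp (-(20 * n)) ^ 2 / m ^ 2)) * (8 * m ^ 2) =
          Real.pi / 5 * (40 * (n : ℝ) * Real.exp (-(20 * n)) ^ 2) := by
        field_simp; norm_num
      rw [e]
      have := mul_le_mul_of_nonneg_left h1 (show 0 ≤ Real.pi / 5 by positivity)
      linarith
    lintegral_deriv := fun b a => by
      refine (lintegral_fderiv_boxProfile_sq_le hm hL' a).trans (le_of_eq ?_)
      rw [← ENNReal.ofReal_mul (by positivity)]
      congr 1
      field_simp
    lintegral_w := by
      refine (lintegral_cutoffWeight_le (by linarith) (by linarith)).trans ?_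
      rw [← ENNReal.ofReal_mul (by positivity)]
      refine ENNReal.ofReal_le_ofReal ?_
      have : (n : ℝ) ≠ 0 := by positivity
      have e : 1 / (8 * (m : ℝ) ^ 2) * (2 * Real.pi * (L + 20) * m / n) =
          5 * Real.pi * (L + 20) / (20 * n * m) := by
        field_simp; norm_num
      rw [e]
      gcongr
      norm_num
    lintegral_w_sq := by
      refine (lintegral_cutoffWeight_sq_le hm' hκ).trans ?_
      rw [← ENNReal.ofReal_mul (by positivity)]
      refine ENNReal.ofReal_le_ofReal ?_
      have : (n : ℝ) ≠ 0 := by positivity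
      have e : 1 / (8 * (m : ℝ) ^ 2) * (4 * Real.pi * (L + 20) ^ 2 * m ^ 2 / n) =
          10 * Real.pi * (L + 20) ^ 2 / (20 * n) := by
        field_simp; norm_num
      rw [e]
      gcongr
      norm_num }

theorem exists_dirichletEnergy_le_of_grid : ∃ C : ℝ, 0 ≤ C ∧ ∀ (α : ℝ) (N n m : ℕ), 0 ≤ α → 1 ≤ n →
    1 ≤ m → α * n ≤ 1 → N ≤ n * (m * m) →
    dirichletEnergy N α unitSquare ≤ ENNReal.ofReal (C * N * m ^ 2) := by
  obtain ⟨L, hL0, hL⟩ := exists_abs_deriv_smoothTransition_le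
  obtain ⟨L', hL'⟩ := exists_norm_fderiv_squareBump_le
  refine ⟨2 * (4 * (8 * L' ^ 2) + 36 * (4 * Real.pi * (L + 20) ^ 2 + (2 * Real.pi * (L + 20)) ^ 2)),
    by positivity, fun α N n m hα hn hm hαn hN => ?_⟩
  obtain ⟨c, hc⟩ := exists_mem_distributions hN
  have hn' : (0 : ℝ) < n := by exact_mod_cast hn
  set D := gridTrialData hα hn hm hαn hL0 hL hL' with hD
  have hT : D.T = ENNReal.ofReal (8 * m ^ 2 * L' ^ 2) := rfl
  have hV₁ : D.V₁ = ENNReal.ofReal (2 * Real.pi * (L + 20) * m / n) := rfl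
  have hV₂ : D.V₂ = ENNReal.ofReal (4 * Real.pi * (L + 20) ^ 2 * m ^ 2 / n) := rfl
  have hval : 4 * D.T + 36 * (n * D.V₂ + n ^ 2 * D.V₁ ^ 2) = ENNReal.ofReal
      (4 * (8 * m ^ 2 * L' ^ 2) + 36 * (n * (4 * Real.pi * (L + 20) ^ 2 * m ^ 2 / n) +
        n ^ 2 * (2 * Real.pi * (L + 20) * m / n) ^ 2)) := by
    rw [ENNReal.ofReal_add (by positivity) (by positivity), ENNReal.ofReal_mul (by norm_num),
      ENNReal.ofReal_mul (p := 36) (by norm_num), ENNReal.ofReal_add (by positivity) (by positivity),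
      ENNReal.ofReal_mul (p := (n : ℝ)) (by positivity),
      ENNReal.ofReal_mul (p := (n : ℝ) ^ 2) (by positivity),
      ENNReal.ofReal_pow (by positivity), ENNReal.ofReal_pow (by positivity),
      ENNReal.ofReal_natCast, ENNReal.ofReal_ofNat, ENNReal.ofReal_ofNat, hT, hV₁, hV₂]
  have key := D.dirichletEnergy_le hc (fun b => boxSquare_subset_unitSquare hm (by norm_num))
    (by rw [hval]; exact ENNReal.ofReal_ne_top)
  refine key.trans (le_of_eq ?_)
  rw [hval, ← ENNReal.ofReal_natCast, ← ENNReal.ofReal_ofNat 2, ← ENNReal.ofReal_mul (by norm_num),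
    ← ENNReal.ofReal_mul (by positivity)]
  congr 1
  field_simp

/-! ### Choice of the grid and conclusion -/

/-- All particles share one box when `α N ≤ 1`. Otherwise the integer part of `1 / α` is taken,
which for `α ≤ 1` is at least `1 / (2 α)`. -/
theorem exists_particles_per_box {α : ℝ} (h0 : 0 ≤ α) (h1 : α ≤ 1) {N : ℕ} (hN : 1 ≤ N) :
    ∃ n : ℕ, 1 ≤ n ∧ α * n ≤ 1 ∧ (N : ℝ) / n ≤ 1 + 2 * α * N := by
  have hN' : (0 : ℝ) < N := by exact_mod_cast hN
  by_cases h : α * N ≤ 1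
  · refine ⟨N, hN, h, ?_⟩
    rw [div_self hN'.ne']
    have : 0 ≤ 2 * α * N := by positivity
    linarith
  · have hα : 0 < α := by
      rcases h0.eq_or_lt with rfl | h'
      · simp at h
      · exact h'
    have hn1 : 1 ≤ ⌊1 / α⌋₊ := by
      rw [Nat.le_floor_iff (by positivity), le_div_iff₀ hα]; simpa using h1
    refine ⟨⌊1 / α⌋₊, hn1, ?_, ?_⟩
    · have := Nat.floor_le (show 0 ≤ 1 / α by positivity)
      rw [le_div_iff₀ hα] at this
      linarith
    · have h2 := Nat.lt_floor_add_one (1 / α)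
      have h3 : (1 : ℝ) ≤ (⌊1 / α⌋₊ : ℝ) := by exact_mod_cast hn1
      rw [div_lt_iff₀ hα] at h2
      rw [div_le_iff₀ (by linarith)]
      have h4 : 1 ≤ 2 * α * (⌊1 / α⌋₊ : ℝ) := by nlinarith
      nlinarith

theorem dirichletEnergy_le : ∃ C K : ℝ, 0 ≤ C ∧ 0 ≤ K ∧ ∀ α : ℝ, 0 ≤ α → α ≤ 1 → ∀ N : ℕ, 1 ≤ N →
    dirichletEnergy N α unitSquare ≤ ENNReal.ofReal (C * α * (N : ℝ) ^ 2 + K * (N : ℝ)) := by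
  obtain ⟨C, hC, h⟩ := exists_dirichletEnergy_le_of_grid
  refine ⟨4 * C, 4 * C, by positivity, by positivity, fun α h0 h1 N hN => ?_⟩
  obtain ⟨n, hn, hαn, hNn⟩ := exists_particles_per_box h0 h1 hN
  have hN' : (0 : ℝ) < N := by exact_mod_cast hN
  have hn' : (0 : ℝ) < n := by exact_mod_cast hn
  set s := Real.sqrt (N / n) with hs
  have hs0 : 0 < s := Real.sqrt_pos.2 (by positivity)
  have hs2 : s ^ 2 = N / n := Real.sq_sqrt (by positivity)
  -- The smallest `m` with `N ≤ n m²`; rounding costs `m² ≤ (s + 1)² ≤ 2 s² + 2`, hence the additive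
  -- term of order `N` in the energy.
  set m := ⌈s⌉₊ with hm
  have hm1 : 1 ≤ m := Nat.one_le_iff_ne_zero.2 (Nat.ceil_pos.2 hs0).ne'
  have hsm : s ≤ m := Nat.le_ceil s
  have hms : (m : ℝ) < s + 1 := Nat.ceil_lt_add_one hs0.le
  have hNnm : N ≤ n * (m * m) := by
    have : (N : ℝ) ≤ n * (m * m) := by
      rw [eq_div_iff hn'.ne'] at hs2
      nlinarith [mul_self_le_mul_self hs0.le hsm]
    exact_mod_cast this
  refine (h α N n m h0 hn hm1 hαn hNnm).trans (ENNReal.ofReal_le_ofReal ?_)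
  have hm2 : (m : ℝ) ^ 2 ≤ 4 + 4 * α * N := by nlinarith [sq_nonneg (s - 1)]
  calc C * N * (m : ℝ) ^ 2 ≤ C * N * (4 + 4 * α * N) := by gcongr
    _ = _ := by ring

/-- Below the cap `min` is `α` itself, and `(N + 4) (N - 1) ≥ N²` for `N ≥ 2`, so the bound already
holds for every such `N`. -/
theorem le_liminf_neumannEnergy {α : ℝ} (h0 : 0 ≤ α) (h1 : α ≤ 1 / 100000) :
    ENNReal.ofReal (Real.pi / 4 * α) ≤
      liminf (fun N : ℕ => neumannEnergy N α unitSquare / (N : ℝ≥0∞) ^ 2) atTop := by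
  refine le_liminf_of_le (by isBoundedDefault) ?_
  filter_upwards [eventually_ge_atTop 2] with N hN
  have hN' : (2 : ℝ) ≤ N := by exact_mod_cast hN
  have h := neumannEnergy_ge h0 (h1.trans (by norm_num)) (N := N) (by lia)
  rw [min_eq_left h1] at h
  rw [ENNReal.le_div_iff_mul_le (Or.inl (by simp; lia)) (Or.inl (by simp)),
    ← ENNReal.ofReal_natCast, ← ENNReal.ofReal_pow (by positivity),
    ← ENNReal.ofReal_mul (by positivity)]
  refine (ENNReal.ofReal_le_ofReal ?_).trans h
  refine mul_le_mul_of_nonneg_left ?_ (by positivity)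
  nlinarith

end Anyon

end

theorem theorem1 :
    (∃ C₁ C₂ K : ℝ, ∃ N₀ : ℕ, 0 < C₁ ∧ C₁ ≤ C₂ ∧
      ∀ α : ℝ, 0 ≤ α → α ≤ 1 → ∀ N : ℕ, N₀ ≤ N → 1 ≤ N →
        ENNReal.ofReal (C₁ * α * (N : ℝ) ^ 2 * (1 - K / (N : ℝ))) ≤
            Anyon.neumannEnergy N α Anyon.unitSquare ∧
          Anyon.neumannEnergy N α Anyon.unitSquare ≤
            Anyon.dirichletEnergy N α Anyon.unitSquare ∧
          Anyon.dirichletEnergy N α Anyon.unitSquare ≤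
            ENNReal.ofReal (C₂ * α * (N : ℝ) ^ 2 + K * (N : ℝ))) ∧
    (∃ K α₀ : ℝ, 0 < α₀ ∧ α₀ ≤ 1 ∧ ∀ α : ℝ, 0 < α → α ≤ α₀ →
      ENNReal.ofReal (Real.pi / 4 * α * (1 - K * α ^ (1 / 3 : ℝ))) ≤
        Filter.liminf
          (fun N : ℕ => Anyon.neumannEnergy N α Anyon.unitSquare / (N : ENNReal) ^ 2)
          Filter.atTop) := by
  constructor
  · obtain ⟨C, K, hC, hK, h⟩ := Anyon.dirichletEnergy_le
    -- For `α ≤ 1` the capped coupling is at least `α / 100000`, which fixes `C₁`. Adding `C₁` to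
    -- `C` only ensures `C₁ ≤ C₂`, and one `K` serves both bounds since enlarging it weakens each.
    refine ⟨Real.pi / 4 * (1 / 100000), C + Real.pi / 4 * (1 / 100000), K + 1, 1, by positivity,
      by linarith, fun α h0 h1 N _ hN => ⟨?_, Anyon.neumannEnergy_le_dirichletEnergy _ _ _, ?_⟩⟩
    · refine (ENNReal.ofReal_le_ofReal ?_).trans (Anyon.neumannEnergy_ge h0 h1 hN)
      have hN' : (1 : ℝ) ≤ N := by exact_mod_cast hN
      have hm : 1 / 100000 * α ≤ min α (1 / 100000) := le_min (by linarith) (by linarith)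
      have e : (N : ℝ) ^ 2 * (1 - (K + 1) / N) ≤ (N + 4) * (N - 1) := by
        have : (N : ℝ) ^ 2 * (1 - (K + 1) / N) = N ^ 2 - (K + 1) * N := by
          field_simp
        rw [this]; nlinarith
      calc _ = Real.pi / 4 * (1 / 100000 * α) * ((N : ℝ) ^ 2 * (1 - (K + 1) / N)) := by ring
        _ ≤ Real.pi / 4 * (1 / 100000 * α) * (((N : ℝ) + 4) * (N - 1)) := by gcongr
        _ ≤ _ := by
          have : (0 : ℝ) ≤ (N + 4) * (N - 1) := mul_nonneg (by linarith) (by linarith)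
          gcongr
    · refine (h α h0 h1 N hN).trans (ENNReal.ofReal_le_ofReal ?_)
      have h2 : 0 ≤ Real.pi / 4 * (1 / 100000) * α * (N : ℝ) ^ 2 := by positivity
      have h3 : (0 : ℝ) ≤ N := by positivity
      linarith
  -- No correction in `α` is needed, so the error constant is zero; `α₀` is the cap of the
  -- two-particle bound.
  · refine ⟨0, 1 / 100000, by norm_num, by norm_num, fun α h0 h1 => ?_⟩
    simpa using Anyon.le_liminf_neumannEnergy h0.le h1
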